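/- **Setting.** Let $n,r,s\ge 0$, let $q$ be an indeterminate, $\xi=q-q^{-1}$, $\mathtt I=\{\pm1,\dots,\pm n\}$, and $|i|=1$ for $i<0$, $|i|=0$ for $i>0$. Let $V_q$ be the superspace over $\mathbb C(q)$ with basis $v_i$ ($i\in\mathtt I$) of parity $|i|$, let $w_i$ be the dual basis of $V_q^*$, and let $V_q^{r,s}=V_q^{\otimes r}\otimes (V_q^*)^{\otimes s}$. Let $E_{ij}$ be the matrix units in $\mathrm{End}(V_q)$, of parity $|i|+|j|$; the same symbols denote the matrix units of $\mathrm{End}(V_q^*)$ in the basis $(w_i)$. All tensor products of operators and algebras follow the super sign rule. The supertranspose is $E_{ij}^{\tt T}=(-1)^{(|i|+|j|)|i|}E_{ji}$, and $(X\otimes Y)^{\tt T}=X^{\tt T}\otimes Y^{\tt T}$. Put $$S=\sum_{i,j}q^{(\delta_{ij}+\delta_{i,-j})(1-2|j|)}E_{ii}\otimes E_{jj}+\xi\sum_{i<j}(-1)^{|i|}(E_{ji}+E_{-j,-i})\otimes E_{ij},$$ $$P=\sum_{i,j}(-1)^{|j|}E_{ij}\otimes E_{ji},\qquad \Phi=\sum_i(-1)^{|i|}E_{i,-i}.$$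 **The quantum queer superalgebra.** $U_q(\mathfrak q(n))$ is the $\mathbb C(q)$-superalgebra generated by $u_{ij}$ ($i\le j$ in $\mathtt I$), of parity $|i|+|j|$, with relations $u_{ii}u_{-i,-i}=1=u_{-i,-i}u_{ii}$ and $U^{12}U^{13}S^{23}=S^{23}U^{13}U^{12}$, where $U=\sum_{i\le j}u_{ij}\otimes E_{ij}$. It acts on $V_q$ by $u_{ij}\mapsto S_{ij}$, where $S=\sum S_{ij}\otimes E_{ij}$; on $V_q^*$ through the antipode $U\mapsto U^{-1}$, i.e. $u_{ij}\mapsto ((S^{-1})_{ij})^{\tt T}$; and on $V_q^{r,s}$ through the coproduct $\Delta(u_{ij})=\sum_k(-1)^{(|i|+|k|)(|k|+|j|)}u_{ik}\otimes u_{kj}$. **The quantum walled Brauer-Clifford superalgebra.** $BC_{r,s}(q)$ is the $\mathbb C(q)$-superalgebra with even generators $t_1,\dots,t_{r-1}$, $t_1^*,\dots,t_{s-1}^*$ and (if $r,s\ge1$) $e$, odd generators $c_1,\dots,c_r$, $c_1^*,\dots,c_s^*$, and the following relations, for all indices for which they make sense: - $t_i^2-\xi t_i-1=0$, $t_it_{i+1}t_i=t_{i+1}t_it_{i+1}$,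 $t_it_j=t_jt_i$ ($|i-j|>1$); the same relations for the $t_i^*$; $t_it_j^*=t_j^*t_i$; - $e^2=0$, $e\,t_{r-1}e=e$, $e\,t_1^*e=e$, $e\,t_j=t_je$ ($j\ne r-1$), $e\,t_j^*=t_j^*e$ ($j\neq1$), $e\,t_{r-1}^{-1}t_1^*e\,t_1^*t_{r-1}^{-1}=t_{r-1}^{-1}t_1^*e\,t_1^*t_{r-1}^{-1}e$; - $c_i^2=-1$, $(c_i^*)^2=1$, $c_ic_j=-c_jc_i$ and $c_i^*c_j^*=-c_j^*c_i^*$ ($i\ne j$), $c_ic_j^*=-c_j^*c_i$; - $t_ic_i=c_{i+1}t_i$, $t_ic_j=c_jt_i$ ($j\ne i,i+1$), $t_i^*c_i^*=c_{i+1}^*t_i^*$, $t_i^*c_j^*=c_j^*t_i^*$ ($j\neq i,i+1$), $t_ic_j^*=c_j^*t_i$, $t_i^*c_j=c_jt_i^*$; - $c_re=c_1^*e$, $e\,c_r=e\,c_1^*$, $c_je=e\,c_j$ ($j\ne r$), $c_j^*e=e\,c_j^*$ ($j\ne1$), $e\,c_re=0$. **Cap and cup.** $\cap:\mathbb C(q)\to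 V_q\otimes V_q^*$ is given by $\cap(1)=\sum_iv_i\otimes w_i$, and $\cup:V_q\otimes V_q^*\to\mathbb C(q)$ by $\cup(v_i\otimes w_j)=(-1)^{|i|}q^{2i(1-2|i|)-(2n+1)}\delta_{ij}$. **Theorem.** $S$ is invertible, the above formulas define an action of the superalgebra $U_q(\mathfrak q(n))$ on $V_q^{r,s}$, and there is an action of the superalgebra $BC_{r,s}(q)$ on $V_q^{r,s}$ (a parity-preserving algebra homomorphism to $\mathrm{End}(V_q^{r,s})$) that supercommutes with the action of $U_q(\mathfrak q(n))$ and in which the generators act by $$t_i\mapsto \mathrm{id}^{\otimes(i-1)}\otimes PS\otimes\mathrm{id}^{\otimes(r+s-1-i)},\qquad c_i\mapsto\mathrm{id}^{\otimes(i-1)}\otimes\Phi\otimes\mathrm{id}^{\otimes(r+s-i)},$$ $$t_i^*\mapsto \mathrm{id}^{\otimes(r+i-1)}\otimes P^{\tt T}S^{\tt T}\otimes\mathrm{id}^{\otimes(s-1-i)},\qquad c_i^*\mapsto\mathrm{id}^{\otimes(r+i-1)}\otimes\Phi^{\tt T}\otimes\mathrm{id}^{\otimes(s-i)},$$ $$e\mapsto\mathrm{id}^{\otimes(r-1)}\otimes{\cap}{\cup}\otimes\mathrm{id}^{\otimes(s-1)}.$$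 Explicitly, when operators on $V_q^*$ are written as matrices in the basis $(w_i)$, $$PS=\sum_{i,j}(-1)^{|i|}q^{(\delta_{ij}+\delta_{i,-j})(1-2|j|)}E_{ji}\otimes E_{ij}+\xi\sum_{i<j}\bigl(E_{ii}\otimes E_{jj}-(-1)^{|i|+|j|}E_{i,-i}\otimes E_{-j,j}\bigr),$$ $$P^{\tt T}S^{\tt T}=\sum_{i,j}(-1)^{|i|}q^{(\delta_{ij}+\delta_{i,-j})(1-2|j|)}E_{ji}\otimes E_{ij}+\xi\sum_{j<i}\bigl(E_{ii}\otimes E_{jj}-E_{i,-i}\otimes E_{-j,j}\bigr),$$ $$\Phi^{\tt T}=\sum_iE_{i,-i},\qquad {\cap}{\cup}=q^{-(2n+1)}\sum_{i,j}(-1)^{|i||j|}q^{2j(1-2|j|)}E_{ij}\otimes E_{ij}.$$ -/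

import Mathlib

open scoped TensorProduct

noncomputable section

namespace QueerBC

/-! ### The base field, the index set and signs -/

/-- The field `ℂ(q)` of rational functions. -/
abbrev K : Type := RatFunc ℂ

/-- The indeterminate `q`. -/
def q : K := RatFunc.X

/-- `ξ = q - q⁻¹`. -/
def xi : K := q - q⁻¹

/-- The index set `I = {±1, …, ±n}`, ordered as a set of integers. -/
abbrev Idx (n : ℕ) : Type := {i : ℤ // i ∈ (Finset.Icc (-(n : ℤ)) (n : ℤ)).erase 0}

instance instNegIdx (n : ℕ) : Neg (Idx n) :=
  ⟨fun i => ⟨-i.1, by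
    have h := i.2
    simp only [Finset.mem_erase, Finset.mem_Icc] at h ⊢
    omega⟩⟩

/-- The parity `|i|` of an index: odd exactly for negative indices. -/
def par {n : ℕ} (i : Idx n) : ZMod 2 := if i.1 < 0 then 1 else 0

/-- The integer `1 - 2|i|`, i.e. `1` for even and `-1` for odd indices. -/
def eps {n : ℕ} (i : Idx n) : ℤ := if i.1 < 0 then -1 else 1

/-- The sign `(-1)^a` of a parity `a`. -/
def sgn (a : ZMod 2) : K := if a = 0 then 1 else -1

/-- The exponent `(δ_{ij} + δ_{i,-j}) (1 - 2|j|)`. -/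
def expo {n : ℕ} (i j : Idx n) : ℤ :=
  ((if i = j then 1 else 0) + (if i = -j then 1 else 0)) * eps j

/-! ### The superalgebra `End(V)` and the super tensor product `End(V) ⊗ End(V)` -/

/-- `End(V_q)`, as matrices in the basis `(v_i)`. -/
abbrev Mat (n : ℕ) : Type := Matrix (Idx n) (Idx n) K

/-- The matrix unit `E_{ij}`. -/
def E {n : ℕ} (i j : Idx n) : Mat n := Matrix.single i j 1

/-- The homogeneous part of parity `p` of `End(V_q)`, spanned by the `E_{ij}`
with `|i| + |j| = p`. -/
def matPart (n : ℕ) (p : ZMod 2) : Submodule K (Mat n) where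
  carrier := {X | ∀ i j, par i + par j ≠ p → X i j = 0}
  add_mem' := by
    intro X Y hX hY i j h
    simp [hX i j h, hY i j h]
  zero_mem' := by
    intro i j _
    rfl
  smul_mem' := by
    intro c X hX i j h
    simp [hX i j h]

/-- The projection of a matrix to its part of parity `p`. -/
def matProj {n : ℕ} (p : ZMod 2) (X : Mat n) : matPart n p :=
  ⟨Matrix.of fun i j => if par i + par j = p then X i j else 0, by
    intro i j h
    simp [h]⟩

instance instGradedMat (n : ℕ) : GradedAlgebra (matPart n) where
  one_mem := by
    intro i j h
    rcases eq_or_ne i j with rfl | hij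
    · exact absurd (CharTwo.add_self_eq_zero (par i)) h
    · exact Matrix.one_apply_ne hij
  mul_mem := by
    intro p p' X Y hX hY i j h
    rw [Matrix.mul_apply]
    refine Finset.sum_eq_zero fun k _ => ?_
    by_cases h1 : par i + par k = p
    · by_cases h2 : par k + par j = p'
      · exfalso
        apply h
        rw [← h1, ← h2]
        have := CharTwo.add_self_eq_zero (par k)
        linear_combination -this
      · rw [hY k j h2, mul_zero]
    · rw [hX i k h1, zero_mul]
  decompose' X := ∑ p : ZMod 2, DirectSum.of (fun p => matPart n p) p (matProj p X)
  left_inv := by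
    intro X
    rw [map_sum]
    ext i j
    simp only [DirectSum.coeAddMonoidHom_of, Matrix.sum_apply]
    simp [matProj]
  right_inv := by
    intro x
    induction x using DirectSum.induction_on with
    | zero =>
      refine Finset.sum_eq_zero fun p _ => ?_
      have : matProj p ((DirectSum.coeAddMonoidHom (matPart n)) 0) = 0 := by
        ext i j
        simp [matProj]
      rw [this, map_zero]
    | of p X =>
      change ∑ p' : ZMod 2, DirectSum.of (fun p => matPart n p) p' (matProj p'
        ((DirectSum.coeAddMonoidHom (matPart n)) (DirectSum.of (fun p => matPart n p) p X))) = _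
      rw [Finset.sum_eq_single p]
      · congr 1
        ext i j
        simp only [DirectSum.coeAddMonoidHom_of, matProj, Matrix.of_apply]
        split_ifs with h
        · rfl
        · exact (X.2 i j h).symm
      · intro p' _ hp'
        have : matProj p' ((DirectSum.coeAddMonoidHom (matPart n))
            (DirectSum.of (fun p => matPart n p) p X)) = 0 := by
          ext i j
          simp only [DirectSum.coeAddMonoidHom_of, matProj, Matrix.of_apply]
          split_ifs with h
          · exact X.2 i j (by rw [h]; exact hp')
          · rfl
        rw [this, map_zero]
      · simp
    | add x y hx hy =>
      have h : ∀ p, matProj p ((DirectSum.coeAddMonoidHom (matPart n)) (x + y)) =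
          matProj p ((DirectSum.coeAddMonoidHom (matPart n)) x) +
          matProj p ((DirectSum.coeAddMonoidHom (matPart n)) y) := by
        intro p
        ext i j
        simp only [map_add, matProj, Matrix.of_apply, Matrix.add_apply, Submodule.coe_add]
        split_ifs <;> simp
      change ∑ p : ZMod 2, DirectSum.of (fun p => matPart n p) p (matProj p
        ((DirectSum.coeAddMonoidHom (matPart n)) (x + y))) = _
      rw [Finset.sum_congr rfl fun p _ => by rw [h p, map_add], Finset.sum_add_distrib]
      exact congrArg₂ (· + ·) hx hy

/-- `End(V_q) ⊗ End(V_q)` with the super multiplication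
`(X ⊗ Y)(X' ⊗ Y') = (-1)^{|Y||X'|} XX' ⊗ YY'`. -/
abbrev Mat2 (n : ℕ) : Type := (matPart n) ᵍ⊗[K] (matPart n)

/-- The tensor `X ⊗ Y` in `End(V_q) ⊗ End(V_q)`. -/
def tens {n : ℕ} (X Y : Mat n) : Mat2 n := GradedTensorProduct.tmul K X Y

/-- The supertranspose on `End(V_q)`: `E_{ij} ↦ (-1)^{(|i|+|j|)|i|} E_{ji}`. -/
def st {n : ℕ} : Mat n →ₗ[K] Mat n where
  toFun X := Matrix.of fun j i => sgn ((par i + par j) * par i) * X i j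
  map_add' X Y := by
    ext i j
    simp [mul_add]
  map_smul' c X := by
    ext i j
    simp [mul_left_comm]

/-- The supertranspose on `End(V_q) ⊗ End(V_q)`: `(X ⊗ Y)ᵀ = Xᵀ ⊗ Yᵀ`. -/
def st2 {n : ℕ} : Mat2 n →ₗ[K] Mat2 n :=
  (GradedTensorProduct.of K (matPart n) (matPart n)).toLinearMap ∘ₗ
    TensorProduct.map st st ∘ₗ
      (GradedTensorProduct.of K (matPart n) (matPart n)).symm.toLinearMap

/-- For `X = ∑ X_{ij} ⊗ E_{ij}`, the component `X_{ij}`. -/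
def entry {n : ℕ} (i j : Idx n) : Mat2 n →ₗ[K] Mat n :=
  TensorProduct.lift
      (LinearMap.mk₂ K (fun X Y : Mat n => Y i j • X)
        (fun X X' Y => smul_add _ _ _)
        (fun c X Y => smul_comm _ _ _)
        (fun X Y Y' => by simp [add_smul])
        (fun c X Y => by simp [mul_smul])) ∘ₗ
    (GradedTensorProduct.of K (matPart n) (matPart n)).symm.toLinearMap

/-- The element `S` of `End(V_q) ⊗ End(V_q)`. -/
def S (n : ℕ) : Mat2 n :=
  (∑ i : Idx n, ∑ j : Idx n, q ^ expo i j • tens (E i i) (E j j)) +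
    xi • ∑ i : Idx n, ∑ j : Idx n,
      if i < j then sgn (par i) • tens (E j i + E (-j) (-i)) (E i j) else 0

/-- The super flip `P`. -/
def P (n : ℕ) : Mat2 n := ∑ i : Idx n, ∑ j : Idx n, sgn (par j) • tens (E i j) (E j i)

/-- The odd operator `Φ`. -/
def Phi (n : ℕ) : Mat n := ∑ i : Idx n, sgn (par i) • E i (-i)

/-! ### The quantum queer superalgebra -/

/-- For an algebra with generators `g x` of parities `π x`, the part of parity `p`: the span of
all products of generators of total parity `p`. -/
def superPart {X A : Type} [Ring A] [Algebra K A] (g : X → A) (π : X → ZMod 2) (p : ZMod 2) :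
    Submodule K A :=
  Submodule.span K {a | ∃ l : List X, (l.map π).sum = p ∧ a = (l.map g).prod}

/-- The index set of the generators `u_{ij}`, `i ≤ j`. -/
abbrev UGen (n : ℕ) : Type := {p : Idx n × Idx n // p.1 ≤ p.2}

/-- The free generator `u_{ij}` for `i ≤ j`; zero for `i > j`. -/
def uFree {n : ℕ} (i j : Idx n) : FreeAlgebra K (UGen n) :=
  if h : i ≤ j then FreeAlgebra.ι K ⟨(i, j), h⟩ else 0

/-- The defining relations of `U_q(q(n))`. The constructor `rtt a b c d` equates the coefficients
of `E_{ab} ⊗ E_{cd}` in `U¹² U¹³ S²³ = S²³ U¹³ U¹²`, where `U = ∑ u_{ij} ⊗ E_{ij}`,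
`|u_{ij}| = |i| + |j|` and products are taken in the super tensor product
`U_q(q(n)) ⊗ End(V_q) ⊗ End(V_q)`; `entry l d (S n) j b` is the coefficient of
`E_{jb} ⊗ E_{ld}` in `S`. On the left the sign comes from moving `E_{aj}` past `u_{cl}` and
`E_{cl}` past `E_{jb}`; on the right from moving `E_{cl}` past `E_{jb}`
(`S` and `U` are even, which makes the other signs trivial). -/
inductive URel (n : ℕ) : FreeAlgebra K (UGen n) → FreeAlgebra K (UGen n) → Prop
  | diag (i : Idx n) : URel n (uFree i i * uFree (-i) (-i)) 1
  | diag' (i : Idx n) : URel n (uFree (-i) (-i) * uFree i i) 1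
  | rtt (a b c d : Idx n) : URel n
      (∑ j : Idx n, ∑ l : Idx n,
        (sgn ((par a + par j) * (par c + par l) + (par c + par l) * (par j + par b)) *
          entry l d (S n) j b) • (uFree a j * uFree c l))
      (∑ j : Idx n, ∑ l : Idx n,
        (sgn ((par c + par l) * (par j + par b)) *
          entry c l (S n) a j) • (uFree l d * uFree j b))

/-- The quantum queer superalgebra `U_q(q(n))`. -/
abbrev Uq (n : ℕ) : Type := RingQuot (URel n)

/-- The generator `u_{ij}` of `U_q(q(n))` (zero for `i > j`). -/
def u {n : ℕ} (i j : Idx n) : Uq n := RingQuot.mkAlgHom K (URel n) (uFree i j)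

/-- The part of parity `p` of the superalgebra `U_q(q(n))`. -/
def uqPart (n : ℕ) (p : ZMod 2) : Submodule K (Uq n) :=
  superPart (fun x : UGen n => (u x.1.1 x.1.2 : Uq n)) (fun x => par x.1.1 + par x.1.2) p

/-! ### The quantum walled Brauer-Clifford superalgebra

Indices are shifted by one: `t i`, `ts i`, `c i`, `cs i` are the generators usually written
`t_{i+1}`, `t*_{i+1}`, `c_{i+1}`, `c*_{i+1}`. -/

/-- Generators; the proofs express the allowable range of the indices. -/
inductive BCGen (r s : ℕ) : Type
  | t (i : ℕ) (h : i + 1 < r) : BCGen r s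
  | ts (i : ℕ) (h : i + 1 < s) : BCGen r s
  | e (hr : 0 < r) (hs : 0 < s) : BCGen r s
  | c (i : ℕ) (h : i < r) : BCGen r s
  | cs (i : ℕ) (h : i < s) : BCGen r s

/-- The parity of a generator. -/
def BCGen.parity {r s : ℕ} : BCGen r s → ZMod 2
  | .t _ _ => 0
  | .ts _ _ => 0
  | .e _ _ => 0
  | .c _ _ => 1
  | .cs _ _ => 1

section
variable {r s : ℕ}

/-- The free generator `t`. -/
def ft (i : ℕ) (h : i + 1 < r) : FreeAlgebra K (BCGen r s) := FreeAlgebra.ι K (.t i h)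
/-- The free generator `t*`. -/
def fts (i : ℕ) (h : i + 1 < s) : FreeAlgebra K (BCGen r s) := FreeAlgebra.ι K (.ts i h)
/-- The free generator `e`. -/
def fe (hr : 0 < r) (hs : 0 < s) : FreeAlgebra K (BCGen r s) := FreeAlgebra.ι K (.e hr hs)
/-- The free generator `c`. -/
def fc (i : ℕ) (h : i < r) : FreeAlgebra K (BCGen r s) := FreeAlgebra.ι K (.c i h)
/-- The free generator `c*`. -/
def fcs (i : ℕ) (h : i < s) : FreeAlgebra K (BCGen r s) := FreeAlgebra.ι K (.cs i h)

/-- `t - ξ`, which is `t⁻¹` by the quadratic relation `t² - ξ t - 1 = 0`. -/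
def ftInv (i : ℕ) (h : i + 1 < r) : FreeAlgebra K (BCGen r s) :=
  ft i h - algebraMap K _ xi

end

/-- The defining relations of `BC_{r,s}(q)`. -/
inductive BCRel (r s : ℕ) : FreeAlgebra K (BCGen r s) → FreeAlgebra K (BCGen r s) → Prop
  | t_quad (i : ℕ) (h : i + 1 < r) : BCRel r s (ft i h ^ 2 - xi • ft i h - 1) 0
  | t_braid (i : ℕ) (h : i + 2 < r) : BCRel r s
      (ft i (by omega) * ft (i + 1) h * ft i (by omega))
      (ft (i + 1) h * ft i (by omega) * ft (i + 1) h)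
  | ts_quad (i : ℕ) (h : i + 1 < s) : BCRel r s (fts i h ^ 2 - xi • fts i h - 1) 0
  | ts_braid (i : ℕ) (h : i + 2 < s) : BCRel r s
      (fts i (by omega) * fts (i + 1) h * fts i (by omega))
      (fts (i + 1) h * fts i (by omega) * fts (i + 1) h)
  | t_comm (i j : ℕ) (hi : i + 1 < r) (hj : j + 1 < r) (h : i + 1 < j ∨ j + 1 < i) : BCRel r s
      (ft i hi * ft j hj) (ft j hj * ft i hi)
  | t_ts (i j : ℕ) (hi : i + 1 < r) (hj : j + 1 < s) : BCRel r s
      (ft i hi * fts j hj) (fts j hj * ft i hi)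
  | ts_comm (i j : ℕ) (hi : i + 1 < s) (hj : j + 1 < s) (h : i + 1 < j ∨ j + 1 < i) : BCRel r s
      (fts i hi * fts j hj) (fts j hj * fts i hi)
  | e_sq (hr : 0 < r) (hs : 0 < s) : BCRel r s (fe hr hs ^ 2) 0
  | e_t_e (hr : 1 < r) (hs : 0 < s) : BCRel r s
      (fe (by omega) hs * ft (r - 2) (by omega) * fe (by omega) hs) (fe (by omega) hs)
  | e_t (hr : 0 < r) (hs : 0 < s) (j : ℕ) (hj : j + 1 < r) (h : j + 2 ≠ r) : BCRel r s
      (fe hr hs * ft j hj) (ft j hj * fe hr hs)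
  | e_ts_e (hr : 0 < r) (hs : 1 < s) : BCRel r s
      (fe hr (by omega) * fts 0 (by omega) * fe hr (by omega)) (fe hr (by omega))
  | e_ts (hr : 0 < r) (hs : 0 < s) (j : ℕ) (hj : j + 1 < s) (h : j ≠ 0) : BCRel r s
      (fe hr hs * fts j hj) (fts j hj * fe hr hs)
  | e_long (hr : 1 < r) (hs : 1 < s) : BCRel r s
      (fe (by omega) (by omega) * ftInv (r - 2) (by omega) * fts 0 (by omega) *
        fe (by omega) (by omega) * fts 0 (by omega) * ftInv (r - 2) (by omega))
      (ftInv (r - 2) (by omega) * fts 0 (by omega) * fe (by omega) (by omega) *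
        fts 0 (by omega) * ftInv (r - 2) (by omega) * fe (by omega) (by omega))
  | c_sq (i : ℕ) (h : i < r) : BCRel r s (fc i h ^ 2) (-1)
  | c_c (i j : ℕ) (hi : i < r) (hj : j < r) (h : i ≠ j) : BCRel r s
      (fc i hi * fc j hj) (-(fc j hj * fc i hi))
  | c_cs (i j : ℕ) (hi : i < r) (hj : j < s) : BCRel r s
      (fc i hi * fcs j hj) (-(fcs j hj * fc i hi))
  | cs_sq (i : ℕ) (h : i < s) : BCRel r s (fcs i h ^ 2) 1
  | cs_cs (i j : ℕ) (hi : i < s) (hj : j < s) (h : i ≠ j) : BCRel r s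
      (fcs i hi * fcs j hj) (-(fcs j hj * fcs i hi))
  | t_c (i : ℕ) (h : i + 1 < r) : BCRel r s
      (ft i h * fc i (by omega)) (fc (i + 1) h * ft i h)
  | t_c_comm (i j : ℕ) (hi : i + 1 < r) (hj : j < r) (h : j ≠ i) (h' : j ≠ i + 1) : BCRel r s
      (ft i hi * fc j hj) (fc j hj * ft i hi)
  | ts_cs (i : ℕ) (h : i + 1 < s) : BCRel r s
      (fts i h * fcs i (by omega)) (fcs (i + 1) h * fts i h)
  | ts_cs_comm (i j : ℕ) (hi : i + 1 < s) (hj : j < s) (h : j ≠ i) (h' : j ≠ i + 1) : BCRel r s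
      (fts i hi * fcs j hj) (fcs j hj * fts i hi)
  | t_cs (i j : ℕ) (hi : i + 1 < r) (hj : j < s) : BCRel r s
      (ft i hi * fcs j hj) (fcs j hj * ft i hi)
  | ts_c (i j : ℕ) (hi : i + 1 < s) (hj : j < r) : BCRel r s
      (fts i hi * fc j hj) (fc j hj * fts i hi)
  | c_e (hr : 0 < r) (hs : 0 < s) : BCRel r s
      (fc (r - 1) (by omega) * fe hr hs) (fcs 0 hs * fe hr hs)
  | e_c (hr : 0 < r) (hs : 0 < s) : BCRel r s
      (fe hr hs * fc (r - 1) (by omega)) (fe hr hs * fcs 0 hs)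
  | c_e_comm (hr : 0 < r) (hs : 0 < s) (j : ℕ) (hj : j < r) (h : j + 1 ≠ r) : BCRel r s
      (fc j hj * fe hr hs) (fe hr hs * fc j hj)
  | cs_e_comm (hr : 0 < r) (hs : 0 < s) (j : ℕ) (hj : j < s) (h : j ≠ 0) : BCRel r s
      (fcs j hj * fe hr hs) (fe hr hs * fcs j hj)
  | e_c_e (hr : 0 < r) (hs : 0 < s) : BCRel r s
      (fe hr hs * fc (r - 1) (by omega) * fe hr hs) 0

/-- The quantum walled Brauer-Clifford superalgebra `BC_{r,s}(q)`. -/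
abbrev BC (r s : ℕ) : Type := RingQuot (BCRel r s)

/-- The image of a generator in `BC_{r,s}(q)`. -/
def bc {r s : ℕ} (x : BCGen r s) : BC r s :=
  RingQuot.mkAlgHom K (BCRel r s) (FreeAlgebra.ι K x)

/-- The part of parity `p` of the superalgebra `BC_{r,s}(q)`. -/
def bcPart (r s : ℕ) (p : ZMod 2) : Submodule K (BC r s) := superPart bc BCGen.parity p

/-! ### The mixed tensor space -/

/-- `V_q`, with standard basis indexed by `I`. -/
abbrev V (n : ℕ) : Type := Idx n → K

/-- The standard basis `(v_i)` of `V_q`. -/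
def vBasis (n : ℕ) : Module.Basis (Idx n) K (V n) := Pi.basisFun K (Idx n)

/-- The dual basis `(w_i)` of `V_q^*`. -/
def wBasis (n : ℕ) : Module.Basis (Idx n) K (Module.Dual K (V n)) := (vBasis n).dualBasis

/-- The mixed tensor space `V_q^{⊗r} ⊗ (V_q^*)^{⊗s}`. -/
def Mixed (n r s : ℕ) : Type :=
  (⨂[K] _ : Fin r, V n) ⊗[K] (⨂[K] _ : Fin s, Module.Dual K (V n))

instance instAddCommGroupMixed (n r s : ℕ) : AddCommGroup (Mixed n r s) :=
  inferInstanceAs (AddCommGroup ((⨂[K] _ : Fin r, V n) ⊗[K] (⨂[K] _ : Fin s, Module.Dual K (V n))))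

instance instModuleMixed (n r s : ℕ) : Module K (Mixed n r s) :=
  inferInstanceAs (Module K ((⨂[K] _ : Fin r, V n) ⊗[K] (⨂[K] _ : Fin s, Module.Dual K (V n))))

/-- The pure tensor `x_1 ⊗ ⋯ ⊗ x_r ⊗ f_1 ⊗ ⋯ ⊗ f_s` in the mixed tensor space. -/
def pureTensor {n r s : ℕ} (x : Fin r → V n) (f : Fin s → Module.Dual K (V n)) : Mixed n r s :=
  PiTensorProduct.tprod K x ⊗ₜ[K] PiTensorProduct.tprod K f

/-- The basis `v_{w_0} ⊗ ⋯ ⊗ v_{w_{r-1}} ⊗ w_{w_r} ⊗ ⋯ ⊗ w_{w_{r+s-1}}` of the mixed tensor space,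
indexed by words `w` of length `r + s` in `I`. -/
def mBasis (n r s : ℕ) : Module.Basis (Fin (r + s) → Idx n) K (Mixed n r s) :=
  ((Basis.piTensorProduct fun _ : Fin r => vBasis n).tensorProduct
    (Basis.piTensorProduct fun _ : Fin s => wBasis n)).reindex (Fin.appendEquiv r s)

theorem mBasis_apply (n r s : ℕ) (w : Fin (r + s) → Idx n) :
    mBasis n r s w =
      pureTensor (fun k => vBasis n (w (Fin.castAdd s k))) (fun k => wBasis n (w (Fin.natAdd r k))) := by
  unfold mBasis pureTensor
  erw [Module.Basis.reindex_apply, Module.Basis.tensorProduct_apply,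
    Basis.piTensorProduct_apply, Basis.piTensorProduct_apply]

/-- The part of parity `p` of the mixed tensor space. -/
def mixedPart (n r s : ℕ) (p : ZMod 2) : Submodule K (Mixed n r s) :=
  Submodule.span K {x | ∃ w : Fin (r + s) → Idx n, ∑ k, par (w k) = p ∧ x = mBasis n r s w}

/-- The endomorphisms of parity `p` of the mixed tensor space. -/
def endPart (n r s : ℕ) (p : ZMod 2) : Submodule K (Module.End K (Mixed n r s)) where
  carrier := {f | ∀ p', ∀ x ∈ mixedPart n r s p', f x ∈ mixedPart n r s (p + p')}
  add_mem' := by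
    intro f g hf hg p' x hx
    exact Submodule.add_mem _ (hf p' x hx) (hg p' x hx)
  zero_mem' := by
    intro p' x _
    exact Submodule.zero_mem _
  smul_mem' := by
    intro c f hf p' x hx
    exact Submodule.smul_mem _ c (hf p' x hx)

/-- `id^{⊗k} ⊗ X ⊗ id^{⊗(r+s-1-k)}` on the mixed tensor space, with the sign rule
`(f ⊗ g)(x ⊗ y) = (-1)^{|g||x|} f x ⊗ g y`: moving `E_{ab}` past the first `k` factors of a basis
vector gives the sign `(-1)^{(|a|+|b|)(|w_0| + ⋯ + |w_{k-1}|)}`. For `k < r` the matrix `X` acts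
in the basis `(v_i)` of `V_q`, for `k ≥ r` in the basis `(w_i)` of `V_q^*`. -/
def site {n r s : ℕ} (k : Fin (r + s)) : Mat n →ₗ[K] Module.End K (Mixed n r s) where
  toFun X := (mBasis n r s).constr K fun w =>
    ∑ a : Idx n, (sgn ((par a + par (w k)) * ∑ l ∈ Finset.Iio k, par (w l)) * X a (w k)) •
      mBasis n r s (Function.update w k a)
  map_add' X Y := by
    refine (mBasis n r s).ext fun w => ?_
    simp [mul_add, add_smul, Finset.sum_add_distrib]
  map_smul' c X := by
    refine (mBasis n r s).ext fun w => ?_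
    simp [Finset.smul_sum, smul_smul, mul_left_comm]

/-- For sites `k < k'`, the operator with `X ⊗ Y` acting in the factors `k`, `k'` and the identity
in the other ones; `X ⊗ Y = (X ⊗ id)(id ⊗ Y)`. -/
def site2 {n r s : ℕ} (k k' : Fin (r + s)) : Mat2 n →ₗ[K] Module.End K (Mixed n r s) :=
  TensorProduct.lift
      ((LinearMap.mul K (Module.End K (Mixed n r s))).compl₁₂ (site k) (site k')) ∘ₗ
    (GradedTensorProduct.of K (matPart n) (matPart n)).symm.toLinearMap

/-! ### The action of `U_q(q(n))` -/

/-- The operator by which `u_{ij}` acts in the factor `k`: on `V_q` it is `S_{ij}`, where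
`S = ∑ S_{ij} ⊗ E_{ij}`; on the dual `V_q^*` it is the supertranspose of the action on `V_q`
of the antipode of `u_{ij}`, which is `(S⁻¹)_{ij}` as the antipode is `U ↦ U⁻¹`. -/
def leg {n r s : ℕ} (k : Fin (r + s)) (i j : Idx n) : Module.End K (Mixed n r s) :=
  site k (if k.1 < r then entry i j (S n) else st (entry i j (Ring.inverse (S n))))

/-- The iterated coproduct
`Δ(u_{ij}) = ∑_k (-1)^{(|i|+|k|)(|k|+|j|)} u_{ik} ⊗ u_{kj}`, for operators in successive
factors; the counit `u_{ij} ↦ δ_{ij}` for the empty product. -/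
def coprod {n : ℕ} {A : Type} [Ring A] [Algebra K A] :
    List (Idx n → Idx n → A) → Idx n → Idx n → A
  | [], i, j => if i = j then 1 else 0
  | M :: L, i, j =>
      ∑ k : Idx n, sgn ((par i + par k) * (par k + par j)) • (M i k * coprod L k j)

/-- The operator by which `u_{ij}` acts on the mixed tensor space. -/
def uAct (n r s : ℕ) (i j : Idx n) : Module.End K (Mixed n r s) :=
  coprod (List.ofFn fun k : Fin (r + s) => leg k) i j

/-! ### The maps cap and cup -/

/-- `∩ : ℂ(q) → V_q ⊗ V_q^*`, `1 ↦ ∑ v_i ⊗ w_i`. -/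
def cap (n : ℕ) : K →ₗ[K] V n ⊗[K] Module.Dual K (V n) :=
  LinearMap.toSpanSingleton K _ (∑ i : Idx n, vBasis n i ⊗ₜ[K] wBasis n i)

/-- `∪ : V_q ⊗ V_q^* → ℂ(q)`,
`v_i ⊗ w_j ↦ (-1)^{|i|} q^{2i(1-2|i|)-(2n+1)} δ_{ij}`. -/
def cup (n : ℕ) : V n ⊗[K] Module.Dual K (V n) →ₗ[K] K :=
  ((vBasis n).tensorProduct (wBasis n)).constr K fun ij =>
    if ij.1 = ij.2 then sgn (par ij.1) * q ^ (2 * ij.1.1 * eps ij.1 - (2 * n + 1)) else 0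

/-- For an even `F ∈ End(V_q ⊗ V_q^*)`, the operator `id^{⊗(r-1)} ⊗ F ⊗ id^{⊗(s-1)}`: `F` is
applied to the two factors next to the wall and the result is inserted in their place. -/
def mid {n r s : ℕ} (hr : 0 < r) (hs : 0 < s)
    (F : Module.End K (V n ⊗[K] Module.Dual K (V n))) : Module.End K (Mixed n r s) :=
  (mBasis n r s).constr K fun w =>
    ((vBasis n).tensorProduct (wBasis n)).constr K
      (fun ab => mBasis n r s
        (Function.update (Function.update w ⟨r - 1, by omega⟩ ab.1) ⟨r, by omega⟩ ab.2))
      (F (vBasis n (w ⟨r - 1, by omega⟩) ⊗ₜ[K] wBasis n (w ⟨r, by omega⟩)))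

end QueerBC

end

open QueerBC

noncomputable section

namespace QueerBC

variable {n : ℕ}

/-! ### Signs and matrix units -/

/-! All computations take place in a `LegSystem`: an algebra with pairwise supercommuting copies
(legs) of End(V) and an involution `J` implementing the parity. An even element of two legs commutes
with everything in the other legs, so each relation becomes an identity in a few abstract legs. The
factors of the mixed tensor space form such a system (`mixed`). Two constructions give further ones:
`ext` adjoins an auxiliary leg by passing to matrices over the algebra, and `op` transposes all legs
into the opposite algebra.

On the V side, the quadratic relation `PS_sq` is a case check on basis vectors; it shows that PS − ξ
inverts PS and so produces S⁻¹. For `braid`, the defect of the braid relation intertwines the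
Clifford generators (`braid_clifford`). As Φ changes the signs of indices, the defect only has to be
killed on vectors with positive indices (`generic_braid`). Moving the flips out of the braid
relation gives `yang_baxter`.

Dual legs are reached through the cap ∑ v_i ⊗ w_i: an operator applied at its V end equals the
supertranspose applied at its V* end. A relation in dual legs is tested by joining them to adjoined
V legs with caps, sliding the relation to the V side and removing the caps again, which `cancel_cap`
permits. The relations among the starred generators t*, c* alone follow more directly from those of
PS through `op`.

The weights of the cup enter through the supertrace `trq`: cup ∘ (X ⊗ 1) ∘ cap is the scalar `trq
X`. It vanishes on 1 and on Φ, which gives e² = 0 and e c_r e = 0. The partial trace `ptr` sends PS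
to 1 by a telescoping sum, which gives e t_{r-1} e = e, and a conjugate of X ⊗ 1 by PS or its
inverse to the scalar `trq X` (`ptr_conj`, `ptr_conj'`). From these follow the invariance of the cup
(`e_mul_R_Rs`) and the long relation, both sides of which equal a product of two nested e's
(`e_long`).

For U_q(q(n)), the iterated coproduct is read off, up to powers of `J`, from the entries of a
transfer matrix: the product over all factors of S, or of the partially transposed S⁻¹, in that
factor and one auxiliary leg (`prodTwo_ext`). The defining relations pass from single factors to the
product (`rtt_prod`). A homogeneous operator that commutes with the transfer matrix supercommutes
with all u_{ij}; for the generators of BC this is a check on one or two adjacent factors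
(`bcGenAct_commute`). Triangularity of S and S⁻¹ is needed because u_{ij} exists only for i ≤ j. -/

lemma zmod_two_cases (a : ZMod 2) : a = 0 ∨ a = 1 := by revert a; decide

lemma sgn_add (a b : ZMod 2) : sgn (a + b) = sgn a * sgn b := by
  rcases zmod_two_cases a with rfl | rfl <;> rcases zmod_two_cases b with rfl | rfl <;>
    simp [sgn, CharTwo.add_self_eq_zero]

@[simp] lemma sgn_zero : sgn 0 = 1 := by simp [sgn]

@[simp] lemma sgn_one : sgn 1 = -1 := by simp [sgn]

@[simp] lemma sgn_mul_self (a : ZMod 2) : sgn a * sgn a = 1 := by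
  rcases zmod_two_cases a with rfl | rfl <;> simp

lemma neg_sgn (a : ZMod 2) : -sgn a = sgn (1 + a) := by
  rw [sgn_add, sgn_one, neg_one_mul]

lemma sgn_ne_zero (a : ZMod 2) : sgn a ≠ 0 := by
  rcases zmod_two_cases a with rfl | rfl <;> simp

/-- Mathlib's graded tensor product expresses its sign as a power of `-1 : ℤˣ`; this translates it
to `sgn`. -/
lemma units_smul_eq_sgn {M : Type*} [AddCommGroup M] [Module K M] (a : ZMod 2) (x : M) :
    ((-1 : ℤˣ) ^ a) • x = sgn a • x := by
  rcases zmod_two_cases a with rfl | rfl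
  · simp
  · rw [show ((-1 : ℤˣ) ^ (1 : ZMod 2)) = -1 by decide]; simp

lemma par_neg (i : Idx n) : par (-i) = par i + 1 := by
  have h := i.2
  simp only [Finset.mem_erase, Finset.mem_Icc] at h
  have : (-i).1 = -i.1 := rfl
  unfold par
  rw [this]
  split_ifs <;> first | omega | rfl

lemma E_mul_E (a b c d : Idx n) : E a b * E c d = if b = c then E a d else 0 := by
  unfold E
  split_ifs with h
  · subst h; simp
  · simp [h]

@[simp] lemma E_mul_E_same (a b d : Idx n) : E a b * E b d = E a d := by simp [E_mul_E]

lemma E_mul_E_ne (a b c d : Idx n) (h : b ≠ c) : E a b * E c d = 0 := by simp [E_mul_E, h]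

lemma E_apply (a b i j : Idx n) : E a b i j = if a = i ∧ b = j then 1 else 0 := by
  simp [E, Matrix.single_apply]

lemma E_mem (a b : Idx n) : E a b ∈ matPart n (par a + par b) := by
  intro i j h
  rw [E_apply, if_neg]
  rintro ⟨rfl, rfl⟩
  exact h rfl

lemma mat_eq_sum (X : Mat n) : X = ∑ a, ∑ b, X a b • E a b := by
  conv_lhs => rw [Matrix.matrix_eq_sum_single X]
  simp [E, Matrix.smul_single]

lemma one_eq_sum_E : (1 : Mat n) = ∑ a : Idx n, E a a := by
  ext i j
  simp only [Matrix.sum_apply, E_apply, Matrix.one_apply]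
  by_cases h : i = j
  · subst h; simp
  · rw [if_neg h, Finset.sum_eq_zero]
    intro a _
    rw [if_neg]
    rintro ⟨rfl, rfl⟩
    exact h rfl

lemma mat_hom_ext {M : Type*} [AddCommGroup M] [Module K M] {f g : Mat n →ₗ[K] M}
    (h : ∀ a b, f (E a b) = g (E a b)) : f = g := by
  ext X
  rw [mat_eq_sum X]
  simp only [map_sum, map_smul, h]

/-! ### The algebra `End(V) ⊗ End(V)` -/

lemma tens_add_left (X X' Y : Mat n) : tens (X + X') Y = tens X Y + tens X' Y := by
  unfold tens GradedTensorProduct.tmul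
  rw [TensorProduct.add_tmul, map_add]

/-- `tens` as a bilinear map. -/
def tensB : Mat n →ₗ[K] Mat n →ₗ[K] Mat2 n :=
  (TensorProduct.mk K (Mat n) (Mat n)).compr₂
    (GradedTensorProduct.of K (matPart n) (matPart n)).toLinearMap

lemma tensB_apply (X Y : Mat n) : tensB X Y = tens X Y := rfl

lemma tens_smul_left (c : K) (X Y : Mat n) : tens (c • X) Y = c • tens X Y := by
  simp only [← tensB_apply, map_smul, LinearMap.smul_apply]

lemma tens_smul_right (c : K) (X Y : Mat n) : tens X (c • Y) = c • tens X Y := by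
  simp only [← tensB_apply, map_smul]

lemma tens_zero_left (Y : Mat n) : tens 0 Y = 0 := by
  simp only [← tensB_apply, map_zero, LinearMap.zero_apply]

lemma tens_zero_right (X : Mat n) : tens X 0 = 0 := by
  simp only [← tensB_apply, map_zero]

lemma tens_sum_left {ι : Type*} (s : Finset ι) (f : ι → Mat n) (Y : Mat n) :
    tens (∑ i ∈ s, f i) Y = ∑ i ∈ s, tens (f i) Y := by
  simp only [← tensB_apply, map_sum, LinearMap.sum_apply]

lemma tens_sum_right {ι : Type*} (s : Finset ι) (f : ι → Mat n) (X : Mat n) :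
    tens X (∑ i ∈ s, f i) = ∑ i ∈ s, tens X (f i) := by
  simp only [← tensB_apply, map_sum]

lemma tens_one_one : tens (1 : Mat n) 1 = 1 := rfl

lemma mat2_hom_ext {M : Type*} [AddCommGroup M] [Module K M] {f g : Mat2 n →ₗ[K] M}
    (h : ∀ a b c d, f (tens (E a b) (E c d)) = g (tens (E a b) (E c d))) : f = g := by
  have key : tensB.compr₂ f = tensB.compr₂ g := by
    refine mat_hom_ext fun a b => mat_hom_ext fun c d => ?_
    exact h a b c d
  apply GradedTensorProduct.hom_ext
  refine TensorProduct.ext' fun X Y => ?_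
  exact LinearMap.congr_fun₂ key X Y

lemma mat2_hom_ext_tens {M : Type*} [AddCommGroup M] [Module K M] {f g : Mat2 n →ₗ[K] M}
    (h : ∀ X Y, f (tens X Y) = g (tens X Y)) : f = g :=
  mat2_hom_ext fun _ _ _ _ => h _ _

/-- Only the two inner factors cross, so only these have to be homogeneous; the outer ones are
arbitrary. -/
lemma tens_mul_tens (X Y : Mat n) (a b c d : Idx n) :
    tens X (E c d) * tens (E a b) Y =
      sgn ((par c + par d) * (par a + par b)) • tens (X * E a b) (E c d * Y) := by
  have := GradedTensorProduct.tmul_coe_mul_coe_tmul (R := K) (𝒜 := matPart n) (ℬ := matPart n)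
    X (⟨E c d, E_mem c d⟩ : matPart n _) (⟨E a b, E_mem a b⟩ : matPart n _) Y
  unfold tens
  rw [this, units_smul_eq_sgn]

lemma tens_one_mul_tens (X X' Y : Mat n) : tens X 1 * tens X' Y = tens (X * X') Y := by
  rw [mat_eq_sum X']
  simp only [tens_sum_left, tens_smul_left, Finset.mul_sum, mul_smul_comm]
  refine Finset.sum_congr rfl fun a _ => Finset.sum_congr rfl fun b _ => ?_
  rw [one_eq_sum_E, tens_sum_right, Finset.sum_mul]
  simp only [tens_mul_tens, CharTwo.add_self_eq_zero, zero_mul, sgn_zero, one_smul]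
  rw [← tens_sum_right, ← Finset.sum_mul, ← one_eq_sum_E, one_mul]

lemma tens_mul_one_tens (X Y Y' : Mat n) : tens X Y * tens 1 Y' = tens X (Y * Y') := by
  rw [mat_eq_sum Y]
  simp only [tens_sum_right, tens_smul_right, Finset.sum_mul, smul_mul_assoc]
  refine Finset.sum_congr rfl fun a _ => Finset.sum_congr rfl fun b _ => ?_
  rw [one_eq_sum_E, tens_sum_left, Finset.mul_sum]
  simp only [tens_mul_tens, CharTwo.add_self_eq_zero, mul_zero, sgn_zero, one_smul]
  rw [← tens_sum_left, ← Finset.mul_sum, ← one_eq_sum_E, mul_one]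

lemma tens_E_mul (a b c d a' b' c' d' : Idx n) :
    tens (E a b) (E c d) * tens (E a' b') (E c' d') =
      if b = a' ∧ d = c' then
        sgn ((par c + par d) * (par a' + par b')) • tens (E a b') (E c d') else 0 := by
  rw [tens_mul_tens, E_mul_E, E_mul_E]
  by_cases h : b = a' <;> by_cases h' : d = c' <;> simp [h, h', tens_zero_left, tens_zero_right]

lemma entry_tens (i j : Idx n) (X Y : Mat n) : entry i j (tens X Y) = Y i j • X := rfl

lemma entry_tens_E (i j a b c d : Idx n) :
    entry i j (tens (E a b) (E c d)) = if c = i ∧ d = j then E a b else 0 := by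
  rw [entry_tens, E_apply]
  split_ifs <;> simp

/-- The even part of `End(V) ⊗ End(V)`. -/
def evenPart (n : ℕ) : Submodule K (Mat2 n) :=
  Submodule.span K {Z | ∃ a b c d : Idx n, par a + par b = par c + par d ∧
    Z = tens (E a b) (E c d)}

lemma tens_mem_evenPart (a b c d : Idx n) (h : par a + par b = par c + par d) :
    tens (E a b) (E c d) ∈ evenPart n := Submodule.subset_span ⟨a, b, c, d, h, rfl⟩

lemma mul_mem_evenPart {Z Z' : Mat2 n} (hZ : Z ∈ evenPart n) (hZ' : Z' ∈ evenPart n) :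
    Z * Z' ∈ evenPart n := by
  induction hZ using Submodule.span_induction with
  | zero => simp
  | add x y _ _ hx hy => rw [add_mul]; exact add_mem hx hy
  | smul c x _ hx => rw [smul_mul_assoc]; exact Submodule.smul_mem _ _ hx
  | mem x hx =>
    obtain ⟨a, b, c, d, h, rfl⟩ := hx
    induction hZ' using Submodule.span_induction with
    | zero => simp
    | add x y _ _ hx hy => rw [mul_add]; exact add_mem hx hy
    | smul c x _ hx => rw [mul_smul_comm]; exact Submodule.smul_mem _ _ hx
    | mem x hx =>
      obtain ⟨a', b', c', d', h', rfl⟩ := hx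
      rw [tens_E_mul]
      split_ifs with h0
      · obtain ⟨rfl, rfl⟩ := h0
        refine Submodule.smul_mem _ _ (tens_mem_evenPart _ _ _ _ ?_)
        revert h h'
        -- Sign and parity conditions are statements about finitely many elements of `ZMod 2`,
        -- settled by exhaustion here and throughout.
        generalize par a = a, par b = b, par c = c, par d = d, par b' = e, par d' = f
        revert a b c d e f
        decide
      · exact zero_mem _

lemma one_mem_evenPart : (1 : Mat2 n) ∈ evenPart n := by
  rw [← tens_one_one, one_eq_sum_E]
  simp only [tens_sum_left, tens_sum_right]
  refine Submodule.sum_mem _ fun a _ => Submodule.sum_mem _ fun b _ => tens_mem_evenPart _ _ _ _ ?_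
  simp [CharTwo.add_self_eq_zero]

lemma S_mem_evenPart : S n ∈ evenPart n := by
  unfold S
  refine add_mem (Submodule.sum_mem _ fun a _ => Submodule.sum_mem _ fun b _ =>
    Submodule.smul_mem _ _ (tens_mem_evenPart _ _ _ _ ?_)) (Submodule.smul_mem _ _
    (Submodule.sum_mem _ fun a _ => Submodule.sum_mem _ fun b _ => ?_))
  · simp [CharTwo.add_self_eq_zero]
  · split_ifs
    · refine Submodule.smul_mem _ _ ?_
      rw [tens_add_left]
      refine add_mem (tens_mem_evenPart _ _ _ _ (add_comm _ _)) (tens_mem_evenPart _ _ _ _ ?_)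
      rw [par_neg, par_neg]
      generalize par a = a, par b = b
      revert a b; decide
    · exact zero_mem _

lemma P_mem_evenPart : P n ∈ evenPart n := by
  unfold P
  exact Submodule.sum_mem _ fun a _ => Submodule.sum_mem _ fun b _ =>
    Submodule.smul_mem _ _ (tens_mem_evenPart _ _ _ _ (add_comm _ _))

/-! ### Systems of supercommuting copies of `End(V)` -/

/-- A family of pairwise supercommuting homomorphisms `End(V) → A`, together with an involution `J`
of `A` implementing the parity on their images. -/
structure LegSystem (n : ℕ) (ι A : Type) [Ring A] [Algebra K A] where
  /-- The homomorphisms. -/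
  leg : ι → Mat n →ₐ[K] A
  /-- The parity operator. -/
  J : A
  J_sq : J * J = 1
  J_leg : ∀ k a b, J * leg k (E a b) = sgn (par a + par b) • (leg k (E a b) * J)
  comm : ∀ k l, k ≠ l → ∀ a b c d, leg k (E a b) * leg l (E c d) =
    sgn ((par a + par b) * (par c + par d)) • (leg l (E c d) * leg k (E a b))

namespace LegSystem
variable {ι A : Type} [Ring A] [Algebra K A] (L : LegSystem n ι A)

/-- `X ⊗ Y` acting in the legs `k` and `l`. -/
def two (k l : ι) : Mat2 n →ₗ[K] A :=
  TensorProduct.lift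
      ((LinearMap.mul K A).compl₁₂ (L.leg k).toLinearMap (L.leg l).toLinearMap) ∘ₗ
    (GradedTensorProduct.of K (matPart n) (matPart n)).symm.toLinearMap

lemma two_tens (k l : ι) (X Y : Mat n) : L.two k l (tens X Y) = L.leg k X * L.leg l Y := rfl

lemma two_one (k l : ι) : L.two k l 1 = 1 := by
  rw [← tens_one_one, two_tens, map_one, map_one, one_mul]

variable {L}
variable {k l m : ι}

/-- The relation `comm` exchanges the inner factors in `A` with the same sign as the super tensor
product does, so two distinct legs give an algebra homomorphism. -/
lemma two_mul (h : k ≠ l) (Z Z' : Mat2 n) : L.two k l (Z * Z') = L.two k l Z * L.two k l Z' := by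
  have : (LinearMap.mul K (Mat2 n)).compr₂ (L.two k l) =
      (LinearMap.mul K A).compl₁₂ (L.two k l) (L.two k l) := by
    refine mat2_hom_ext fun a b c d => mat2_hom_ext fun a' b' c' d' => ?_
    simp only [LinearMap.compr₂_apply, LinearMap.mul_apply', LinearMap.compl₁₂_apply]
    rw [tens_mul_tens, map_smul, two_tens, two_tens, two_tens, map_mul, map_mul,
      mul_assoc, ← mul_assoc (L.leg k (E a' b')), L.comm k l h, smul_mul_assoc, mul_smul_comm,
      smul_smul]
    rw [show ∀ x y : ZMod 2, sgn (x * y) * sgn (y * x) = 1 from fun x y => by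
      rw [mul_comm y x, sgn_mul_self], one_smul]
    simp only [mul_assoc]
  exact LinearMap.congr_fun₂ this Z Z'

/-- `J ^ p` for a parity `p`. -/
def Jp (L : LegSystem n ι A) (p : ZMod 2) : A := if p = 0 then 1 else L.J

@[simp] lemma Jp_zero : L.Jp 0 = 1 := by simp [Jp]

@[simp] lemma Jp_one : L.Jp 1 = L.J := by simp [Jp]

lemma Jp_mul (p p' : ZMod 2) : L.Jp p * L.Jp p' = L.Jp (p + p') := by
  rcases zmod_two_cases p with rfl | rfl <;> rcases zmod_two_cases p' with rfl | rfl <;>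
    simp [L.J_sq, CharTwo.add_self_eq_zero]

lemma Jp_mul_self (p : ZMod 2) : L.Jp p * L.Jp p = 1 := by
  rw [Jp_mul, CharTwo.add_self_eq_zero, Jp_zero]

lemma Jp_leg (k : ι) (p : ZMod 2) (a b : Idx n) :
    L.Jp p * L.leg k (E a b) = sgn (p * (par a + par b)) • (L.leg k (E a b) * L.Jp p) := by
  rcases zmod_two_cases p with rfl | rfl
  · simp
  · simp [L.J_leg]

lemma J_two {Z : Mat2 n} (hZ : Z ∈ evenPart n) (k l : ι) :
    L.J * L.two k l Z = L.two k l Z * L.J := by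
  induction hZ using Submodule.span_induction with
  | zero => simp
  | add x y _ _ hx hy => rw [map_add, mul_add, add_mul, hx, hy]
  | smul c x _ hx => rw [map_smul, mul_smul_comm, smul_mul_assoc, hx]
  | mem x hx =>
    obtain ⟨a, b, c, d, h, rfl⟩ := hx
    rw [two_tens, ← mul_assoc, L.J_leg, smul_mul_assoc, mul_assoc, L.J_leg, mul_smul_comm,
      smul_smul, h, sgn_mul_self, one_smul, mul_assoc]

/-- Even elements commute with disjoint legs. -/
lemma two_leg {Z : Mat2 n} (hZ : Z ∈ evenPart n) (hk : k ≠ m) (hl : l ≠ m) (X : Mat n) :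
    L.two k l Z * L.leg m X = L.leg m X * L.two k l Z := by
  have : ∀ a b, L.two k l Z * L.leg m (E a b) = L.leg m (E a b) * L.two k l Z := by
    intro a' b'
    induction hZ using Submodule.span_induction with
    | zero => simp
    | add x y _ _ hx hy => rw [map_add, mul_add, add_mul, hx, hy]
    | smul c x _ hx => rw [map_smul, mul_smul_comm, smul_mul_assoc, hx]
    | mem x hx =>
      obtain ⟨a, b, c, d, h, rfl⟩ := hx
      rw [two_tens, mul_assoc, L.comm l m hl, mul_smul_comm, ← mul_assoc, L.comm k m hk,
        smul_mul_assoc, smul_smul, h, sgn_mul_self, one_smul, mul_assoc]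
  have h2 : (LinearMap.mulLeft K (L.two k l Z)) ∘ₗ (L.leg m).toLinearMap =
      (LinearMap.mulRight K (L.two k l Z)) ∘ₗ (L.leg m).toLinearMap := mat_hom_ext this
  exact LinearMap.congr_fun h2 X

/-- It is enough that one of the two elements is even: it commutes with each leg of the other
separately. -/
lemma two_two {Z : Mat2 n} (hZ : Z ∈ evenPart n) {m' : ι} (h1 : k ≠ m) (h2 : l ≠ m)
    (h3 : k ≠ m') (h4 : l ≠ m') (Z' : Mat2 n) :
    L.two k l Z * L.two m m' Z' = L.two m m' Z' * L.two k l Z := by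
  have : (LinearMap.mulLeft K (L.two k l Z)) ∘ₗ L.two m m' =
      (LinearMap.mulRight K (L.two k l Z)) ∘ₗ L.two m m' := by
    refine mat2_hom_ext_tens fun X Y => ?_
    simp only [LinearMap.comp_apply, LinearMap.mulLeft_apply, LinearMap.mulRight_apply, two_tens]
    rw [← mul_assoc, two_leg hZ h1 h2, mul_assoc, two_leg hZ h3 h4, mul_assoc]
  exact LinearMap.congr_fun this Z'

/-- The flip in the legs `k`, `l`. -/
abbrev flip (L : LegSystem n ι A) (k l : ι) : A := L.two k l (P n)

lemma flip_eq : L.flip k l = ∑ i, ∑ j, sgn (par j) • (L.leg k (E i j) * L.leg l (E j i)) := by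
  simp only [flip, P, map_sum, map_smul, two_tens]

lemma flip_comm (h : k ≠ l) : L.flip k l = L.flip l k := by
  rw [flip_eq, flip_eq, Finset.sum_comm]
  refine Finset.sum_congr rfl fun i _ => Finset.sum_congr rfl fun j _ => ?_
  rw [L.comm k l h, smul_smul, ← sgn_add]
  congr 2
  generalize par i = a, par j = b
  revert a b; decide

/-- Conjugation by the super flip exchanges the two legs, for odd `X` as well, thanks to the signs
in `P`. Both sides are expanded over the elements E_{ib} in leg `k` times E_{ai} in leg `l`. -/
lemma flip_leg (h : k ≠ l) (X : Mat n) : L.flip k l * L.leg k X = L.leg l X * L.flip k l := by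
  have : (LinearMap.mulLeft K (L.flip k l)) ∘ₗ (L.leg k).toLinearMap =
      (LinearMap.mulRight K (L.flip k l)) ∘ₗ (L.leg l).toLinearMap := by
    refine mat_hom_ext fun a b => ?_
    simp only [LinearMap.comp_apply, LinearMap.mulLeft_apply, LinearMap.mulRight_apply,
      AlgHom.toLinearMap_apply]
    have h1 : L.flip k l * L.leg k (E a b) =
        ∑ i, sgn (par a + (par a + par i) * (par a + par b)) •
          (L.leg k (E i b) * L.leg l (E a i)) := by
      rw [flip_eq, Finset.sum_mul]
      refine Finset.sum_congr rfl fun i _ => ?_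
      rw [Finset.sum_mul, Finset.sum_eq_single a]
      · rw [smul_mul_assoc, mul_assoc, L.comm l k h.symm, mul_smul_comm, ← mul_assoc, ← map_mul,
          smul_smul, ← sgn_add, E_mul_E_same]
      · intro j _ hj
        rw [smul_mul_assoc, mul_assoc, L.comm l k h.symm, mul_smul_comm, ← mul_assoc, ← map_mul,
          E_mul_E_ne _ _ _ _ hj]
        simp
      · simp
    have h2 : L.leg l (E a b) * L.flip k l =
        ∑ i, sgn (par b + (par a + par b) * (par b + par i)) •
          (L.leg k (E i b) * L.leg l (E a i)) := by
      rw [flip_eq, Finset.sum_comm, Finset.mul_sum, Finset.sum_eq_single b]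
      · rw [Finset.mul_sum]
        refine Finset.sum_congr rfl fun i _ => ?_
        rw [mul_smul_comm, ← mul_assoc, L.comm l k h.symm, smul_mul_assoc, mul_assoc, ← map_mul,
          smul_smul, ← sgn_add, E_mul_E_same, add_comm (par i) (par b)]
      · intro j _ hj
        rw [Finset.mul_sum]
        refine Finset.sum_eq_zero fun i _ => ?_
        rw [mul_smul_comm, ← mul_assoc, L.comm l k h.symm, smul_mul_assoc, mul_assoc, ← map_mul,
          E_mul_E_ne _ _ _ _ hj.symm]
        simp
      · simp
    rw [h1, h2]
    refine Finset.sum_congr rfl fun i _ => ?_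
    congr 2
    generalize par i = i, par a = a, par b = b
    revert i a b; decide
  exact LinearMap.congr_fun this X

lemma flip_leg' (h : k ≠ l) (X : Mat n) : L.flip k l * L.leg l X = L.leg k X * L.flip k l := by
  rw [flip_comm h, flip_leg h.symm]

lemma flip_two (h : k ≠ l) (hk : k ≠ m) (hl : l ≠ m) (Z : Mat2 n) :
    L.flip k l * L.two k m Z = L.two l m Z * L.flip k l := by
  have : (LinearMap.mulLeft K (L.flip k l)) ∘ₗ L.two k m =
      (LinearMap.mulRight K (L.flip k l)) ∘ₗ L.two l m := by
    refine mat2_hom_ext_tens fun X Y => ?_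
    simp only [LinearMap.comp_apply, LinearMap.mulLeft_apply, LinearMap.mulRight_apply, two_tens]
    rw [← mul_assoc, flip_leg h, mul_assoc, two_leg P_mem_evenPart hk hl, mul_assoc]
  exact LinearMap.congr_fun this Z

lemma flip_two' (h : k ≠ l) (hk : k ≠ m) (hl : l ≠ m) (Z : Mat2 n) :
    L.flip k l * L.two m k Z = L.two m l Z * L.flip k l := by
  have : (LinearMap.mulLeft K (L.flip k l)) ∘ₗ L.two m k =
      (LinearMap.mulRight K (L.flip k l)) ∘ₗ L.two m l := by
    refine mat2_hom_ext_tens fun X Y => ?_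
    simp only [LinearMap.comp_apply, LinearMap.mulLeft_apply, LinearMap.mulRight_apply, two_tens]
    rw [← mul_assoc, two_leg P_mem_evenPart hk hl, mul_assoc, flip_leg h, mul_assoc]
  exact LinearMap.congr_fun this Z

lemma flip_two_right (h : k ≠ l) (hk : k ≠ m) (hl : l ≠ m) (Z : Mat2 n) :
    L.flip k l * L.two l m Z = L.two k m Z * L.flip k l := by
  rw [flip_comm h, flip_two h.symm hl hk]

lemma flip_two_right' (h : k ≠ l) (hk : k ≠ m) (hl : l ≠ m) (Z : Mat2 n) :
    L.flip k l * L.two m l Z = L.two m k Z * L.flip k l := by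
  rw [flip_comm h, flip_two' h.symm hl hk]

lemma flip_two_swap (h : k ≠ l) (Z : Mat2 n) :
    L.flip k l * L.two k l Z = L.two l k Z * L.flip k l := by
  have : (LinearMap.mulLeft K (L.flip k l)) ∘ₗ L.two k l =
      (LinearMap.mulRight K (L.flip k l)) ∘ₗ L.two l k := by
    refine mat2_hom_ext_tens fun X Y => ?_
    simp only [LinearMap.comp_apply, LinearMap.mulLeft_apply, LinearMap.mulRight_apply, two_tens]
    rw [← mul_assoc, flip_leg h, mul_assoc, flip_leg' h, mul_assoc]
  exact LinearMap.congr_fun this Z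

end LegSystem

lemma P_mul_P : P n * P n = 1 := by
  have h : ∀ i j : Idx n, (sgn (par j) • tens (E i j) (E j i)) * P n = tens (E i i) (E j j) := by
    intro i j
    unfold P
    rw [Finset.mul_sum, Finset.sum_eq_single j]
    · rw [Finset.mul_sum, Finset.sum_eq_single i]
      · rw [smul_mul_assoc, mul_smul_comm, tens_E_mul, if_pos ⟨rfl, rfl⟩, smul_smul, smul_smul,
          ← sgn_add, ← sgn_add]
        convert one_smul K _
        rw [← sgn_zero]
        congr 1
        generalize par i = a, par j = b
        revert a b; decide
      · intro b _ hb
        rw [smul_mul_assoc, mul_smul_comm, tens_E_mul, if_neg (by simp [hb.symm])]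
        simp
      · simp
    · intro b _ hb
      rw [Finset.mul_sum]
      refine Finset.sum_eq_zero fun c _ => ?_
      rw [smul_mul_assoc, mul_smul_comm, tens_E_mul, if_neg (by simp [hb.symm])]
      simp
    · simp
  conv_lhs => enter [1]; unfold P
  simp only [Finset.sum_mul, h]
  simp only [← tens_sum_right]
  rw [← tens_sum_left, ← one_eq_sum_E, tens_one_one]

namespace LegSystem
variable {ι A : Type} [Ring A] [Algebra K A] {L : LegSystem n ι A} {k l m : ι}

lemma flip_mul_flip (h : k ≠ l) : L.flip k l * L.flip k l = 1 := by
  rw [flip, ← two_mul h, P_mul_P, two_one]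

/-! ### Adjoining a leg -/

/-- The embedding of `A` into matrices over `A` by scalar matrices. -/
def incl (n : ℕ) (A : Type) [Ring A] [Algebra K A] : A →ₐ[K] Matrix (Idx n) (Idx n) A where
  toFun a := Matrix.diagonal fun _ => a
  map_one' := Matrix.diagonal_one
  map_mul' a b := by rw [Matrix.diagonal_mul_diagonal]
  map_zero' := Matrix.diagonal_zero
  map_add' a b := by rw [Matrix.diagonal_add]
  commutes' c := by ext i j; simp [Matrix.algebraMap_matrix_apply, Matrix.diagonal_apply]

lemma incl_apply (a : A) : incl n A a = Matrix.diagonal fun _ => a := rfl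

lemma incl_mul_apply (a : A) (M : Matrix (Idx n) (Idx n) A) (i j : Idx n) :
    (incl n A a * M) i j = a * M i j := by
  rw [incl_apply, Matrix.diagonal_mul]

lemma mul_incl_apply (a : A) (M : Matrix (Idx n) (Idx n) A) (i j : Idx n) :
    (M * incl n A a) i j = M i j * a := by
  rw [incl_apply, Matrix.mul_diagonal]

/-- The adjoined leg `E_{ij} ↦ J^{|i|+|j|} E_{ij}`. -/
def newLeg (L : LegSystem n ι A) : Mat n →ₐ[K] Matrix (Idx n) (Idx n) A where
  toFun X := Matrix.of fun i j => X i j • L.Jp (par i + par j)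
  map_one' := by
    ext i j
    rw [Matrix.of_apply, Matrix.one_apply, Matrix.one_apply]
    split_ifs with h
    · subst h; simp [CharTwo.add_self_eq_zero]
    · simp
  map_mul' X Y := by
    ext i j
    simp only [Matrix.of_apply, Matrix.mul_apply, Finset.sum_smul]
    refine Finset.sum_congr rfl fun k _ => ?_
    rw [smul_mul_smul_comm, Jp_mul]
    congr 2
    generalize par i = i, par j = j, par k = k
    revert i j k; decide
  map_zero' := by ext i j; simp
  map_add' X Y := by ext i j; simp [add_smul]
  commutes' c := by
    ext i j
    rw [Matrix.of_apply, Matrix.algebraMap_matrix_apply, Matrix.algebraMap_matrix_apply]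
    split_ifs with h
    · subst h; simp [CharTwo.add_self_eq_zero, Algebra.smul_def]
    · simp

lemma newLeg_apply (X : Mat n) (i j : Idx n) :
    L.newLeg X i j = X i j • L.Jp (par i + par j) := rfl

/-- The parity operator after adjoining a leg. -/
def newJ (L : LegSystem n ι A) : Matrix (Idx n) (Idx n) A :=
  Matrix.diagonal fun i => sgn (par i) • L.J

/-- Adjoining a leg. -/
def ext (L : LegSystem n ι A) : LegSystem n (Option ι) (Matrix (Idx n) (Idx n) A) where
  leg k := k.elim L.newLeg fun k => (incl n A).comp (L.leg k)
  J := L.newJ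
  J_sq := by
    unfold newJ
    rw [Matrix.diagonal_mul_diagonal]
    simp only [smul_mul_smul_comm, L.J_sq, sgn_mul_self, one_smul]
    exact Matrix.diagonal_one
  J_leg k a b := by
    cases k with
    | none =>
      ext i j
      simp only [Option.elim_none, newJ, Matrix.diagonal_mul, Matrix.smul_apply,
        Matrix.mul_diagonal, newLeg_apply, E_apply]
      split_ifs with h
      · obtain ⟨rfl, rfl⟩ := h
        rw [one_smul, smul_mul_assoc, mul_smul_comm, smul_smul, ← Jp_one, Jp_mul, Jp_mul,
          add_comm (1 : ZMod 2), ← sgn_add]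
        congr 2
        generalize par a = a, par b = b
        revert a b; decide
      · simp
    | some k =>
      ext i j
      simp only [Option.elim_some, AlgHom.comp_apply, newJ,
        Matrix.smul_apply, Matrix.mul_diagonal, incl_apply, Matrix.diagonal_apply]
      split_ifs with h
      · subst h
        rw [smul_mul_assoc, mul_smul_comm, L.J_leg, smul_comm]
      · simp
  comm k l h a b c d := by
    cases k with
    | none =>
      cases l with
      | none => exact absurd rfl h
      | some l =>
        ext i j
        simp only [Option.elim_some, Option.elim_none, AlgHom.comp_apply, Matrix.smul_apply,
          incl_mul_apply, mul_incl_apply, newLeg_apply, E_apply]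
        split_ifs with h
        · obtain ⟨rfl, rfl⟩ := h
          rw [one_smul, Jp_leg]
        · simp
    | some k =>
      cases l with
      | none =>
        ext i j
        simp only [Option.elim_some, Option.elim_none, AlgHom.comp_apply, Matrix.smul_apply,
          incl_mul_apply, mul_incl_apply, newLeg_apply, E_apply]
        split_ifs with h
        · obtain ⟨rfl, rfl⟩ := h
          rw [one_smul, Jp_leg, smul_smul, mul_comm (par a + par b), sgn_mul_self, one_smul]
        · simp
      | some l =>
        simp only [Option.elim_some, AlgHom.comp_apply]
        rw [← map_mul, L.comm k l (fun e => h (by rw [e])), map_smul, map_mul]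

lemma ext_leg_some (k : ι) (X : Mat n) : L.ext.leg (some k) X = incl n A (L.leg k X) := rfl

lemma ext_leg_none (X : Mat n) : L.ext.leg none X = L.newLeg X := rfl

lemma ext_two_some (k l : ι) (Z : Mat2 n) :
    L.ext.two (some k) (some l) Z = incl n A (L.two k l Z) := by
  have : L.ext.two (some k) (some l) = (incl n A).toLinearMap ∘ₗ L.two k l := by
    refine mat2_hom_ext_tens fun X Y => ?_
    simp only [LinearMap.comp_apply, two_tens, AlgHom.toLinearMap_apply, map_mul, ext_leg_some]
  exact LinearMap.congr_fun this Z

/-- In the adjoined leg the second tensor factor becomes a matrix position. The power of `J` is the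
price for making the new leg supercommute with the old ones. -/
lemma ext_two_none (k : ι) (Z : Mat2 n) (i j : Idx n) :
    L.ext.two (some k) none Z i j = L.leg k (entry i j Z) * L.Jp (par i + par j) := by
  let f : Matrix (Idx n) (Idx n) A →ₗ[K] A :=
    { toFun := fun M => M i j, map_add' := fun _ _ => rfl, map_smul' := fun _ _ => rfl }
  have : f ∘ₗ L.ext.two (some k) none =
      (LinearMap.mulRight K (L.Jp (par i + par j))) ∘ₗ (L.leg k).toLinearMap ∘ₗ entry i j := by
    refine mat2_hom_ext_tens fun X Y => ?_
    simp only [LinearMap.comp_apply, two_tens, AlgHom.toLinearMap_apply, entry_tens,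
      LinearMap.mulRight_apply, map_smul, ext_leg_some, ext_leg_none]
    change (incl n A _ * L.newLeg Y) i j = _
    rw [incl_mul_apply, newLeg_apply, mul_smul_comm]
  exact LinearMap.congr_fun this Z

end LegSystem

/-! ### The operator `PS` -/

@[simp] lemma idx_neg_neg (a : Idx n) : -(-a) = a := Subtype.ext (neg_neg a.1)

lemma idx_val_neg (a : Idx n) : (-a).1 = -a.1 := rfl

lemma idx_neg_eq_iff (a b : Idx n) : -a = b ↔ a = -b := by
  constructor <;> (rintro rfl; simp)

lemma idx_ne_zero (a : Idx n) : a.1 ≠ 0 := (Finset.mem_erase.1 a.2).1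

lemma idx_lt_iff (a b : Idx n) : a < b ↔ a.1 < b.1 := Iff.rfl

lemma P_mul_tens (a b c d : Idx n) : P n * tens (E a b) (E c d) =
    sgn (par a + (par a + par c) * (par a + par b)) • tens (E c b) (E a d) := by
  unfold P
  rw [Finset.sum_mul, Finset.sum_eq_single c]
  · rw [Finset.sum_mul, Finset.sum_eq_single a]
    · rw [smul_mul_assoc, tens_E_mul, if_pos ⟨rfl, rfl⟩, smul_smul, ← sgn_add]
    · intro j _ hj
      rw [smul_mul_assoc, tens_E_mul, if_neg (by simp [hj]), smul_zero]
    · simp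
  · intro i _ hi
    rw [Finset.sum_mul]
    refine Finset.sum_eq_zero fun j _ => ?_
    rw [smul_mul_assoc, tens_E_mul, if_neg (by simp [hi]), smul_zero]
  · simp

lemma P_mul_S : P n * S n =
    (∑ i : Idx n, ∑ j : Idx n, (sgn (par i) * q ^ expo i j) • tens (E j i) (E i j)) +
    xi • ∑ i : Idx n, ∑ j : Idx n,
      (if i < j then
        tens (E i i) (E j j) - sgn (par i + par j) • tens (E i (-i)) (E (-j) j)
      else 0) := by
  unfold S
  rw [mul_add, mul_smul_comm]
  simp only [Finset.mul_sum]
  congr 1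
  · refine Finset.sum_congr rfl fun i _ => Finset.sum_congr rfl fun j _ => ?_
    rw [mul_smul_comm, P_mul_tens, smul_smul, CharTwo.add_self_eq_zero, mul_zero, add_zero,
      mul_comm]
  · congr 1
    refine Finset.sum_congr rfl fun i _ => Finset.sum_congr rfl fun j _ => ?_
    split_ifs
    · rw [mul_smul_comm, tens_add_left, mul_add, P_mul_tens, P_mul_tens, smul_add, smul_smul,
        smul_smul, sub_eq_add_neg, ← neg_smul, ← sgn_add, ← sgn_add, par_neg, par_neg]
      congr 1
      · convert one_smul K _
        rw [← sgn_zero]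
        congr 1
        generalize par i = a, par j = b
        revert a b; decide
      · congr 1
        rw [neg_sgn]
        congr 1
        generalize par i = a, par j = b
        revert a b; decide
    · rw [mul_zero]

lemma st_E (a b : Idx n) : st (E a b) = sgn ((par a + par b) * par a) • E b a := by
  ext i j
  simp only [st, LinearMap.coe_mk, AddHom.coe_mk, Matrix.of_apply, E_apply, Matrix.smul_apply]
  by_cases h : a = j ∧ b = i
  · obtain ⟨rfl, rfl⟩ := h; simp
  · rw [if_neg h, if_neg (by tauto)]; simp

lemma st2_tens (X Y : Mat n) : st2 (tens X Y) = tens (st X) (st Y) := rfl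

lemma st2_tens_E (a b c d : Idx n) : st2 (tens (E a b) (E c d)) =
    sgn ((par a + par b) * par a + (par c + par d) * par c) • tens (E b a) (E d c) := by
  rw [st2_tens, st_E, st_E, tens_smul_left, tens_smul_right, smul_smul, ← sgn_add]

lemma st2_P : st2 (P n) = P n := by
  unfold P
  simp only [map_sum, map_smul, st2_tens_E]
  rw [Finset.sum_comm]
  refine Finset.sum_congr rfl fun i _ => Finset.sum_congr rfl fun j _ => ?_
  rw [smul_smul, ← sgn_add]
  congr 2
  generalize par i = a, par j = b
  revert a b; decide

lemma st2_P_mul_st2_S : st2 (P n) * st2 (S n) =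
    (∑ i : Idx n, ∑ j : Idx n, (sgn (par i) * q ^ expo i j) • tens (E j i) (E i j)) +
    xi • ∑ i : Idx n, ∑ j : Idx n,
      (if j < i then tens (E i i) (E j j) - tens (E i (-i)) (E (-j) j) else 0) := by
  rw [st2_P]
  unfold S
  rw [map_add, map_smul, mul_add, mul_smul_comm]
  simp only [map_sum, Finset.mul_sum]
  congr 1
  · refine Finset.sum_congr rfl fun i _ => Finset.sum_congr rfl fun j _ => ?_
    rw [map_smul, st2_tens_E, mul_smul_comm, mul_smul_comm, P_mul_tens]
    simp [CharTwo.add_self_eq_zero, smul_smul, mul_comm]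
  · congr 1
    -- Transposing exchanges the roles of the two indices, which turns the condition i < j of `S`
    -- into j < i.
    rw [Finset.sum_comm]
    refine Finset.sum_congr rfl fun i _ => Finset.sum_congr rfl fun j _ => ?_
    split_ifs
    · rw [map_smul, mul_smul_comm, tens_add_left, map_add, mul_add, st2_tens_E, st2_tens_E,
        mul_smul_comm, mul_smul_comm, P_mul_tens, P_mul_tens, smul_add, smul_smul,
        smul_smul, smul_smul, smul_smul, sub_eq_add_neg, ← neg_one_smul K (tens (E i (-i)) _),
        ← sgn_one, ← sgn_add, ← sgn_add, ← sgn_add, ← sgn_add, par_neg, par_neg]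
      congr 1
      · convert one_smul K _
        rw [← sgn_zero]
        congr 1
        generalize par i = a, par j = b
        revert a b; decide
      · congr 2
        generalize par i = a, par j = b
        revert a b; decide
    · rw [map_zero, mul_zero]

lemma st_Phi : st (Phi n) = ∑ i : Idx n, E i (-i) := by
  unfold Phi
  rw [map_sum]
  refine Fintype.sum_equiv ⟨fun i => -i, fun i => -i, idx_neg_neg, idx_neg_neg⟩ _ _ fun i => ?_
  rw [map_smul, st_E, smul_smul, ← sgn_add, par_neg]
  simp only [Equiv.coe_fn_mk, idx_neg_neg]
  convert one_smul K _
  rw [← sgn_zero]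
  congr 1
  generalize par i = a
  revert a; decide

/-- The coefficient of `v_b ⊗ v_a` in `PS (v_a ⊗ v_b)`. -/
def cg (a b : Idx n) : K := sgn (par a * par b) * q ^ expo a b
/-- The coefficient of `v_a ⊗ v_b` in `PS (v_a ⊗ v_b)`. -/
def ch (a b : Idx n) : K := if a < b then xi else 0
/-- The coefficient of `v_{-a} ⊗ v_{-b}` in `PS (v_a ⊗ v_b)`. -/
def ck (a b : Idx n) : K := if -a < b then xi * sgn (par b) else 0

/-- For a fixed even `o` the element E_{ao} has parity |a| and behaves under left multiplication
like the vector v_a. This allows PS to be computed on v_a ⊗ v_b without leaving the algebra of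
operators. -/
lemma PS_mul_tens (o : Idx n) (ho : par o = 0) (a b : Idx n) :
    P n * S n * tens (E a o) (E b o) = cg a b • tens (E b o) (E a o) +
      ch a b • tens (E a o) (E b o) + ck a b • tens (E (-a) o) (E (-b) o) := by
  rw [P_mul_S, add_mul, smul_mul_assoc, add_assoc]
  simp only [Finset.sum_mul]
  congr 1
  · rw [Finset.sum_eq_single a, Finset.sum_eq_single b]
    · rw [smul_mul_assoc, tens_E_mul, if_pos ⟨rfl, rfl⟩, smul_smul]
      congr 1
      rw [cg, mul_right_comm, ← sgn_add, ho]
      congr 2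
      generalize par a = a, par b = b
      revert a b; decide
    · intro j _ hj
      rw [smul_mul_assoc, tens_E_mul, if_neg (by simp [hj]), smul_zero]
    · simp
    · intro i _ hi
      refine Finset.sum_eq_zero fun j _ => ?_
      rw [smul_mul_assoc, tens_E_mul, if_neg (by simp [hi]), smul_zero]
    · simp
  · have h : ∀ i j : Idx n, (if i < j then
        tens (E i i) (E j j) - sgn (par i + par j) • tens (E i (-i)) (E (-j) j) else 0) *
        tens (E a o) (E b o) =
        (if i = a ∧ j = b then (if a < b then tens (E a o) (E b o) else 0) else 0) +
        (if i = -a ∧ j = b then (if -a < b then sgn (par b) • tens (E (-a) o) (E (-b) o)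
          else 0) else 0) := by
      intro i j
      by_cases hij : i < j
      · rw [if_pos hij, sub_mul, smul_mul_assoc, tens_E_mul, tens_E_mul, sub_eq_add_neg]
        congr 1
        · by_cases h : i = a ∧ j = b
          · rw [if_pos h, if_pos h]
            obtain ⟨rfl, rfl⟩ := h
            simp [CharTwo.add_self_eq_zero, hij]
          · rw [if_neg h, if_neg h]
        · simp only [idx_neg_eq_iff]
          by_cases h : i = -a ∧ j = b
          · rw [if_pos h, if_pos h]
            obtain ⟨rfl, rfl⟩ := h
            rw [if_pos hij, smul_smul, ← neg_smul, ← sgn_add, neg_sgn, par_neg,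
              par_neg, ho]
            congr 2
            generalize par a = a, par j = b
            revert a b; decide
          · rw [if_neg h, if_neg h]; simp
      · rw [if_neg hij, zero_mul]
        by_cases h : i = a ∧ j = b
        · obtain ⟨rfl, rfl⟩ := h
          rw [if_pos ⟨rfl, rfl⟩, if_neg hij, if_neg, add_zero]
          rintro ⟨h, -⟩
          have := idx_ne_zero i
          have h2 := congrArg Subtype.val h
          rw [idx_val_neg] at h2
          omega
        · rw [if_neg h]
          by_cases h : i = -a ∧ j = b
          · obtain ⟨rfl, rfl⟩ := h
            simp [hij]
          · rw [if_neg h]; simp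
    simp only [h, Finset.sum_add_distrib, ite_and, Finset.sum_ite_eq', Finset.mem_univ, if_true,
      Finset.sum_ite_irrel, Finset.sum_const_zero]
    rw [smul_add, ch, ck]
    congr 1
    · split_ifs <;> simp
    · split_ifs <;> simp [smul_smul]

/-- Every index comes with an even one. -/
lemma exists_even (a : Idx n) : ∃ o : Idx n, par o = 0 := by
  by_cases h : a.1 < 0
  · refine ⟨-a, ?_⟩
    rw [par_neg, par, if_pos h]; decide
  · exact ⟨a, by rw [par, if_neg h]⟩

/-- The vectors E_{ao} ⊗ E_{bo} detect operators: each E_{aa} ⊗ E_{bb} factors through one of them,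
and these idempotents sum to 1. -/
lemma mat2_ext_tens {Z Z' : Mat2 n}
    (h : ∀ o : Idx n, par o = 0 → ∀ a b, Z * tens (E a o) (E b o) = Z' * tens (E a o) (E b o)) :
    Z = Z' := by
  have key : ∀ a b : Idx n, Z * tens (E a a) (E b b) = Z' * tens (E a a) (E b b) := by
    intro a b
    obtain ⟨o, ho⟩ := exists_even a
    have : tens (E a a) (E b b) =
        tens (E a o) (E b o) * (sgn ((par b + par o) * (par o + par a)) • tens (E o a) (E o b)) := by
      rw [mul_smul_comm, tens_E_mul, if_pos ⟨rfl, rfl⟩, smul_smul, sgn_mul_self, one_smul]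
    rw [this, ← mul_assoc, h o ho, mul_assoc]
  rw [← mul_one Z, ← mul_one Z', ← tens_one_one, one_eq_sum_E]
  simp only [tens_sum_left, tens_sum_right, Finset.mul_sum, key]

lemma q_ne_zero : q ≠ 0 := RatFunc.X_ne_zero

/-- Together with the signs of `a` and `b`, these cases decide every conditional in the coefficients
of PS. -/
lemma idx_trichotomy (a b : Idx n) :
    a = b ∨ a = -b ∨ a.1.natAbs < b.1.natAbs ∨ b.1.natAbs < a.1.natAbs := by
  simp only [Subtype.ext_iff, idx_val_neg]
  omega

lemma idx_sign (a : Idx n) : a.1 < 0 ∨ 0 < a.1 := by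
  have := idx_ne_zero a; omega

/-! ### Quadratic and braid relations on vectors, over an arbitrary field -/

section
variable {F M : Type*} [Field F] [AddCommGroup M] [Module F M]

/-- `cg` over an arbitrary field. -/
def gcg (x : F) (a b : Idx n) : F := (if a.1 < 0 ∧ b.1 < 0 then -1 else 1) * x ^ expo a b
/-- `ch` over an arbitrary field. -/
def gch (x : F) (a b : Idx n) : F := if a.1 < b.1 then x - x⁻¹ else 0
/-- `ck` over an arbitrary field. -/
def gck (x : F) (a b : Idx n) : F :=
  if -a.1 < b.1 then (x - x⁻¹) * (if b.1 < 0 then -1 else 1) else 0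

/-- Over an abstract field `x` is an opaque variable for `field_simp` and `ring`. The vectors need
not be independent: in each case the coefficients of the two sides agree formally. -/
lemma generic_quad (x : F) (hx : x ≠ 0) (v : Idx n → Idx n → M) (T : M →ₗ[F] M)
    (hT : ∀ a b, T (v a b) = gcg x a b • v b a + gch x a b • v a b + gck x a b • v (-a) (-b))
    (a b : Idx n) : T (T (v a b)) = (x - x⁻¹) • T (v a b) + v a b := by
  rcases idx_sign a with ha | ha <;> rcases idx_sign b with hb | hb <;>
  rcases idx_trichotomy a b with rfl | rfl | hab | hab <;>
  first
  -- This discards the combinations of signs and sizes that cannot occur.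
  | (exfalso; (try simp only [idx_val_neg] at *); omega)
  | ((try simp only [idx_val_neg] at ha)
     simp only [hT, map_add, map_smul, idx_neg_neg]
     simp (disch := ((try simp only [idx_val_neg, Subtype.ext_iff]); omega)) only
       [gcg, gch, gck, expo, eps, if_pos, if_neg, if_true]
     simp only [mul_one, one_mul, zero_mul, add_zero, zero_add, zpow_one, zpow_neg,
       zpow_zero, zero_smul, one_smul]
     match_scalars <;> field_simp <;> ring)

set_option maxHeartbeats 1000000 in
-- Only the starting indices are positive; negative ones appear along the way through `gck`.
-- Starting vectors with negative indices are left to the Clifford symmetry in `braid`, which keeps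
-- the case distinction to the relative order of a, b, c.
lemma generic_braid (x : F) (hx : x ≠ 0) (v : Idx n → Idx n → Idx n → M) (T T' : M →ₗ[F] M)
    (hT : ∀ a b c, T (v a b c) =
      gcg x a b • v b a c + gch x a b • v a b c + gck x a b • v (-a) (-b) c)
    (hT' : ∀ a b c, T' (v a b c) =
      gcg x b c • v a c b + gch x b c • v a b c + gck x b c • v a (-b) (-c))
    (a b c : Idx n) (ha : 0 < a.1) (hb : 0 < b.1) (hc : 0 < c.1) :
    T (T' (T (v a b c))) = T' (T (T' (v a b c))) := by
  have h1 : a = b ∨ a.1 < b.1 ∨ b.1 < a.1 := by rw [Subtype.ext_iff]; omega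
  have h2 : b = c ∨ b.1 < c.1 ∨ c.1 < b.1 := by rw [Subtype.ext_iff]; omega
  have h3 : a = c ∨ a.1 < c.1 ∨ c.1 < a.1 := by rw [Subtype.ext_iff]; omega
  rcases h1 with rfl | hab | hab <;> rcases h2 with h | hbc | hbc <;>
  rcases h3 with h' | hac | hac <;> (try subst h) <;> (try subst h') <;>
  first
  | (exfalso; omega)
  | (simp only [hT, hT', map_add, map_smul, idx_neg_neg]
     simp (disch := ((try simp only [idx_val_neg, Subtype.ext_iff]); omega)) only
       [gcg, gch, gck, expo, eps, if_pos, if_neg, if_true]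
     simp only [mul_one, one_mul, zero_mul, add_zero, zero_add, zpow_one, zpow_neg,
       zpow_zero, zero_smul, one_smul]
     match_scalars <;> field_simp <;> ring)

/-- Commutation relations of Hecke-Clifford type are inherited by the difference of the two sides
of the braid relation. -/
lemma braid_clifford {R : Type*} [Ring R] [Algebra F R] (x : F) (t t' c c' c'' : R)
    (h1 : t * c = c' * t) (h2 : t' * c' = c'' * t') (h3 : t * c'' = c'' * t)
    (h4 : t' * c = c * t') (h5 : t * c' = c * t + x • (c' - c))
    (h6 : t' * c'' = c' * t' + x • (c'' - c')) (q1 : t * t = x • t + 1)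
    (q2 : t' * t' = x • t' + 1) :
    (t * t' * t - t' * t * t') * c = c'' * (t * t' * t - t' * t * t') ∧
    (t * t' * t - t' * t * t') * c' = c' * (t * t' * t - t' * t * t') ∧
    (t * t' * t - t' * t * t') * c'' = c * (t * t' * t - t' * t * t') := by
  have r1 : ∀ z, t * (c * z) = c' * (t * z) := fun z => by rw [← mul_assoc, h1, mul_assoc]
  have r2 : ∀ z, t' * (c' * z) = c'' * (t' * z) := fun z => by rw [← mul_assoc, h2, mul_assoc]
  have r3 : ∀ z, t * (c'' * z) = c'' * (t * z) := fun z => by rw [← mul_assoc, h3, mul_assoc]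
  have r4 : ∀ z, t' * (c * z) = c * (t' * z) := fun z => by rw [← mul_assoc, h4, mul_assoc]
  have r5 : ∀ z, t * (c' * z) = c * (t * z) + x • (c' * z - c * z) := fun z => by
    rw [← mul_assoc, h5, add_mul, smul_mul_assoc, sub_mul, mul_assoc]
  have r6 : ∀ z, t' * (c'' * z) = c' * (t' * z) + x • (c'' * z - c' * z) := fun z => by
    rw [← mul_assoc, h6, add_mul, smul_mul_assoc, sub_mul, mul_assoc]
  -- All Clifford elements are moved to the left of `t` and `t'`; the correction terms then cancel
  -- modulo the quadratic relations.
  refine ⟨?_, ?_, ?_⟩ <;>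
  simp only [sub_mul, mul_sub, mul_assoc, h1, h2, h3, h4, h5, h6, r1, r2, r3, r4, r5, r6,
    mul_add, mul_smul_comm, q1, q2, smul_add, smul_sub, mul_one] <;>
  module

end

/-! ### The quadratic relation for PS and the inverse of S -/

lemma cg_eq (a b : Idx n) : cg a b = gcg q a b := by
  unfold cg gcg par
  congr 1
  split_ifs <;> first | omega | simp

lemma ch_eq (a b : Idx n) : ch a b = gch q a b := rfl

lemma ck_eq (a b : Idx n) : ck a b = gck q a b := by
  unfold ck gck par
  have : (-a < b) ↔ -a.1 < b.1 := Iff.rfl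
  simp only [this]
  split_ifs <;> simp [xi]

lemma PS_sq : P n * S n * (P n * S n) = xi • (P n * S n) + 1 := by
  refine mat2_ext_tens fun o ho a b => ?_
  rw [add_mul, one_mul, smul_mul_assoc, mul_assoc]
  exact generic_quad q q_ne_zero (fun a b => tens (E a o) (E b o))
    (LinearMap.mulLeft K (P n * S n))
    (fun a b => by
      rw [LinearMap.mulLeft_apply, PS_mul_tens o ho, cg_eq, ch_eq, ck_eq]) a b

lemma PS_mul_sub : P n * S n * (P n * S n - xi • 1) = 1 := by
  rw [mul_sub, PS_sq, mul_smul_comm, mul_one, add_sub_cancel_left]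

lemma sub_mul_PS : (P n * S n - xi • 1) * (P n * S n) = 1 := by
  rw [sub_mul, PS_sq, smul_mul_assoc, one_mul, add_sub_cancel_left]

/-- The inverse of `S`. -/
def Sinv (n : ℕ) : Mat2 n := (P n * S n - xi • 1) * P n

lemma Sinv_mul_S : Sinv n * S n = 1 := by
  rw [Sinv, mul_assoc, sub_mul_PS]

lemma S_mul_Sinv : S n * Sinv n = 1 := by
  have : S n = P n * (P n * S n) := by rw [← mul_assoc, P_mul_P, one_mul]
  rw [this, Sinv, mul_assoc, ← mul_assoc (P n * S n), PS_mul_sub, one_mul, P_mul_P]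

lemma isUnit_S : IsUnit (S n) := ⟨⟨S n, Sinv n, S_mul_Sinv, Sinv_mul_S⟩, rfl⟩

lemma inverse_S : Ring.inverse (S n) = Sinv n :=
  Ring.inverse_unit ⟨S n, Sinv n, S_mul_Sinv, Sinv_mul_S⟩

lemma PS_mem_evenPart : P n * S n ∈ evenPart n := mul_mem_evenPart P_mem_evenPart S_mem_evenPart

lemma Sinv_mem_evenPart : Sinv n ∈ evenPart n :=
  mul_mem_evenPart (sub_mem PS_mem_evenPart (Submodule.smul_mem _ _ one_mem_evenPart))
    P_mem_evenPart

/-! ### The operator `Φ` -/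

lemma Phi_mul_E (a b : Idx n) : Phi n * E a b = sgn (par a + 1) • E (-a) b := by
  unfold Phi
  rw [Finset.sum_mul, Finset.sum_eq_single (-a)]
  · rw [smul_mul_assoc, idx_neg_neg, E_mul_E_same, par_neg]
  · intro i _ hi
    rw [smul_mul_assoc, E_mul_E_ne, smul_zero]
    rwa [Ne, idx_neg_eq_iff]
  · simp

lemma tens_Phi_mul (a b o : Idx n) : tens (Phi n) 1 * tens (E a o) (E b o) =
    sgn (par a + 1) • tens (E (-a) o) (E b o) := by
  rw [tens_one_mul_tens, Phi_mul_E, tens_smul_left]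

lemma one_tens_mul_tens (Y : Mat n) (a b c d : Idx n) :
    tens 1 (E c d) * tens (E a b) Y =
      sgn ((par c + par d) * (par a + par b)) • tens (E a b) (E c d * Y) := by
  rw [tens_mul_tens, one_mul]

lemma tens_one_Phi_mul (a b o : Idx n) (ho : par o = 0) :
    tens 1 (Phi n) * tens (E a o) (E b o) =
      sgn (par a + par b + 1) • tens (E a o) (E (-b) o) := by
  have : tens 1 (Phi n) * tens (E a o) (E b o) = sgn (par a) • tens (E a o) (Phi n * E b o) := by
    unfold Phi
    simp only [tens_sum_right, tens_smul_right, Finset.sum_mul, smul_mul_assoc, Finset.smul_sum,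
      one_tens_mul_tens]
    refine Finset.sum_congr rfl fun i _ => ?_
    rw [smul_comm, par_neg, ho]
    congr 2
    generalize par i = i, par a = a
    revert i a; decide
  rw [this, Phi_mul_E, tens_smul_right, smul_smul, ← sgn_add, add_assoc]

lemma cg_neg_left (a b : Idx n) : cg (-a) b = sgn (par b) * cg a b := by
  have : expo (-a) b = expo a b := by
    unfold expo
    rw [add_comm]
    congr 2
    · simp only [idx_neg_eq_iff, idx_neg_neg]
    · simp only [idx_neg_eq_iff]
  rw [cg, cg, this, ← mul_assoc, ← sgn_add, par_neg]
  congr 2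
  ring

lemma ch_neg_left (a b : Idx n) : ch (-a) b = sgn (par b) * ck a b := by
  rw [ch, ck]
  split_ifs
  · rw [mul_left_comm, sgn_mul_self, mul_one]
  · simp

lemma ck_neg_left (a b : Idx n) : ck (-a) b = sgn (par b) * ch a b := by
  rw [ch, ck, idx_neg_neg]
  split_ifs
  · rw [mul_comm]
  · simp

/-- Replacing a by −a preserves `cg` and exchanges `ch` with `ck`, in each case up to the sign `sgn
(par b)`. These signs match those that Φ produces in the two factors. -/
lemma PS_mul_Phi : P n * S n * tens (Phi n) 1 = tens 1 (Phi n) * (P n * S n) := by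
  refine mat2_ext_tens fun o ho a b => ?_
  rw [mul_assoc, tens_Phi_mul, mul_smul_comm, PS_mul_tens o ho, mul_assoc (tens 1 (Phi n)),
    PS_mul_tens o ho, mul_add, mul_add]
  simp only [mul_smul_comm, tens_one_Phi_mul _ _ o ho, smul_add, smul_smul, idx_neg_neg, par_neg,
    cg_neg_left, ch_neg_left, ck_neg_left]
  have e1 : sgn (par a + 1) * (sgn (par b) * cg a b) = cg a b * sgn (par b + par a + 1) := by
    rw [← mul_assoc, ← sgn_add, mul_comm]; congr 2; ring
  have e2 : sgn (par a + 1) * (sgn (par b) * ck a b) =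
      ck a b * sgn (par a + 1 + (par b + 1) + 1) := by
    rw [← mul_assoc, ← sgn_add, mul_comm]; congr 2
    generalize par a = a, par b = b
    revert a b; decide
  have e3 : sgn (par a + 1) * (sgn (par b) * ch a b) = ch a b * sgn (par a + par b + 1) := by
    rw [← mul_assoc, ← sgn_add, mul_comm]; congr 2; ring
  rw [e1, e2, e3]
  abel

lemma Phi_sq : Phi n * Phi n = -1 := by
  conv_lhs => enter [2]; unfold Phi
  rw [Finset.mul_sum]
  have : ∀ i : Idx n, Phi n * (sgn (par i) • E i (-i)) = -E (-i) (-i) := by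
    intro i
    rw [mul_smul_comm, Phi_mul_E, smul_smul, ← sgn_add, ← neg_one_smul K, ← sgn_one]
    congr 2
    generalize par i = i
    revert i; decide
  rw [Finset.sum_congr rfl fun i _ => this i, Finset.sum_neg_distrib, one_eq_sum_E]
  congr 1
  exact Fintype.sum_equiv ⟨fun i => -i, fun i => -i, idx_neg_neg, idx_neg_neg⟩ _ _ fun i => rfl

namespace LegSystem
variable {ι A : Type} [Ring A] [Algebra K A] {L : LegSystem n ι A} {k l m : ι}

/-! ### The braid relation and the Yang-Baxter equation -/

/-- `PS` in the legs `k`, `l`. -/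
abbrev T (L : LegSystem n ι A) (k l : ι) : A := L.two k l (P n * S n)

/-- `S` in the legs `k`, `l`. -/
abbrev R (L : LegSystem n ι A) (k l : ι) : A := L.two k l (S n)

/-- `S⁻¹` in the legs `k`, `l`. -/
abbrev Ri (L : LegSystem n ι A) (k l : ι) : A := L.two k l (Sinv n)

/-- `Φ` in the leg `k`. -/
abbrev C (L : LegSystem n ι A) (k : ι) : A := L.leg k (Phi n)

lemma T_sq (h : k ≠ l) : L.T k l * L.T k l = xi • L.T k l + 1 := by
  rw [T, ← two_mul h, PS_sq, map_add, map_smul, two_one]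

lemma T_eq (h : k ≠ l) : L.T k l = L.flip k l * L.R k l := two_mul h _ _

lemma R_mul_Ri (h : k ≠ l) : L.R k l * L.Ri k l = 1 := by
  rw [R, Ri, ← two_mul h, S_mul_Sinv, two_one]

lemma Ri_mul_R (h : k ≠ l) : L.Ri k l * L.R k l = 1 := by
  rw [R, Ri, ← two_mul h, Sinv_mul_S, two_one]

lemma T_mul_C (h : k ≠ l) : L.T k l * L.C k = L.C l * L.T k l := by
  have := congrArg (L.two k l) (PS_mul_Phi (n := n))
  rwa [two_mul h (P n * S n), two_mul h _ (P n * S n), two_tens, two_tens, map_one, map_one, one_mul,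
    mul_one] at this

/-- This is `T_mul_C` multiplied by T⁻¹ on both sides, with T⁻¹ = T − ξ from the quadratic relation.
-/
lemma T_mul_C' (h : k ≠ l) :
    L.T k l * L.C l = L.C k * L.T k l + xi • (L.C l - L.C k) := by
  have h1 := T_mul_C (L := L) h
  have h2 : (L.T k l - xi • 1) * L.T k l = 1 := by
    rw [sub_mul, T_sq h, smul_mul_assoc, one_mul, add_sub_cancel_left]
  have h3 : L.T k l * (L.T k l - xi • 1) = 1 := by
    rw [mul_sub, T_sq h, mul_smul_comm, mul_one, add_sub_cancel_left]
  have h4 : (L.T k l - xi • 1) * L.C l = L.C k * (L.T k l - xi • 1) := by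
    calc (L.T k l - xi • 1) * L.C l
        = (L.T k l - xi • 1) * (L.C l * L.T k l) * (L.T k l - xi • 1) := by
          rw [mul_assoc, mul_assoc, h3, mul_one]
      _ = _ := by rw [← h1, ← mul_assoc, h2, one_mul]
  rw [sub_mul, mul_sub, smul_mul_assoc, mul_smul_comm, one_mul, mul_one] at h4
  rw [smul_sub, sub_eq_iff_eq_add.1 h4]
  abel

/-- The three-leg analogue of `mat2_ext_tens`: vectors detect elements of `A` under left
multiplication. -/
lemma legs_ext {z z' : A} (h : ∀ o : Idx n, par o = 0 → ∀ a b c,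
    z * (L.leg k (E a o) * L.leg l (E b o) * L.leg m (E c o)) =
    z' * (L.leg k (E a o) * L.leg l (E b o) * L.leg m (E c o))) (hkl : k ≠ l) (hkm : k ≠ m)
    (hlm : l ≠ m) : z = z' := by
  have key : ∀ a b c : Idx n, z * (L.leg k (E a a) * L.leg l (E b b) * L.leg m (E c c)) =
      z' * (L.leg k (E a a) * L.leg l (E b b) * L.leg m (E c c)) := by
    intro a b c
    obtain ⟨o, ho⟩ := exists_even a
    -- The covectors are multiplied in reverse order, so that neighbours contract to even
    -- idempotents and no sign appears.
    have : L.leg k (E a a) * L.leg l (E b b) * L.leg m (E c c) =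
        L.leg k (E a o) * L.leg l (E b o) * L.leg m (E c o) *
        (L.leg m (E o c) * L.leg l (E o b) * L.leg k (E o a)) := by
      have h1 : L.leg m (E c o) * (L.leg m (E o c) * L.leg l (E o b) * L.leg k (E o a)) =
          sgn ((par c + par c) * (par o + par b)) • sgn ((par c + par c) * (par o + par a)) •
          (L.leg l (E o b) * L.leg k (E o a) * L.leg m (E c c)) := by
        rw [← mul_assoc, ← mul_assoc, ← map_mul, E_mul_E_same, L.comm m l hlm.symm,
          smul_mul_assoc, mul_assoc, L.comm m k hkm.symm, mul_smul_comm, mul_assoc]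
      simp only [CharTwo.add_self_eq_zero, zero_mul, sgn_zero, one_smul] at h1
      have h2 : L.leg l (E b o) * (L.leg l (E o b) * L.leg k (E o a)) =
          sgn ((par b + par b) * (par o + par a)) • (L.leg k (E o a) * L.leg l (E b b)) := by
        rw [← mul_assoc, ← map_mul, E_mul_E_same, L.comm l k hkl.symm]
      simp only [CharTwo.add_self_eq_zero, zero_mul, sgn_zero, one_smul] at h2
      rw [mul_assoc (L.leg k (E a o) * _), h1, ← mul_assoc, mul_assoc (L.leg k (E a o)), h2,
        ← mul_assoc (L.leg k (E a o)), ← map_mul, E_mul_E_same]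
    rw [this, ← mul_assoc, h o ho, mul_assoc]
  have e : (1 : A) = ∑ a, ∑ b, ∑ c, L.leg k (E a a) * L.leg l (E b b) * L.leg m (E c c) := by
    simp only [← Finset.mul_sum, ← map_sum, ← one_eq_sum_E, map_one, mul_one]
  rw [← mul_one z, ← mul_one z', e]
  simp only [Finset.mul_sum, key]

lemma T_mul_vec (hkl : k ≠ l) (o : Idx n) (ho : par o = 0) (a b : Idx n) :
    L.T k l * (L.leg k (E a o) * L.leg l (E b o)) =
      gcg q a b • (L.leg k (E b o) * L.leg l (E a o)) +
      gch q a b • (L.leg k (E a o) * L.leg l (E b o)) +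
      gck q a b • (L.leg k (E (-a) o) * L.leg l (E (-b) o)) := by
  simp only [← two_tens]
  rw [T, ← two_mul hkl, PS_mul_tens o ho, map_add, map_add, map_smul, map_smul, map_smul, cg_eq,
    ch_eq, ck_eq]

/-- The defect `z` of the relation satisfies z C_k = C_m z, z C_l = C_l z and z C_m = C_k z. Hence
if `z` kills a vector, it also kills the vector with one index negated, and positive triples
suffice. -/
theorem braid (hkl : k ≠ l) (hkm : k ≠ m) (hlm : l ≠ m) :
    L.T k l * L.T l m * L.T k l = L.T l m * L.T k l * L.T l m := by
  refine sub_eq_zero.1 (legs_ext (L := L) (fun o ho => ?_) hkl hkm hlm)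
  obtain ⟨z1, z2, z3⟩ := braid_clifford xi (L.T k l) (L.T l m) (L.C k) (L.C l) (L.C m)
    (T_mul_C hkl) (T_mul_C hlm) (two_leg PS_mem_evenPart hkm hlm _)
    (two_leg PS_mem_evenPart hkl.symm hkm.symm _) (T_mul_C' hkl) (T_mul_C' hlm) (T_sq hkl)
    (T_sq hlm)
  set z := L.T k l * L.T l m * L.T k l - L.T l m * L.T k l * L.T l m with hz
  set v : Idx n → Idx n → Idx n → A :=
    fun a b c => L.leg k (E a o) * L.leg l (E b o) * L.leg m (E c o) with hv
  have hpos : ∀ a b c : Idx n, 0 < a.1 → 0 < b.1 → 0 < c.1 → z * v a b c = 0 := by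
    intro a b c ha hb hc
    have := generic_braid q q_ne_zero v (LinearMap.mulLeft K (L.T k l))
      (LinearMap.mulLeft K (L.T l m))
      (fun a b c => by
        simp only [hv, LinearMap.mulLeft_apply]
        rw [← mul_assoc, T_mul_vec hkl o ho, add_mul, add_mul, smul_mul_assoc, smul_mul_assoc,
          smul_mul_assoc])
      (fun a b c => by
        simp only [hv, LinearMap.mulLeft_apply, mul_assoc (L.leg k _)]
        rw [← mul_assoc, two_leg PS_mem_evenPart hkl.symm hkm.symm, mul_assoc, T_mul_vec hlm o ho,
          mul_add, mul_add, mul_smul_comm, mul_smul_comm, mul_smul_comm]) a b c ha hb hc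
    simp only [LinearMap.mulLeft_apply] at this
    rw [hz, sub_mul, mul_assoc, mul_assoc, mul_assoc, mul_assoc, this, sub_self]
  have hsmul : ∀ (s : ZMod 2) (x : A), sgn s • x = 0 → x = 0 := fun s x h =>
    (smul_eq_zero.1 h).resolve_left (sgn_ne_zero s)
  have neg1 : ∀ a b c, z * v a b c = 0 → z * v (-a) b c = 0 := by
    intro a b c h
    apply hsmul (par a + 1)
    have : L.C k * v a b c = sgn (par a + 1) • v (-a) b c := by
      simp only [hv, C]
      rw [← mul_assoc, ← mul_assoc, ← map_mul, Phi_mul_E, map_smul, smul_mul_assoc,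
        smul_mul_assoc]
    rw [← mul_smul_comm, ← this, ← mul_assoc, z1, mul_assoc, h, mul_zero]
  -- As `o` is even, E_{ao} has the parity of `a`, and the odd Φ passes it with that sign.
  have anti : ∀ (i j : ι) (_ : i ≠ j) (a : Idx n),
      L.C i * L.leg j (E a o) = sgn (par a) • (L.leg j (E a o) * L.C i) := by
    intro i j hij a
    simp only [C, Phi, map_sum, map_smul, Finset.sum_mul, Finset.mul_sum, Finset.smul_sum]
    refine Finset.sum_congr rfl fun x _ => ?_
    rw [smul_mul_assoc, L.comm i j hij, mul_smul_comm, smul_comm, par_neg, ho]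
    congr 2
    generalize par x = x, par a = a
    revert x a; decide
  have neg2 : ∀ a b c, z * v a b c = 0 → z * v a (-b) c = 0 := by
    intro a b c h
    apply hsmul (par a + (par b + 1))
    have : L.C l * v a b c = sgn (par a + (par b + 1)) • v a (-b) c := by
      simp only [hv]
      rw [← mul_assoc, ← mul_assoc, anti l k hkl.symm, smul_mul_assoc, mul_assoc (L.leg k _), C,
        ← map_mul, Phi_mul_E, map_smul, mul_smul_comm, smul_smul, ← sgn_add, smul_mul_assoc]
    rw [← mul_smul_comm, ← this, ← mul_assoc, z2, mul_assoc, h, mul_zero]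
  have neg3 : ∀ a b c, z * v a b c = 0 → z * v a b (-c) = 0 := by
    intro a b c h
    apply hsmul (par a + par b + (par c + 1))
    have : L.C m * v a b c = sgn (par a + par b + (par c + 1)) • v a b (-c) := by
      simp only [hv]
      rw [← mul_assoc, ← mul_assoc, anti m k hkm.symm, smul_mul_assoc, mul_assoc (L.leg k _),
        anti m l hlm.symm, mul_smul_comm, smul_smul, ← mul_assoc, smul_mul_assoc, mul_assoc, C,
        ← map_mul, Phi_mul_E, map_smul, mul_smul_comm, smul_smul, ← sgn_add, ← sgn_add]
    rw [← mul_smul_comm, ← this, ← mul_assoc, z3, mul_assoc, h, mul_zero]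
  intro a b c
  rw [zero_mul]
  change z * v a b c = 0
  have hneg : ∀ a : Idx n, 0 < a.1 ∨ 0 < (-a).1 := fun a => by
    rw [idx_val_neg]; have := idx_ne_zero a; omega
  have s1 : ∀ a b c : Idx n, 0 < a.1 → 0 < b.1 → z * v a b c = 0 := fun a b c ha hb => by
    rcases hneg c with hc | hc
    · exact hpos a b c ha hb hc
    · simpa using neg3 _ _ _ (hpos a b (-c) ha hb hc)
  have s2 : ∀ a b c : Idx n, 0 < a.1 → z * v a b c = 0 := fun a b c ha => by
    rcases hneg b with hb | hb
    · exact s1 a b c ha hb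
    · simpa using neg2 _ _ _ (s1 a (-b) c ha hb)
  rcases hneg a with ha | ha
  · exact s2 a b c ha
  · simpa using neg1 _ _ _ (s2 (-a) b c ha)

/-- With T = flip · R in the braid relation, all flips can be moved to the left; on both sides they
multiply to the flip of the outer legs, which is invertible. -/
theorem yang_baxter (hkl : k ≠ l) (hkm : k ≠ m) (hlm : l ≠ m) :
    L.R k l * L.R k m * L.R l m = L.R l m * L.R k m * L.R k l := by
  have h := braid (L := L) hkl hkm hlm
  rw [T_eq hkl, T_eq hlm] at h
  have hp1 : L.flip k l * L.flip l m * L.flip k l = L.flip k m := by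
    rw [flip_two_right hkl hkm hlm, mul_assoc, flip_mul_flip hkl, mul_one]
  have hp2 : L.flip l m * L.flip k l * L.flip l m = L.flip k m := by
    rw [flip_two' hlm hkl.symm hkm.symm, mul_assoc, flip_mul_flip hlm, mul_one]
  have e1 : L.flip k l * L.R k l * (L.flip l m * L.R l m) * (L.flip k l * L.R k l) =
      L.flip k m * (L.R l m * L.R k m * L.R k l) := by
    calc _ = L.flip k l * (L.R k l * L.flip l m) * (L.R l m * L.flip k l) * L.R k l := by
          simp only [mul_assoc]
      _ = L.flip k l * L.flip l m * (L.R k m * L.flip k l) * L.R k m * L.R k l := by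
          rw [← flip_two_right' hlm hkl.symm hkm.symm, ← flip_two hkl hkm hlm]
          simp only [mul_assoc]
      _ = (L.flip k l * L.flip l m * L.flip k l) * (L.R l m * L.R k m * L.R k l) := by
          rw [← flip_two_right hkl hkm hlm]
          simp only [mul_assoc]
      _ = _ := by rw [hp1]
  have e2 : L.flip l m * L.R l m * (L.flip k l * L.R k l) * (L.flip l m * L.R l m) =
      L.flip k m * (L.R k l * L.R k m * L.R l m) := by
    calc _ = L.flip l m * (L.R l m * L.flip k l) * (L.R k l * L.flip l m) * L.R l m := by
          simp only [mul_assoc]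
      _ = L.flip l m * L.flip k l * (L.R k m * L.flip l m) * L.R k m * L.R l m := by
          rw [← flip_two_right' hlm hkl.symm hkm.symm, ← flip_two hkl hkm hlm]
          simp only [mul_assoc]
      _ = (L.flip l m * L.flip k l * L.flip l m) * (L.R k l * L.R k m * L.R l m) := by
          rw [← flip_two' hlm hkl.symm hkm.symm]
          simp only [mul_assoc]
      _ = _ := by rw [hp2]
  rw [e1, e2] at h
  have := congrArg (fun x => L.flip k m * x) h
  simp only [← mul_assoc (L.flip k m) (L.flip k m), flip_mul_flip hkm, one_mul] at this
  exact this.symm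

end LegSystem

/-! ### Cap and cup in `End(V) ⊗ End(V)` -/

/-- The weight `q^{2j(1-2|j|)-(2n+1)}`. -/
def cw (j : Idx n) : K := q ^ (2 * j.1 * eps j - (2 * n + 1))

lemma cw_ne_zero (j : Idx n) : cw j ≠ 0 := zpow_ne_zero _ q_ne_zero

/-- The exponent is twice the absolute value of j, minus 2n + 1. This evenness of the weights makes
the weighted supertrace vanish on 1 and makes `D` commute with Φ. -/
lemma cw_neg (j : Idx n) : cw (-j) = cw j := by
  unfold cw eps
  rw [idx_val_neg]
  have := idx_ne_zero j
  congr 2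
  split_ifs <;> omega

/-- The unweighted version of `∩∪`. -/
def Q0 (n : ℕ) : Mat2 n := ∑ i : Idx n, ∑ j : Idx n, sgn (par i * par j) • tens (E i j) (E i j)

/-- The diagonal matrix of the weights. -/
def D (n : ℕ) : Mat n := ∑ j : Idx n, cw j • E j j

/-- The operator `∩∪`. -/
def Q (n : ℕ) : Mat2 n :=
  ∑ i : Idx n, ∑ j : Idx n, (sgn (par i * par j) * cw j) • tens (E i j) (E i j)

lemma Q0_mem_evenPart : Q0 n ∈ evenPart n :=
  Submodule.sum_mem _ fun _ _ => Submodule.sum_mem _ fun _ _ =>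
    Submodule.smul_mem _ _ (tens_mem_evenPart _ _ _ _ rfl)

lemma Q_mem_evenPart : Q n ∈ evenPart n :=
  Submodule.sum_mem _ fun _ _ => Submodule.sum_mem _ fun _ _ =>
    Submodule.smul_mem _ _ (tens_mem_evenPart _ _ _ _ rfl)

lemma E_mul_D (a b : Idx n) : E a b * D n = cw b • E a b := by
  unfold D
  rw [Finset.mul_sum, Finset.sum_eq_single b]
  · rw [mul_smul_comm, E_mul_E_same]
  · intro j _ hj
    rw [mul_smul_comm, E_mul_E_ne _ _ _ _ hj.symm, smul_zero]
  · simp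

lemma D_mul_E (a b : Idx n) : D n * E a b = cw a • E a b := by
  unfold D
  rw [Finset.sum_mul, Finset.sum_eq_single a]
  · rw [smul_mul_assoc, E_mul_E_same]
  · intro j _ hj
    rw [smul_mul_assoc, E_mul_E_ne _ _ _ _ hj, smul_zero]
  · simp

lemma tens_mul_tens_D (X : Mat n) (c d : Idx n) :
    tens X (E c d) * tens (D n) 1 = tens (X * D n) (E c d) := by
  unfold D
  simp only [tens_sum_left, tens_smul_left, Finset.mul_sum, mul_smul_comm, tens_mul_tens,
    CharTwo.add_self_eq_zero, mul_zero, sgn_zero, one_smul, mul_one]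

lemma tens_one_D_mul (Y : Mat n) (a b : Idx n) :
    tens 1 (D n) * tens (E a b) Y = tens (E a b) (D n * Y) := by
  unfold D
  simp only [tens_sum_right, tens_smul_right, Finset.sum_mul, smul_mul_assoc, tens_mul_tens,
    CharTwo.add_self_eq_zero, zero_mul, sgn_zero, one_smul, one_mul]

/-- The weights sit on the cup side, that is, on the right. Operators slide along the cap without
meeting them; along the cup they have to be moved past `D` first. -/
lemma Q_eq : Q n = Q0 n * tens (D n) 1 := by
  unfold Q Q0
  simp only [Finset.sum_mul, smul_mul_assoc, tens_mul_tens_D, E_mul_D, tens_smul_left, smul_smul]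

lemma tens_E_mul_Q0 (a b : Idx n) : tens (E a b) 1 * Q0 n =
    ∑ j, sgn (par b * par j) • tens (E a j) (E b j) := by
  unfold Q0
  rw [Finset.mul_sum, Finset.sum_eq_single b]
  · simp only [Finset.mul_sum, mul_smul_comm, tens_one_mul_tens, E_mul_E_same]
  · intro i _ hi
    simp only [Finset.mul_sum, mul_smul_comm, tens_one_mul_tens, E_mul_E_ne _ _ _ _ hi.symm,
      tens_zero_left, smul_zero, Finset.sum_const_zero]
  · simp

lemma one_tens_E_mul_Q0 (a b : Idx n) : tens 1 (E b a) * Q0 n =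
    ∑ j, sgn (par a * par j + (par b + par a) * (par a + par j)) • tens (E a j) (E b j) := by
  unfold Q0
  rw [Finset.mul_sum, Finset.sum_eq_single a]
  · simp only [Finset.mul_sum, mul_smul_comm, one_tens_mul_tens, E_mul_E_same, smul_smul, ← sgn_add]
  · intro i _ hi
    simp only [Finset.mul_sum, mul_smul_comm, one_tens_mul_tens, E_mul_E_ne _ _ _ _ hi.symm,
      tens_zero_right, smul_zero, Finset.sum_const_zero]
  · simp

lemma Q0_mul_tens_E (a b : Idx n) : Q0 n * tens (E a b) 1 =
    ∑ i, sgn (par i * par a + (par i + par a) * (par a + par b)) • tens (E i b) (E i a) := by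
  unfold Q0
  rw [Finset.sum_mul]
  refine Finset.sum_congr rfl fun i _ => ?_
  rw [Finset.sum_mul, Finset.sum_eq_single a]
  · rw [smul_mul_assoc, tens_mul_tens, E_mul_E_same, mul_one, smul_smul, ← sgn_add]
  · intro j _ hj
    rw [smul_mul_assoc, tens_mul_tens, E_mul_E_ne _ _ _ _ hj, tens_zero_left, smul_zero, smul_zero]
  · simp

lemma Q0_mul_one_tens_E (a b : Idx n) : Q0 n * tens 1 (E b a) =
    ∑ i, sgn (par i * par b) • tens (E i b) (E i a) := by
  unfold Q0
  rw [Finset.sum_mul]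
  refine Finset.sum_congr rfl fun i _ => ?_
  rw [Finset.sum_mul, Finset.sum_eq_single b]
  · rw [smul_mul_assoc, tens_mul_one_tens, E_mul_E_same]
  · intro j _ hj
    rw [smul_mul_assoc, tens_mul_one_tens, E_mul_E_ne _ _ _ _ hj, tens_zero_right, smul_zero]
  · simp

/-- The left half of `Q0` is ∑ v_i ⊗ w_i, where an operator on V can be traded for its
supertranspose on V*. -/
lemma tens_mul_Q0 (X : Mat n) : tens X 1 * Q0 n = tens 1 (st X) * Q0 n := by
  have : (LinearMap.mulRight K (Q0 n)) ∘ₗ tensB.flip 1 =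
      (LinearMap.mulRight K (Q0 n)) ∘ₗ tensB 1 ∘ₗ st := by
    refine mat_hom_ext fun a b => ?_
    simp only [LinearMap.comp_apply, LinearMap.mulRight_apply, LinearMap.flip_apply, tensB_apply,
      st_E, tens_smul_right, smul_mul_assoc, tens_E_mul_Q0, one_tens_E_mul_Q0, Finset.smul_sum,
      smul_smul, ← sgn_add]
    refine Finset.sum_congr rfl fun j _ => ?_
    congr 2
    generalize par a = a, par b = b, par j = j
    revert a b j; decide
  exact LinearMap.congr_fun this X

/-- The mirror statement for the cup. It is stated for the unweighted element because a general `X`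
does not commute with `D`. -/
lemma Q0_mul_tens (X : Mat n) : Q0 n * tens X 1 = Q0 n * tens 1 (st X) := by
  have : (LinearMap.mulLeft K (Q0 n)) ∘ₗ tensB.flip 1 =
      (LinearMap.mulLeft K (Q0 n)) ∘ₗ tensB 1 ∘ₗ st := by
    refine mat_hom_ext fun a b => ?_
    simp only [LinearMap.comp_apply, LinearMap.mulLeft_apply, LinearMap.flip_apply, tensB_apply,
      st_E, tens_smul_right, mul_smul_comm, Q0_mul_tens_E, Q0_mul_one_tens_E, Finset.smul_sum,
      smul_smul, ← sgn_add]
    refine Finset.sum_congr rfl fun i _ => ?_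
    congr 2
    generalize par a = a, par b = b, par i = i
    revert a b i; decide
  exact LinearMap.congr_fun this X

/-- PS takes v_a ⊗ v_b to a combination of v_b ⊗ v_a, v_a ⊗ v_b and v_{-a} ⊗ v_{-b}, all of which
have the same product of weights. -/
lemma tens_D_D_mul_PS : tens (D n) (D n) * (P n * S n) = P n * S n * tens (D n) (D n) := by
  refine mat2_ext_tens fun o ho a b => ?_
  have hD : ∀ a b : Idx n, tens (D n) (D n) * tens (E a o) (E b o) =
      (cw a * cw b) • tens (E a o) (E b o) := by
    intro a b
    have : tens (D n) (D n) = tens (D n) 1 * tens 1 (D n) := by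
      rw [tens_one_mul_tens, mul_one]
    rw [this, mul_assoc, tens_one_D_mul, tens_one_mul_tens, D_mul_E, D_mul_E, tens_smul_left,
      tens_smul_right, smul_smul]
  rw [mul_assoc, mul_assoc (P n * S n), hD, mul_smul_comm, PS_mul_tens o ho, mul_add, mul_add,
    mul_smul_comm, mul_smul_comm, mul_smul_comm, hD, hD, hD, cw_neg, cw_neg, smul_add, smul_add,
    smul_comm (cg a b), smul_comm (ch a b), smul_comm (ck a b), mul_comm (cw b)]

/-- The weighted supertrace. -/
def trq : Mat n →ₗ[K] K where
  toFun X := ∑ a, sgn (par a) * cw a * X a a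
  map_add' X Y := by simp [mul_add, Finset.sum_add_distrib]
  map_smul' c X := by simp [Finset.mul_sum, mul_left_comm]

lemma trq_apply (X : Mat n) : trq X = ∑ a, sgn (par a) * cw a * X a a := rfl

lemma trq_E (a b : Idx n) : trq (E a b) = if a = b then sgn (par a) * cw a else 0 := by
  rw [trq_apply, Finset.sum_eq_single a]
  · rw [E_apply]; by_cases h : a = b <;> simp [h, eq_comm]
  · intro c _ hc
    rw [E_apply, if_neg (by simp [hc.symm]), mul_zero]
  · simp

/-- As `Q` is cup followed by cap, the middle part cup ∘ (X ⊗ 1) ∘ cap is a scalar, and it is the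
weighted supertrace. -/
lemma Q_mul_tens_mul_Q (X : Mat n) : Q n * tens X 1 * Q n = trq X • Q n := by
  have : (LinearMap.mulRight K (Q n)) ∘ₗ (LinearMap.mulLeft K (Q n)) ∘ₗ tensB.flip 1 =
      (LinearMap.toSpanSingleton K _ (Q n)) ∘ₗ trq := by
    refine mat_hom_ext fun a b => ?_
    simp only [LinearMap.comp_apply, LinearMap.mulRight_apply, LinearMap.mulLeft_apply,
      LinearMap.flip_apply, tensB_apply, LinearMap.toSpanSingleton_apply, trq_E]
    rw [Q_eq, mul_assoc (Q0 n) (tens (D n) 1), tens_one_mul_tens, D_mul_E, tens_smul_left,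
      mul_smul_comm, Q0_mul_tens_E, ← Q_eq, smul_mul_assoc, Finset.sum_mul]
    have h : ∀ i : Idx n, tens (E i b) (E i a) * Q n = if a = b then
        ∑ j, (sgn ((par i + par a) * (par a + par j) + par a * par j) * cw j) •
          tens (E i j) (E i j) else 0 := by
      intro i
      unfold Q
      split_ifs with hab
      · subst hab
        rw [Finset.mul_sum, Finset.sum_eq_single a]
        · rw [Finset.mul_sum]
          refine Finset.sum_congr rfl fun j _ => ?_
          rw [mul_smul_comm, tens_E_mul, if_pos ⟨rfl, rfl⟩, smul_smul, mul_right_comm, ← sgn_add,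
            add_comm]
        · intro c _ hc
          rw [Finset.mul_sum]
          refine Finset.sum_eq_zero fun j _ => ?_
          rw [mul_smul_comm, tens_E_mul, if_neg (by simp [hc.symm]), smul_zero]
        · simp
      · rw [Finset.mul_sum]
        refine Finset.sum_eq_zero fun c _ => ?_
        rw [Finset.mul_sum]
        refine Finset.sum_eq_zero fun j _ => ?_
        rw [mul_smul_comm, tens_E_mul, if_neg, smul_zero]
        rintro ⟨h1, h2⟩
        exact hab (h2.trans h1.symm)
    simp only [smul_mul_assoc, h]
    split_ifs with hab
    · subst hab
      unfold Q
      simp only [Finset.smul_sum, smul_smul]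
      refine Finset.sum_congr rfl fun i _ => Finset.sum_congr rfl fun j _ => ?_
      congr 1
      have : sgn (par i * par a + (par i + par a) * (par a + par a)) *
          sgn ((par i + par a) * (par a + par j) + par a * par j) =
          sgn (par a) * sgn (par i * par j) := by
        rw [← sgn_add, ← sgn_add]
        congr 1
        generalize par a = a, par i = i, par j = j
        revert a i j; decide
      linear_combination cw a * cw j * this
    · simp
  exact LinearMap.congr_fun this X

/-- The partial weighted supertrace over the second factor. -/
def ptr : Mat2 n →ₗ[K] Mat n := ∑ a : Idx n, (sgn (par a) * cw a) • entry a a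

lemma ptr_tens (X Y : Mat n) : ptr (tens X Y) = trq Y • X := by
  simp only [ptr, LinearMap.sum_apply, LinearMap.smul_apply, entry_tens, smul_smul, trq_apply,
    Finset.sum_smul]

/-- No sign arises, since only diagonal and hence even matrix units in the second factor contribute
to the trace. -/
lemma ptr_mul_tens (Z : Mat2 n) (X : Mat n) : ptr (Z * tens X 1) = ptr Z * X := by
  have key : (((LinearMap.mul K (Mat2 n)).compr₂ ptr).compl₂ (tensB.flip 1)) =
      (LinearMap.mul K (Mat n)) ∘ₗ ptr := by
    refine mat2_hom_ext fun a b c d => mat_hom_ext fun a' b' => ?_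
    simp only [LinearMap.compl₂_apply, LinearMap.compr₂_apply, LinearMap.mul_apply',
      LinearMap.flip_apply, tensB_apply, LinearMap.comp_apply, tens_mul_tens, map_smul, ptr_tens,
      mul_one, trq_E]
    split_ifs with h
    · subst h
      simp [CharTwo.add_self_eq_zero]
    · simp
  exact LinearMap.congr_fun₂ key Z X

lemma ptr_tens_mul (Z : Mat2 n) (X : Mat n) : ptr (tens X 1 * Z) = X * ptr Z := by
  have key : ptr ∘ₗ (LinearMap.mulLeft K (tens X 1)) = (LinearMap.mulLeft K X) ∘ₗ ptr := by
    refine mat2_hom_ext_tens fun A B => ?_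
    simp only [LinearMap.comp_apply, LinearMap.mulLeft_apply, tens_one_mul_tens, ptr_tens,
      mul_smul_comm]
  exact LinearMap.congr_fun key Z

/-- The supertranspose in the first factor. -/
def st1 : Mat2 n →ₗ[K] Mat2 n :=
  (GradedTensorProduct.of K (matPart n) (matPart n)).toLinearMap ∘ₗ
    TensorProduct.map st LinearMap.id ∘ₗ
      (GradedTensorProduct.of K (matPart n) (matPart n)).symm.toLinearMap

lemma st1_tens (X Y : Mat n) : st1 (tens X Y) = tens (st X) Y := rfl

lemma entry_st1 (i j : Idx n) (Z : Mat2 n) : entry i j (st1 Z) = st (entry i j Z) := by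
  have : entry i j ∘ₗ st1 (n := n) = st ∘ₗ entry i j := by
    refine mat2_hom_ext_tens fun X Y => ?_
    simp only [LinearMap.comp_apply, st1_tens, entry_tens, map_smul]
  exact LinearMap.congr_fun this Z

lemma st1_mem_evenPart {Z : Mat2 n} (hZ : Z ∈ evenPart n) : st1 Z ∈ evenPart n := by
  induction hZ using Submodule.span_induction with
  | zero => simp
  | add x y _ _ hx hy => rw [map_add]; exact add_mem hx hy
  | smul c x _ hx => rw [map_smul]; exact Submodule.smul_mem _ _ hx
  | mem x hx =>
    obtain ⟨a, b, c, d, h, rfl⟩ := hx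
    rw [st1_tens, st_E, tens_smul_left]
    exact Submodule.smul_mem _ _ (tens_mem_evenPart _ _ _ _ (by rw [add_comm, h]))

lemma st2_mem_evenPart {Z : Mat2 n} (hZ : Z ∈ evenPart n) : st2 Z ∈ evenPart n := by
  induction hZ using Submodule.span_induction with
  | zero => simp
  | add x y _ _ hx hy => rw [map_add]; exact add_mem hx hy
  | smul c x _ hx => rw [map_smul]; exact Submodule.smul_mem _ _ hx
  | mem x hx =>
    obtain ⟨a, b, c, d, h, rfl⟩ := hx
    rw [st2_tens_E]
    exact Submodule.smul_mem _ _ (tens_mem_evenPart _ _ _ _ (by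
      rw [add_comm, h, add_comm (par c)]))

lemma Phi_mul_D : Phi n * D n = D n * Phi n := by
  unfold Phi
  simp only [Finset.mul_sum, Finset.sum_mul, smul_mul_assoc, mul_smul_comm, E_mul_D, D_mul_E,
    cw_neg]

/-- The substitution i ↦ −i preserves the weights and reverses the signs, so the sum is its own
negative. -/
lemma trq_one : trq (1 : Mat n) = 0 := by
  rw [trq_apply]
  simp only [Matrix.one_apply_eq, mul_one]
  have h : ∑ a : Idx n, sgn (par a) * cw a = -∑ a : Idx n, sgn (par a) * cw a := by
    rw [← Finset.sum_neg_distrib]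
    refine Fintype.sum_equiv ⟨fun i => -i, fun i => -i, idx_neg_neg, idx_neg_neg⟩ _ _ fun i => ?_
    simp only [Equiv.coe_fn_mk, par_neg, cw_neg, sgn_add, sgn_one]
    ring
  exact self_eq_neg.1 h

lemma trq_Phi : trq (Phi n) = 0 := by
  unfold Phi
  rw [map_sum]
  refine Finset.sum_eq_zero fun a _ => ?_
  rw [map_smul, trq_E, if_neg, smul_zero]
  intro h
  have h2 := congrArg Subtype.val h
  rw [idx_val_neg] at h2
  have := idx_ne_zero a
  omega

/-! ### Partial traces of `PS` -/

/-- The signed weight. -/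
def wt (a : Idx n) : K := sgn (par a) * cw a

/-- A primitive of the function `ξ wt`. -/
def wtPrim (n : ℕ) (m : ℤ) : K := if 0 ≤ m then q ^ (2 * m - 2 * n) else q ^ (-2 * m - 2 * n - 2)

lemma xi_mul_wt (a : Idx n) : xi * wt a = wtPrim n a.1 - wtPrim n (a.1 - 1) := by
  have hq := q_ne_zero
  unfold wt wtPrim cw par eps xi
  rcases idx_sign a with h | h
  · rw [if_pos h, if_pos h, if_neg (by omega), if_neg (by omega), sgn_one,
      show 2 * a.1 * -1 - (2 * (n : ℤ) + 1) = (-2 * a.1 - 2 * n - 2) + 1 by ring,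
      show -2 * (a.1 - 1) - 2 * (n : ℤ) - 2 = (-2 * a.1 - 2 * n - 2) + 1 + 1 by ring,
      zpow_add_one₀ hq (_ + 1), zpow_add_one₀ hq]
    field_simp
    ring
  · rw [if_neg (by omega), if_neg (by omega), if_pos (by omega), if_pos (by omega), sgn_zero,
      show 2 * (a.1 : ℤ) - 2 * n = (2 * (a.1 - 1) - 2 * n) + 1 + 1 by ring,
      show 2 * a.1 * 1 - (2 * (n : ℤ) + 1) = (2 * (a.1 - 1) - 2 * n) + 1 by ring,
      zpow_add_one₀ hq (_ + 1), zpow_add_one₀ hq]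
    field_simp

lemma idx_ne_neg (a : Idx n) : a ≠ -a := by
  intro h
  have h2 := congrArg Subtype.val h
  rw [idx_val_neg] at h2
  have := idx_ne_zero a
  omega

lemma cg_self (a : Idx n) : cg a a = sgn (par a) * q ^ eps a := by
  rw [cg, expo, if_pos rfl, if_neg (idx_ne_neg a), add_zero, one_mul]
  congr 2
  generalize par a = a
  revert a; decide

lemma wt_mul_cg (a : Idx n) : wt a * cg a a = wtPrim n a.1 := by
  have hq := q_ne_zero
  rw [cg_self, wt, mul_mul_mul_comm, mul_comm (cw a)]
  rw [mul_comm (q ^ _) (cw a), ← mul_assoc, sgn_mul_self, one_mul, cw, ← zpow_add₀ hq]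
  unfold wtPrim eps
  rcases idx_sign a with h | h
  · rw [if_pos h, if_neg (by omega)]; congr 1; ring
  · rw [if_neg (by omega), if_pos (by omega)]; congr 1; ring

lemma sum_Ioc_sub (G : ℤ → K) (N : ℤ) (k : ℕ) :
    ∑ m ∈ Finset.Ioc (N - k) N, (G m - G (m - 1)) = G N - G (N - k) := by
  induction k with
  | zero => simp
  | succ k ih =>
    have : Finset.Ioc (N - (k + 1 : ℕ)) N = insert (N - k) (Finset.Ioc (N - k) N) := by
      ext m
      simp only [Finset.mem_Ioc, Finset.mem_insert]
      push_cast
      omega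
    rw [this, Finset.sum_insert (by simp), ih, show N - (k + 1 : ℕ) = N - k - 1 by push_cast; ring]
    ring

/-- The sum telescopes over a < y ≤ n; `wtPrim` is 1 at n and `wt a * cg a a` at a. -/
lemma sum_ch_mul_wt (a : Idx n) : ∑ y, ch a y * wt y = 1 - wt a * cg a a := by
  have ha := a.2
  simp only [Finset.mem_erase, Finset.mem_Icc] at ha
  have h1 : ∑ y : Idx n, ch a y * wt y =
      ∑ y : Idx n, (fun m : ℤ => if a.1 < m then wtPrim n m - wtPrim n (m - 1) else 0) y.1 := by
    refine Finset.sum_congr rfl fun y _ => ?_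
    simp only [ch, idx_lt_iff]
    split_ifs
    · exact xi_mul_wt y
    · simp
  rw [h1, wt_mul_cg]
  refine (Finset.sum_coe_sort ((Finset.Icc (-(n : ℤ)) (n : ℤ)).erase 0)
    (fun m : ℤ => if a.1 < m then wtPrim n m - wtPrim n (m - 1) else 0)).trans ?_
  rw [← Finset.sum_filter]
  have h2 : ∑ m ∈ Finset.Ioc a.1 n, (wtPrim n m - wtPrim n (m - 1)) = 1 - wtPrim n a.1 := by
    have := sum_Ioc_sub (wtPrim n) n (n - a.1).toNat
    rw [show (n : ℤ) - ((n - a.1).toNat : ℤ) = a.1 by omega] at this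
    rw [this]
    congr 1
    rw [wtPrim, if_pos (by omega), sub_self, zpow_zero]
  rw [← h2]
  refine Finset.sum_subset ?_ ?_
  · intro m
    simp only [Finset.mem_filter, Finset.mem_erase, Finset.mem_Icc, Finset.mem_Ioc]
    omega
  · intro m hm hm'
    simp only [Finset.mem_filter, Finset.mem_erase, Finset.mem_Icc, Finset.mem_Ioc] at hm hm'
    -- The integer 0 is not an index, but its term vanishes: `wtPrim` takes the same value q^(−2n)
    -- at 0 and at −1.
    have : m = 0 := by omega
    subst this
    simp [wtPrim]

lemma cg_self_sq (a : Idx n) : cg a a * cg a a = 1 + xi * cg a a := by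
  have hq := q_ne_zero
  rw [cg_self, xi]
  rcases idx_sign a with h | h
  · rw [par, eps, if_pos h, if_pos h, sgn_one, zpow_neg, zpow_one]
    field_simp
    ring
  · rw [par, eps, if_neg (by omega), if_neg (by omega), sgn_zero, zpow_one]
    field_simp
    ring

lemma entry_mul_E (Z : Mat2 n) (x y o : Idx n) :
    entry y y Z * E x o = entry y o (Z * tens (E x o) (E y o)) := by
  have : (LinearMap.mulRight K (E x o)) ∘ₗ entry y y =
      entry y o ∘ₗ (LinearMap.mulRight K (tens (E x o) (E y o))) := by
    refine mat2_hom_ext fun a b c d => ?_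
    simp only [LinearMap.comp_apply, LinearMap.mulRight_apply, entry_tens_E, tens_mul_tens,
      map_smul]
    by_cases hd : d = y
    · subst hd
      rw [E_mul_E_same, entry_tens, E_apply]
      by_cases hc : c = d
      · subst hc; simp [CharTwo.add_self_eq_zero]
      · simp [hc]
    · rw [E_mul_E_ne _ _ _ _ hd, tens_zero_right]; simp [hd]
  exact LinearMap.congr_fun this Z

/-- This reduces a partial trace to the action on vectors: on v_x it collects the coefficients that
keep v_y in the second factor. -/
lemma ptr_mul_E (Z : Mat2 n) (x o : Idx n) :
    ptr Z * E x o = ∑ y, wt y • entry y o (Z * tens (E x o) (E y o)) := by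
  simp only [ptr, LinearMap.sum_apply, LinearMap.smul_apply, Finset.sum_mul, smul_mul_assoc,
    entry_mul_E, wt]

lemma mat_ext_E {X Y : Mat n} (h : ∀ o : Idx n, par o = 0 → ∀ x, X * E x o = Y * E x o) :
    X = Y := by
  have key : ∀ x, X * E x x = Y * E x x := by
    intro x
    obtain ⟨o, ho⟩ := exists_even x
    rw [← E_mul_E_same x o x, ← mul_assoc, h o ho, mul_assoc]
  rw [← mul_one X, ← mul_one Y, one_eq_sum_E, Finset.mul_sum, Finset.mul_sum]
  exact Finset.sum_congr rfl fun x _ => key x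

lemma entry_vec (o y a b : Idx n) :
    entry y o (tens (E a o) (E b o)) = if b = y then E a o else 0 := by
  rw [entry_tens_E]
  simp

lemma neg_ne_self (a : Idx n) : -a ≠ a := (idx_ne_neg a).symm

/-- On v_x the trace consists of the swap term at y = x and the `ch` terms; `sum_ch_mul_wt` says
that they add up to 1. The `ck` terms would require −y = y. -/
lemma ptr_PS : ptr (P n * S n) = 1 := by
  refine mat_ext_E fun o ho x => ?_
  rw [ptr_mul_E]
  simp only [PS_mul_tens o ho, map_add, map_smul, entry_vec, if_true, neg_ne_self, if_false,
    smul_zero, add_zero, smul_add, Finset.sum_add_distrib, smul_ite, Finset.sum_ite_eq,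
    Finset.mem_univ, smul_smul, ← Finset.sum_smul, one_mul]
  rw [← add_smul]
  convert one_smul K _
  have := sum_ch_mul_wt x
  simp only [mul_comm (wt _)] at *
  rw [this]
  ring

lemma sum_wt_ch_ch {a b : Idx n} (h : a ≤ b) :
    ∑ y, wt y * (ch b y * ch a y) = xi * (1 - wt b * cg b b) := by
  rw [← sum_ch_mul_wt, Finset.mul_sum]
  refine Finset.sum_congr rfl fun y _ => ?_
  rw [ch, ch]
  by_cases hy : b < y
  · rw [if_pos hy, if_pos (lt_of_le_of_lt h hy)]; ring
  · rw [if_neg hy]; ring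

/-- The product lives on b < y < a, where the opposite signs of y and −y give −ξ². The indicator of
this interval is that of b < y minus those of a < y and y = a, which brings the weighted sum back to
`sum_ch_mul_wt`. -/
lemma ck_mul_ck (a b y : Idx n) (h : b < a) : ck (-b) y * ck a (-y) =
    -xi * (ch b y - ch a y - if y = a then xi else 0) := by
  have hs : sgn (par y) * sgn (par (-y)) = -1 := by
    rw [par_neg, ← sgn_add, ← add_assoc, CharTwo.add_self_eq_zero, zero_add, sgn_one]
  rw [ck, ck, ch, ch, idx_neg_neg]
  have e : -a < -y ↔ y < a := by simp only [idx_lt_iff, idx_val_neg]; omega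
  simp only [e]
  rcases lt_trichotomy y a with hy | rfl | hy
  · rw [if_pos hy, if_neg (not_lt.2 hy.le), if_neg hy.ne]
    split_ifs
    · linear_combination xi * xi * hs
    · ring
  · simp [h]
  · rw [if_neg (not_lt.2 hy.le), if_pos hy, if_neg hy.ne']
    simp only [if_pos (h.trans hy)]
    ring

lemma sum_wt_ck_ck {a b : Idx n} (h : b < a) :
    ∑ y, wt y * (ck (-b) y * ck a (-y)) =
      -xi * ((1 - wt b * cg b b) - (1 - wt a * cg a a) - xi * wt a) := by
  rw [← sum_ch_mul_wt, ← sum_ch_mul_wt]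
  have : xi * wt a = ∑ y, if y = a then xi * wt y else 0 := by simp
  rw [this, ← Finset.sum_sub_distrib, ← Finset.sum_sub_distrib, Finset.mul_sum]
  refine Finset.sum_congr rfl fun y _ => ?_
  rw [ck_mul_ck a b y h]
  split_ifs <;> ring

lemma cg_mul_cg_of_ne {x b : Idx n} (h1 : x ≠ b) (h2 : x ≠ -b) : cg x b * cg b x = 1 := by
  have h3 : b ≠ -x := fun h => h2 (by rw [h, idx_neg_neg])
  rw [cg, cg, expo, expo, if_neg h1, if_neg h2, if_neg h1.symm, if_neg h3]
  simp [mul_comm (par b)]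

lemma cg_neg_self (b : Idx n) : cg (-b) b = sgn (par b) * cg b b := cg_neg_left b b

lemma cg_self_neg (b : Idx n) : cg b (-b) = sgn (par b) * (cg b b - xi) := by
  have hq := q_ne_zero
  rw [cg_self, cg, expo, if_neg (idx_ne_neg b), if_pos (idx_neg_neg b).symm, par_neg, zero_add,
    one_mul, xi]
  have h0 : sgn (par b * (par b + 1)) = 1 := by
    rw [← sgn_zero]
    congr 1
    generalize par b = b
    revert b; decide
  rw [h0, one_mul]
  unfold par eps
  rw [idx_val_neg]
  rcases idx_sign b with h | h
  · simp only [if_pos h, if_neg (show ¬ -b.1 < 0 by omega), sgn_one, zpow_neg, zpow_one]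
    ring
  · simp only [if_pos (show -b.1 < 0 by omega), if_neg (show ¬ b.1 < 0 by omega), sgn_zero,
      zpow_neg, zpow_one]
    ring

lemma ck_neg_self (b : Idx n) : ck (-b) b = 0 := by
  rw [ck, idx_neg_neg, if_neg (lt_irrefl b)]

lemma ck_self_neg (b : Idx n) : ck b (-b) = 0 := by
  rw [ck, if_neg (lt_irrefl (-b))]

lemma tens_E_one_mul_vec (a b o x y : Idx n) : tens (E a b) 1 * tens (E x o) (E y o) =
    if x = b then tens (E a o) (E y o) else 0 := by
  rw [tens_one_mul_tens, E_mul_E]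
  split_ifs with h1 h2 h2
  · rfl
  · exact absurd h1.symm h2
  · exact absurd h2.symm h1
  · rw [tens_zero_left]

/-- The scalar identity behind `ptr_PS_tens_PS` on the diagonal. -/
lemma ptr_identity_same (a b : Idx n) :
    (if a = b then wt b * (cg b b * cg b b) else 0) + wt b * (cg b b * ch a b) +
      wt a * (ch b a * cg a a) + ∑ y, wt y * (ch b y * ch a y) =
    (if a = b then wt b else 0) + xi := by
  rcases lt_trichotomy a b with h | rfl | h
  · rw [if_neg h.ne, if_neg h.ne, sum_wt_ch_ch h.le, ch, ch, if_pos h, if_neg (not_lt.2 h.le)]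
    ring
  · rw [if_pos rfl, if_pos rfl, sum_wt_ch_ch le_rfl, ch, if_neg (lt_irrefl a), cg_self_sq]
    ring
  · have : ∑ y, wt y * (ch b y * ch a y) = ∑ y, wt y * (ch a y * ch b y) :=
      Finset.sum_congr rfl fun y _ => by rw [mul_comm (ch b y)]
    rw [if_neg h.ne', if_neg h.ne', this, sum_wt_ch_ch h.le, ch, ch, if_pos h,
      if_neg (not_lt.2 h.le)]
    ring

/-- The scalar identity behind `ptr_PS_tens_PS` on the antidiagonal. -/
lemma ptr_identity_neg (a b : Idx n) :
    (if a = b then wt b * (cg (-b) b * cg b (-b)) else 0) + wt b * (cg (-b) b * ck a (-b)) +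
      wt a * (ck (-b) a * cg a (-a)) + ∑ y, wt y * (ck (-b) y * ck a (-y)) =
    if a = b then wt b else 0 := by
  have hs : ∀ b : Idx n, sgn (par b) * sgn (par b) = 1 := fun b => sgn_mul_self _
  have hz : a ≤ b → ∑ y, wt y * (ck (-b) y * ck a (-y)) = 0 := by
    intro h
    refine Finset.sum_eq_zero fun y _ => ?_
    rw [ck, ck, idx_neg_neg]
    by_cases hy : b < y
    · rw [if_neg (c := -a < -y)]
      · simp
      · simp only [idx_lt_iff, idx_val_neg] at *
        have : a.1 ≤ b.1 := h
        omega
    · rw [if_neg hy]; simp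
  rcases lt_trichotomy a b with h | rfl | h
  · have h' : ¬ -a < -b := by
      simp only [idx_lt_iff, idx_val_neg] at *; omega
    rw [if_neg h.ne, if_neg h.ne, hz h.le, ck, ck, idx_neg_neg, if_neg h', if_neg (not_lt.2 h.le)]
    ring
  · rw [if_pos rfl, if_pos rfl, hz le_rfl, ck_self_neg, ck_neg_self, cg_neg_self, cg_self_neg]
    linear_combination wt a * cg a a * (cg a a - xi) * hs a + wt a * cg_self_sq a
  · have h' : -a < -b := by
      simp only [idx_lt_iff, idx_val_neg] at *; omega
    rw [if_neg h.ne', if_neg h.ne', sum_wt_ck_ck h, ck, ck, idx_neg_neg, if_pos h', if_pos h,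
      cg_neg_self, cg_self_neg, par_neg, sgn_add, sgn_one]
    linear_combination -wt b * cg b b * xi * hs b + wt a * (cg a a - xi) * xi * hs a

/-- For X = E_{ab} and the vector v_x, the cases x = b and x = −b are the two scalar identities
`ptr_identity_same` and `ptr_identity_neg`. For all other x only the twofold swap survives, with
coefficient 1, and it gives the scalar `trq X`. -/
lemma ptr_PS_tens_PS (X : Mat n) :
    ptr (P n * S n * tens X 1 * (P n * S n)) = trq X • (1 : Mat n) + xi • X := by
  have key : ptr ∘ₗ (LinearMap.mulRight K (P n * S n)) ∘ₗ (LinearMap.mulLeft K (P n * S n)) ∘ₗ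
      tensB.flip 1 = (LinearMap.toSpanSingleton K (Mat n) 1) ∘ₗ trq + xi • LinearMap.id := by
    refine mat_hom_ext fun a b => ?_
    simp only [LinearMap.comp_apply, LinearMap.mulRight_apply, LinearMap.mulLeft_apply,
      LinearMap.flip_apply, tensB_apply, LinearMap.add_apply, LinearMap.toSpanSingleton_apply,
      LinearMap.smul_apply, LinearMap.id_apply, trq_E]
    refine mat_ext_E fun o ho x => ?_
    rw [ptr_mul_E]
    -- The three summands come from the three terms of PS on v_x ⊗ v_y; E_{ab} ⊗ 1 kills each of
    -- them unless its first index is b, which means y = b, x = b or x = −b.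
    have hv : ∀ y : Idx n, wt y • entry y o (P n * S n * tens (E a b) 1 * (P n * S n) *
        tens (E x o) (E y o)) =
        (if y = b then wt b • (if a = b then (cg x b * cg b x) • E x o else 0) +
          wt b • (if x = b then (cg b b * ch a b) • E a o else 0) +
          wt b • (if x = -b then (cg (-b) b * ck a (-b)) • E (-a) o else 0) else 0) +
        (if x = b then
          (if y = a then (wt a * (ch b a * cg a a)) • E a o else 0) +
            (wt y * (ch b y * ch a y)) • E a o else 0) +
        (if x = -b then
          (if y = a then (wt a * (ck (-b) a * cg a (-a))) • E (-a) o else 0) +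
            (wt y * (ck (-b) y * ck a (-y))) • E (-a) o else 0) := by
      intro y
      rw [mul_assoc _ (P n * S n) (tens _ _), PS_mul_tens o ho, mul_add, mul_add, map_add, map_add,
        smul_add, smul_add]
      simp only [mul_smul_comm, mul_assoc (P n * S n) (tens (E a b) 1), tens_E_one_mul_vec]
      congr 1
      · congr 1
        · by_cases hy : y = b
          · subst hy
            rw [if_pos rfl, if_pos rfl, PS_mul_tens o ho]
            simp only [map_add, map_smul, entry_vec, smul_add, smul_ite, smul_zero, smul_smul]
            congr 1
            · congr 1
              · split_ifs with h1
                · subst h1; rfl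
                · rfl
              · split_ifs with h1
                · subst h1; rfl
                · rfl
            · simp only [idx_neg_eq_iff]
              split_ifs with h1
              · subst h1; rfl
              · rfl
          · rw [if_neg hy, if_neg hy]; simp
        · by_cases hx : x = b
          · subst hx
            rw [if_pos rfl, if_pos rfl, PS_mul_tens o ho]
            simp only [map_add, map_smul, entry_vec, smul_add, smul_ite, smul_zero, smul_smul,
              if_true, neg_ne_self, if_false, add_zero]
            congr 1
            by_cases hy : y = a
            · subst hy; simp
            · rw [if_neg hy, if_neg (Ne.symm hy)]
          · rw [if_neg hx, if_neg hx]; simp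
      · simp only [idx_neg_eq_iff]
        by_cases hx : x = -b
        · subst hx
          rw [if_pos rfl, if_pos rfl, PS_mul_tens o ho]
          simp only [map_add, map_smul, entry_vec, smul_add, smul_ite, smul_zero, smul_smul,
            if_true, neg_ne_self, if_false, add_zero, idx_neg_neg]
          congr 1
          by_cases hy : y = a
          · subst hy; simp
          · rw [if_neg hy, if_neg (Ne.symm hy)]
        · rw [if_neg hx, if_neg hx]; simp
    simp only [hv, Finset.sum_add_distrib, Finset.sum_ite_eq', Finset.mem_univ, if_true,
      Finset.sum_ite_irrel, Finset.sum_const_zero, ← Finset.sum_smul]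
    rw [add_mul, smul_mul_assoc, smul_mul_assoc, one_mul, E_mul_E]
    by_cases hx : x = b
    · subst hx
      simp only [if_true, idx_ne_neg, if_false, smul_zero, add_zero]
      have := congrArg (fun t : K => t • E a o) (ptr_identity_same a x)
      simp only [add_smul] at this
      by_cases hab : a = x
      · subst hab
        simp only [if_true, smul_smul, wt] at this ⊢
        rw [← this]; abel
      · simp only [hab, if_false, zero_smul, smul_zero, zero_add, smul_smul] at this ⊢
        rw [← this]; abel
    · by_cases hx' : x = -b
      · subst hx'
        simp only [if_true, neg_ne_self, idx_ne_neg, if_false, smul_zero, add_zero]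
        have := congrArg (fun t : K => t • E (-a) o) (ptr_identity_neg a b)
        simp only [add_smul] at this
        by_cases hab : a = b
        · subst hab
          simp only [if_true, smul_smul, wt] at this ⊢
          rw [← this]; abel
        · simp only [hab, if_false, zero_smul, smul_zero, zero_add, smul_smul] at this ⊢
          rw [← this]; abel
      · simp only [hx, hx', if_false, smul_zero, add_zero, if_neg (Ne.symm hx),
          cg_mul_cg_of_ne hx hx', one_smul, wt]
        split_ifs with hab
        · rw [hab]
        · simp
  exact LinearMap.congr_fun key X

/-- `PS - ξ`, the inverse of `PS`. -/
abbrev PSinv (n : ℕ) : Mat2 n := P n * S n - xi • 1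

/-- Since (PS)⁻¹ = PS − ξ, the term ξX of `ptr_PS_tens_PS` is cancelled by `ptr_PS`. -/
lemma ptr_conj (X : Mat n) : ptr (P n * S n * tens X 1 * PSinv n) = trq X • (1 : Mat n) := by
  rw [PSinv, mul_sub, map_sub, ptr_PS_tens_PS, mul_smul_comm, mul_one, map_smul, ptr_mul_tens,
    ptr_PS, one_mul, add_sub_cancel_right]

lemma ptr_conj' (X : Mat n) : ptr (PSinv n * tens X 1 * (P n * S n)) = trq X • (1 : Mat n) := by
  rw [PSinv, sub_mul, sub_mul, map_sub, ptr_PS_tens_PS, smul_mul_assoc, one_mul, smul_mul_assoc,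
    map_smul, ptr_tens_mul, ptr_PS, mul_one, add_sub_cancel_right]

namespace LegSystem
variable {ι A : Type} [Ring A] [Algebra K A] {L : LegSystem n ι A} {k l m a b : ι}

/-! ### Sliding operators along caps and cups -/

/-- `∩∪` in the legs `k`, `l`. -/
abbrev e (L : LegSystem n ι A) (k l : ι) : A := L.two k l (Q n)

/-- The unweighted `∩∪` in the legs `k`, `l`. -/
abbrev e0 (L : LegSystem n ι A) (k l : ι) : A := L.two k l (Q0 n)

/-- `PᵀSᵀ` in the legs `k`, `l`. -/
abbrev Ts (L : LegSystem n ι A) (k l : ι) : A := L.two k l (st2 (P n) * st2 (S n))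

/-- `Φᵀ` in the leg `k`. -/
abbrev Cs (L : LegSystem n ι A) (k : ι) : A := L.leg k (st (Phi n))

/-- The supertranspose in the first factor of `S⁻¹`, in the legs `k`, `a`. -/
abbrev Rs (L : LegSystem n ι A) (k a : ι) : A := L.two k a (st1 (Sinv n))

lemma Ts_mem_evenPart : st2 (P n) * st2 (S n) ∈ evenPart n :=
  mul_mem_evenPart (st2_mem_evenPart P_mem_evenPart) (st2_mem_evenPart S_mem_evenPart)

lemma Rs_mem_evenPart : st1 (Sinv n) ∈ evenPart n := st1_mem_evenPart Sinv_mem_evenPart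

lemma e_eq (h : k ≠ l) : L.e k l = L.e0 k l * L.leg k (D n) := by
  rw [e, Q_eq, two_mul h, two_tens, map_one, mul_one]

lemma leg_mul_e0 (h : k ≠ l) (X : Mat n) : L.leg k X * L.e0 k l = L.leg l (st X) * L.e0 k l := by
  have := congrArg (L.two k l) (tens_mul_Q0 X)
  rwa [two_mul h, two_mul h, two_tens, two_tens, map_one, map_one, mul_one, one_mul] at this

lemma e0_mul_leg (h : k ≠ l) (X : Mat n) : L.e0 k l * L.leg k X = L.e0 k l * L.leg l (st X) := by
  have := congrArg (L.two k l) (Q0_mul_tens X)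
  rwa [two_mul h, two_mul h, two_tens, two_tens, map_one, map_one, mul_one, one_mul] at this

lemma leg_mul_e (h : k ≠ l) (X : Mat n) : L.leg k X * L.e k l = L.leg l (st X) * L.e k l := by
  rw [e_eq h, ← mul_assoc, leg_mul_e0 h, mul_assoc]

lemma D_mul_leg (h : k ≠ l) (X : Mat n) :
    L.leg k (D n) * L.leg l X = L.leg l X * L.leg k (D n) := by
  have key : (LinearMap.mulLeft K (L.leg k (D n))) ∘ₗ (L.leg l).toLinearMap =
      (LinearMap.mulRight K (L.leg k (D n))) ∘ₗ (L.leg l).toLinearMap := by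
    refine mat_hom_ext fun c d => ?_
    simp only [LinearMap.comp_apply, LinearMap.mulLeft_apply, LinearMap.mulRight_apply,
      AlgHom.toLinearMap_apply, D, map_sum, map_smul, Finset.sum_mul, Finset.mul_sum]
    refine Finset.sum_congr rfl fun j _ => ?_
    rw [smul_mul_assoc, mul_smul_comm, L.comm k l h, CharTwo.add_self_eq_zero, zero_mul, sgn_zero,
      one_smul]
  exact LinearMap.congr_fun key X

lemma C_mul_e (h : k ≠ l) : L.C k * L.e k l = L.Cs l * L.e k l := leg_mul_e h _

/-- The weights do not obstruct sliding Φ along the cup, because Φ commutes with `D`. -/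
lemma e_mul_C (h : k ≠ l) : L.e k l * L.C k = L.e k l * L.Cs l := by
  rw [e_eq h, mul_assoc, mul_assoc, D_mul_leg h, C, ← map_mul, ← Phi_mul_D, map_mul, ← mul_assoc,
    e0_mul_leg h, mul_assoc]

/-- The component in leg `k` slides along the cap to `l`; the component in leg `a` is disjoint from
the even element `e` and can be moved out of the way and back. -/
lemma st1_mul_e (hkl : k ≠ l) (hka : k ≠ a) (hla : l ≠ a) (Z : Mat2 n) :
    L.two l a (st1 Z) * L.e k l = L.two k a Z * L.e k l := by
  have key : (LinearMap.mulRight K (L.e k l)) ∘ₗ L.two l a ∘ₗ st1 =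
      (LinearMap.mulRight K (L.e k l)) ∘ₗ L.two k a := by
    refine mat2_hom_ext_tens fun X Y => ?_
    simp only [LinearMap.comp_apply, LinearMap.mulRight_apply, st1_tens, two_tens]
    rw [mul_assoc, ← two_leg Q_mem_evenPart hka hla, ← mul_assoc, ← leg_mul_e hkl, mul_assoc,
      two_leg Q_mem_evenPart hka hla, mul_assoc]
  exact LinearMap.congr_fun key Z

lemma Rs_mul_e (hkl : k ≠ l) (hka : k ≠ a) (hla : l ≠ a) :
    L.Rs l a * L.e k l = L.Ri k a * L.e k l := st1_mul_e hkl hka hla _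

lemma R_mul_C (h : k ≠ a) : L.R k a * L.C k = L.C k * L.R k a := by
  have h1 : L.flip k a * (L.R k a * L.C k) = L.flip k a * (L.C k * L.R k a) := by
    rw [← mul_assoc, ← T_eq h, T_mul_C h, T_eq h, ← mul_assoc, ← mul_assoc, flip_leg h]
  have := congrArg (fun x => L.flip k a * x) h1
  simpa only [← mul_assoc (L.flip k a) (L.flip k a), flip_mul_flip h, one_mul] using this

lemma Ri_mul_C (h : k ≠ a) : L.Ri k a * L.C k = L.C k * L.Ri k a := by
  calc L.Ri k a * L.C k = L.Ri k a * (L.C k * L.R k a) * L.Ri k a := by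
        rw [mul_assoc, mul_assoc, R_mul_Ri h, mul_one]
    _ = _ := by rw [← R_mul_C h, ← mul_assoc, Ri_mul_R h, one_mul]

/-- `PS` intertwines the action on `V ⊗ V`. -/
lemma T_mul_R_R (hkl : k ≠ l) (hka : k ≠ a) (hla : l ≠ a) :
    L.T k l * (L.R k a * L.R l a) = L.R k a * L.R l a * L.T k l := by
  rw [T_eq hkl]
  calc L.flip k l * L.R k l * (L.R k a * L.R l a)
      = L.flip k l * (L.R k l * L.R k a * L.R l a) := by simp only [mul_assoc]
    _ = (L.flip k l * L.R l a) * L.R k a * L.R k l := by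
        rw [yang_baxter hkl hka hla]; simp only [mul_assoc]
    _ = L.R k a * (L.flip k l * L.R k a) * L.R k l := by
        rw [flip_two_right hkl hka hla]; simp only [mul_assoc]
    _ = _ := by rw [flip_two hkl hka hla]; simp only [mul_assoc]

lemma T_mul_Ri_Ri (hkl : k ≠ l) (hka : k ≠ a) (hla : l ≠ a) :
    L.T k l * (L.Ri l a * L.Ri k a) = L.Ri l a * L.Ri k a * L.T k l := by
  have h1 : L.R k a * L.R l a * (L.Ri l a * L.Ri k a) = 1 := by
    rw [mul_assoc, ← mul_assoc (L.R l a), R_mul_Ri hla, one_mul, R_mul_Ri hka]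
  have h2 : L.Ri l a * L.Ri k a * (L.R k a * L.R l a) = 1 := by
    rw [mul_assoc, ← mul_assoc (L.Ri k a), Ri_mul_R hka, one_mul, Ri_mul_R hla]
  calc L.T k l * (L.Ri l a * L.Ri k a)
      = L.Ri l a * L.Ri k a * (L.R k a * L.R l a * L.T k l) * (L.Ri l a * L.Ri k a) := by
        rw [← mul_assoc (L.Ri l a * L.Ri k a), h2, one_mul]
    _ = L.Ri l a * L.Ri k a * L.T k l * (L.R k a * L.R l a * (L.Ri l a * L.Ri k a)) := by
        rw [← T_mul_R_R hkl hka hla]; simp only [mul_assoc]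
    _ = _ := by rw [h1, mul_one]

/-! ### Cancelling a cap -/

/-- The diagonal entry (i, i) in the adjoined leg is z · E_{ii} up to a nonzero scalar, and the
E_{ii} sum to 1. This is the tool for proving relations in a dual leg `k`: cap it with a new V leg
and work there. -/
lemma cancel_cap (k : ι) {z z' : A}
    (h : incl n A z * L.ext.e none (some k) = incl n A z' * L.ext.e none (some k)) : z = z' := by
  have key : ∀ i : Idx n, ∀ z : A, (incl n A z * L.ext.e none (some k)) i i =
      (sgn (par i * par i) * cw i) • (z * L.leg k (E i i)) := by
    intro i z
    rw [incl_mul_apply]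
    have : L.ext.e none (some k) i i = (sgn (par i * par i) * cw i) • L.leg k (E i i) := by
      simp only [e, Q, map_sum, map_smul, two_tens, ext_leg_some, ext_leg_none, Matrix.sum_apply,
        Matrix.smul_apply, mul_incl_apply, newLeg_apply, E_apply]
      rw [Finset.sum_eq_single i, Finset.sum_eq_single i]
      · simp [CharTwo.add_self_eq_zero]
      · intro c _ hc; simp [hc]
      · simp
      · intro c _ hc; simp [hc]
      · simp
    rw [this, mul_smul_comm]
  have h2 : ∀ i : Idx n, z * L.leg k (E i i) = z' * L.leg k (E i i) := by
    intro i
    have := congrFun (congrFun h i) i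
    rw [key, key] at this
    exact smul_right_injective A (mul_ne_zero (sgn_ne_zero _) (cw_ne_zero i)) this
  rw [← mul_one z, ← mul_one z', ← map_one (L.leg k), one_eq_sum_E, map_sum, Finset.mul_sum,
    Finset.mul_sum]
  exact Finset.sum_congr rfl fun i _ => h2 i

lemma e_comm_e {k' l' : ι} (h1 : k ≠ k') (h2 : l ≠ k') (h3 : k ≠ l') (h4 : l ≠ l') :
    L.e k l * L.e k' l' = L.e k' l' * L.e k l := two_two Q_mem_evenPart h1 h2 h3 h4 _

lemma cancel_two_caps (k l : ι) {z z' : A}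
    (h : incl n _ (incl n A z) *
        (L.ext.ext.e none (some (some l)) * L.ext.ext.e (some none) (some (some k))) =
      incl n _ (incl n A z') *
        (L.ext.ext.e none (some (some l)) * L.ext.ext.e (some none) (some (some k)))) (hkl : k ≠ l) :
    z = z' := by
  rw [e_comm_e (by simp) (by simp) (by simp) (by simpa using hkl.symm),
    show L.ext.ext.e (some none) (some (some k)) = _ from ext_two_some _ _ _, ← mul_assoc,
    ← mul_assoc, ← map_mul, ← map_mul] at h
  exact cancel_cap k (cancel_cap (some l) h)

end LegSystem

lemma st_one : st (1 : Mat n) = 1 := by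
  ext i j
  change sgn ((par j + par i) * par j) * (1 : Mat n) j i = (1 : Mat n) i j
  rcases eq_or_ne i j with rfl | h
  · simp [CharTwo.add_self_eq_zero, sgn_zero]
  · rw [Matrix.one_apply_ne h, Matrix.one_apply_ne h.symm, mul_zero]

lemma Phi_mem : Phi n ∈ matPart n 1 := by
  refine Submodule.sum_mem _ fun i _ => Submodule.smul_mem _ _ ?_
  have h := E_mem i (-i)
  rwa [par_neg, show par i + (par i + 1) = 1 by generalize par i = a; revert a; decide] at h

namespace LegSystem
variable {ι A : Type} [Ring A] [Algebra K A] {L : LegSystem n ι A} {k l m a b : ι}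

/-! ### The transposed system in the opposite algebra -/

/-- The linear map `E_{ij} ↦ (E_{ij})ᵀ J^{|i|+|j|}` in the leg `k`. -/
def legT (L : LegSystem n ι A) (k : ι) : Mat n →ₗ[K] A :=
  ∑ p : ZMod 2, (LinearMap.mulRight K (L.Jp p)) ∘ₗ (L.leg k).toLinearMap ∘ₗ st ∘ₗ
    { toFun := fun X => (matProj p X : Mat n)
      map_add' := fun X Y => by
        ext i j
        simp only [matProj, Matrix.of_apply, Matrix.add_apply]
        split_ifs <;> simp
      map_smul' := fun c X => by
        ext i j
        simp [matProj] }

lemma legT_of_mem {p : ZMod 2} {X : Mat n} (hX : X ∈ matPart n p) :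
    L.legT k X = L.leg k (st X) * L.Jp p := by
  have h1 : (matProj p X : Mat n) = X := by
    ext i j
    simp only [matProj, Matrix.of_apply]
    split_ifs with h
    · rfl
    · exact (hX i j h).symm
  have h2 : ∀ p' ≠ p, (matProj p' X : Mat n) = 0 := by
    intro p' hp'
    ext i j
    simp only [matProj, Matrix.of_apply]
    split_ifs with h
    · exact hX i j (by rw [h]; exact hp')
    · rfl
  simp only [legT, LinearMap.sum_apply, LinearMap.comp_apply, LinearMap.coe_mk, AddHom.coe_mk,
    LinearMap.mulRight_apply, AlgHom.toLinearMap_apply]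
  rw [Finset.sum_eq_single p, h1]
  · intro p' _ hp'
    rw [h2 p' hp', map_zero, map_zero, zero_mul]
  · simp

lemma legT_E (i j : Idx n) :
    L.legT k (E i j) =
      sgn ((par i + par j) * par i) • (L.leg k (E j i) * L.Jp (par i + par j)) := by
  rw [legT_of_mem (E_mem i j), st_E, map_smul, smul_mul_assoc]

lemma legT_one : L.legT k 1 = 1 := by
  have : (1 : Mat n) ∈ matPart n 0 := SetLike.GradedOne.one_mem
  rw [legT_of_mem this, st_one, map_one, Jp_zero, one_mul]

/-- The supertranspose reverses products up to the sign (−1)^{|X||Y|}; moving the powers of `J`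
together absorbs this sign, which leaves an honest anti-homomorphism. -/
lemma legT_mul (X Y : Mat n) : L.legT k (X * Y) = L.legT k Y * L.legT k X := by
  have : (LinearMap.mul K (Mat n)).compr₂ (L.legT k) =
      (LinearMap.mul K A).flip.compl₁₂ (L.legT k) (L.legT k) := by
    refine mat_hom_ext fun i j => mat_hom_ext fun i' j' => ?_
    simp only [LinearMap.compr₂_apply, LinearMap.mul_apply', LinearMap.compl₁₂_apply,
      LinearMap.flip_apply]
    rw [E_mul_E, legT_E, legT_E, smul_mul_smul_comm, mul_assoc, ← mul_assoc (L.Jp _), Jp_leg,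
      smul_mul_assoc, mul_smul_comm, mul_assoc, Jp_mul, ← mul_assoc, ← map_mul, E_mul_E]
    by_cases h : j = i'
    · subst h
      rw [if_pos rfl, if_pos rfl, legT_E, smul_smul, ← sgn_add, ← sgn_add]
      generalize L.leg k _ = x
      congr 2
      · generalize par i = i, par j = j, par j' = j'
        revert i j j'; decide
      · congr 1
        generalize par i = i, par j = j, par j' = j'
        revert i j j'; decide
    · rw [if_neg h, if_neg (Ne.symm h)]
      simp
  exact LinearMap.congr_fun₂ this X Y

/-- Transposing all legs, and reversing the multiplication. -/
def op (L : LegSystem n ι A) : LegSystem n ι Aᵐᵒᵖ where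
  leg k := AlgHom.ofLinearMap ((MulOpposite.opLinearEquiv K).toLinearMap ∘ₗ L.legT k)
    (congrArg MulOpposite.op legT_one) (fun X Y => congrArg MulOpposite.op (legT_mul X Y))
  J := MulOpposite.op L.J
  J_sq := by rw [← MulOpposite.op_mul, L.J_sq, MulOpposite.op_one]
  J_leg k a b := by
    refine MulOpposite.unop_injective ?_
    change L.legT k (E a b) * L.J = sgn (par a + par b) • (L.J * L.legT k (E a b))
    rw [legT_E, smul_mul_assoc, mul_smul_comm, ← mul_assoc, L.J_leg, smul_mul_assoc, mul_assoc,
      mul_assoc, ← Jp_one, Jp_mul, Jp_mul, add_comm 1, smul_comm (sgn (par a + par b)),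
      smul_smul (sgn (par a + par b)), add_comm (par b) (par a), sgn_mul_self, one_smul]
  comm k l h a b c d := by
    refine MulOpposite.unop_injective ?_
    change L.legT l (E c d) * L.legT k (E a b) =
      sgn ((par a + par b) * (par c + par d)) • (L.legT k (E a b) * L.legT l (E c d))
    rw [legT_E, legT_E, smul_mul_smul_comm, smul_mul_smul_comm, mul_assoc, ← mul_assoc (L.Jp _),
      Jp_leg, smul_mul_assoc, mul_smul_comm, mul_assoc, Jp_mul, ← mul_assoc, L.comm l k h.symm,
      mul_assoc (L.leg k _) (L.Jp _), ← mul_assoc (L.Jp (par a + par b)), Jp_leg, smul_mul_assoc,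
      smul_mul_assoc, mul_smul_comm, mul_assoc (L.leg l _) (L.Jp _), Jp_mul, ← mul_assoc,
      add_comm (par a + par b) (par c + par d)]
    simp only [smul_smul, ← sgn_add]
    congr 2
    generalize par a = a, par b = b, par c = c, par d = d
    revert a b c d; decide

lemma op_leg (X : Mat n) : L.op.leg k X = MulOpposite.op (L.legT k X) := rfl

/-- For even `Z` the two powers of `J` cancel, and the sign from moving one past a leg is undone by
reordering the legs. -/
lemma op_two (h : k ≠ l) {Z : Mat2 n} (hZ : Z ∈ evenPart n) :
    L.op.two k l Z = MulOpposite.op (L.two k l (st2 Z)) := by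
  induction hZ using Submodule.span_induction with
  | zero => simp
  | add x y _ _ hx hy => simp only [map_add, hx, hy, MulOpposite.op_add]
  | smul c x _ hx => simp only [map_smul, hx, MulOpposite.op_smul]
  | mem x hx =>
    obtain ⟨a, b, c, d, h', rfl⟩ := hx
    rw [two_tens, op_leg, op_leg, ← MulOpposite.op_mul, st2_tens_E, map_smul, two_tens, legT_E,
      legT_E, smul_mul_smul_comm, mul_assoc, ← mul_assoc (L.Jp _), Jp_leg, smul_mul_assoc,
      mul_smul_comm, mul_assoc, Jp_mul, h', CharTwo.add_self_eq_zero, Jp_zero, mul_one,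
      L.comm l k h.symm, smul_smul, smul_smul, ← h']
    congr 2
    rw [add_comm (par b) (par a), add_comm (par d), h', mul_assoc, sgn_mul_self, mul_one,
      ← sgn_add, add_comm]

/-- Reversing the product PᵀSᵀ gives SP in legs (k, l), which is PS in legs (l, k). So the relations
of `T` carry over to `Ts` with the legs exchanged. -/
lemma Ts_eq (h : k ≠ l) : MulOpposite.op (L.Ts k l) = L.op.T l k := by
  have h1 : L.op.T l k = L.op.two k l (S n) * L.op.two k l (P n) := by
    rw [T_eq h.symm, flip_two_swap h.symm, flip_comm h.symm]
  rw [h1, op_two h S_mem_evenPart, op_two h P_mem_evenPart, ← MulOpposite.op_mul, Ts, two_mul h]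

lemma Ts_sq (h : k ≠ l) : L.Ts k l * L.Ts k l = xi • L.Ts k l + 1 := by
  apply MulOpposite.op_injective
  rw [MulOpposite.op_mul, MulOpposite.op_add, MulOpposite.op_smul, MulOpposite.op_one, Ts_eq h,
    T_sq h.symm]

theorem Ts_braid (hkl : k ≠ l) (hkm : k ≠ m) (hlm : l ≠ m) :
    L.Ts k l * L.Ts l m * L.Ts k l = L.Ts l m * L.Ts k l * L.Ts l m := by
  apply MulOpposite.op_injective
  rw [MulOpposite.op_mul, MulOpposite.op_mul, MulOpposite.op_mul, MulOpposite.op_mul, Ts_eq hkl,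
    Ts_eq hlm, ← mul_assoc, ← mul_assoc, braid hlm.symm hkm.symm hkl.symm]

lemma Ts_mul_Cs (h : k ≠ l) : L.Ts k l * L.Cs k = L.Cs l * L.Ts k l := by
  have h1 := T_mul_C (L := L.op) h.symm
  rw [← Ts_eq h, C, C, op_leg, op_leg, ← MulOpposite.op_mul, ← MulOpposite.op_mul] at h1
  have h2 := MulOpposite.op_injective h1
  -- Transposing the odd Φ leaves a factor `J` on each side; it commutes with the even `Ts` and is
  -- cancelled by J² = 1.
  rw [legT_of_mem Phi_mem, legT_of_mem Phi_mem, Jp_one, mul_assoc,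
    J_two Ts_mem_evenPart, ← mul_assoc, ← mul_assoc] at h2
  have h3 := congrArg (· * L.J) h2
  simpa only [mul_assoc, L.J_sq, mul_one] using h3.symm

end LegSystem

namespace LegSystem
variable {ι A : Type} [Ring A] [Algebra K A] {L : LegSystem n ι A} {k l m a b : ι}

/-! ### Relations between dual legs and an auxiliary leg -/

/-- The Yang-Baxter equation multiplied on both sides by the inverses of its two factors in leg `k`.
-/
lemma Ri_Ri_R (hka : k ≠ a) (hkb : k ≠ b) (hab : a ≠ b) :
    L.Ri k b * L.Ri k a * L.R a b = L.R a b * L.Ri k a * L.Ri k b := by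
  have h1 : L.R k b * L.R k a * (L.Ri k a * L.Ri k b) = 1 := by
    rw [mul_assoc, ← mul_assoc (L.R k a), R_mul_Ri hka, one_mul, R_mul_Ri hkb]
  have h2 : L.Ri k b * L.Ri k a * (L.R k a * L.R k b) = 1 := by
    rw [mul_assoc, ← mul_assoc (L.Ri k a), Ri_mul_R hka, one_mul, Ri_mul_R hkb]
  calc L.Ri k b * L.Ri k a * L.R a b
      = L.Ri k b * L.Ri k a * (L.R a b * L.R k b * L.R k a) * (L.Ri k a * L.Ri k b) := by
        rw [mul_assoc (L.R a b), mul_assoc _ (L.R a b * _), mul_assoc (L.R a b), h1, mul_one]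
    _ = _ := by
        rw [← yang_baxter hka hkb hab, ← mul_assoc _ (L.R k a * L.R k b), h2, one_mul, mul_assoc]

/-- Under a cap joining `k` to an adjoined V leg, each `Rs` slides to `Ri` on the new leg, with the
order of the two reversed. What remains is `Ri_Ri_R`. -/
theorem Rs_Rs_R (hka : k ≠ a) (hkb : k ≠ b) (hab : a ≠ b) :
    L.Rs k a * L.Rs k b * L.R a b = L.R a b * L.Rs k b * L.Rs k a := by
  refine cancel_cap (L := L) k ?_
  have ne : ∀ {x y : ι}, x ≠ y → some x ≠ some y := fun h e => h (Option.some.inj e)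
  simp only [map_mul, ← ext_two_some]
  set M := L.ext
  calc M.Rs (some k) (some a) * M.Rs (some k) (some b) * M.R (some a) (some b) * M.e none (some k)
      = M.Rs (some k) (some a) * (M.Rs (some k) (some b) * M.e none (some k)) *
          M.R (some a) (some b) := by
        rw [mul_assoc, two_two S_mem_evenPart (Option.some_ne_none _) (Option.some_ne_none _)
          (ne hka.symm) (ne hkb.symm)]
        simp only [mul_assoc]
    _ = (M.Rs (some k) (some a) * M.Ri none (some b)) * M.e none (some k) *
          M.R (some a) (some b) := by
        rw [Rs_mul_e (Option.some_ne_none _).symm (Option.some_ne_none _).symm (ne hkb)]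
        simp only [mul_assoc]
    _ = M.Ri none (some b) * (M.Rs (some k) (some a) * M.e none (some k)) *
          M.R (some a) (some b) := by
        rw [two_two Rs_mem_evenPart (Option.some_ne_none _) (Option.some_ne_none _) (ne hkb)
          (ne hab)]
        simp only [mul_assoc]
    _ = M.Ri none (some b) * M.Ri none (some a) * (M.e none (some k) *
          M.R (some a) (some b)) := by
        rw [Rs_mul_e (Option.some_ne_none _).symm (Option.some_ne_none _).symm (ne hka)]
        simp only [mul_assoc]
    _ = M.Ri none (some b) * M.Ri none (some a) * M.R (some a) (some b) * M.e none (some k) := by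
        rw [← two_two S_mem_evenPart (Option.some_ne_none _) (Option.some_ne_none _)
          (ne hka.symm) (ne hkb.symm)]
        simp only [mul_assoc]
    _ = M.R (some a) (some b) * M.Ri none (some a) * (M.Ri none (some b) * M.e none (some k)) := by
        rw [Ri_Ri_R (Option.some_ne_none _).symm (Option.some_ne_none _).symm (ne hab)]
        simp only [mul_assoc]
    _ = M.R (some a) (some b) * (M.Rs (some k) (some b) * (M.Ri none (some a) *
          M.e none (some k))) := by
        rw [← Rs_mul_e (Option.some_ne_none _).symm (Option.some_ne_none _).symm (ne hkb),
          mul_assoc, ← mul_assoc (M.Ri none (some a)),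
          ← two_two (Z := st1 (Sinv n)) Rs_mem_evenPart (Option.some_ne_none _)
            (Option.some_ne_none _) (ne hka) (ne hab.symm)]
        simp only [mul_assoc]
    _ = _ := by
        rw [← Rs_mul_e (Option.some_ne_none _).symm (Option.some_ne_none _).symm (ne hka)]
        simp only [mul_assoc]

lemma Rs_mul_Cs (h : k ≠ a) : L.Rs k a * L.Cs k = L.Cs k * L.Rs k a := by
  refine cancel_cap (L := L) k ?_
  have h' : some k ≠ some a := fun e => h (Option.some.inj e)
  have hn : ∀ x : ι, none ≠ some x := fun x => (Option.some_ne_none x).symm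
  simp only [map_mul, ← ext_two_some, ← ext_leg_some]
  rw [mul_assoc, mul_assoc, ← C_mul_e (hn k), Rs_mul_e (hn k) (hn a) h', ← mul_assoc, ← mul_assoc,
    two_leg Rs_mem_evenPart (hn k).symm (hn a).symm,
    ← two_leg Sinv_mem_evenPart (hn k) h'.symm, mul_assoc, mul_assoc,
    Rs_mul_e (hn k) (hn a) h', ← C_mul_e (hn k), ← mul_assoc, ← mul_assoc, Ri_mul_C (hn a)]

/-! ### Nested caps and cups -/

/-- The legs l, k, k', l' carry nested caps, and each component of `Z` slides along its own cap. No
sign occurs, since the component in `k` is moved only past the even cap of `l`. -/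
lemma two_st2_mul_caps {k' l' : ι} (hkk' : k ≠ k') (hlk : l ≠ k) (hlk' : l ≠ k') (hll' : l ≠ l')
    (hkl' : k ≠ l') (hkl'' : k' ≠ l') (Z : Mat2 n) :
    L.two l' k' (st2 Z) * (L.e k k' * L.e l l') = L.two l k Z * (L.e k k' * L.e l l') := by
  have hc : L.e k k' * L.e l l' = L.e l l' * L.e k k' :=
    e_comm_e hlk.symm hlk'.symm hkl' hkl''
  have key : (LinearMap.mulRight K (L.e k k' * L.e l l')) ∘ₗ L.two l' k' ∘ₗ st2 =
      (LinearMap.mulRight K (L.e k k' * L.e l l')) ∘ₗ L.two l k := by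
    refine mat2_hom_ext_tens fun X Y => ?_
    simp only [LinearMap.comp_apply, LinearMap.mulRight_apply, st2_tens, two_tens]
    calc L.leg l' (st X) * L.leg k' (st Y) * (L.e k k' * L.e l l')
        = L.leg l' (st X) * (L.leg k' (st Y) * L.e k k') * L.e l l' := by simp only [mul_assoc]
      _ = L.leg l' (st X) * L.leg k Y * (L.e k k' * L.e l l') := by
          rw [← leg_mul_e hkk']; simp only [mul_assoc]
      _ = L.leg l' (st X) * (L.leg k Y * L.e l l') * L.e k k' := by
          rw [hc]; simp only [mul_assoc]
      _ = (L.leg l' (st X) * L.e l l') * L.leg k Y * L.e k k' := by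
          rw [← two_leg Q_mem_evenPart hlk hkl'.symm]; simp only [mul_assoc]
      _ = L.leg l X * (L.e l l' * L.leg k Y) * L.e k k' := by
          rw [← leg_mul_e hll']; simp only [mul_assoc]
      _ = _ := by
          rw [two_leg Q_mem_evenPart hlk hkl'.symm, hc]; simp only [mul_assoc]
  exact LinearMap.congr_fun key Z

/-- Sliding reverses the order of the factors, so PᵀSᵀ arrives on the V side as SP in legs (l, k),
which is PS in legs (k, l). -/
lemma Ts_mul_caps {k' l' : ι} (hkk' : k ≠ k') (hlk : l ≠ k) (hlk' : l ≠ k') (hll' : l ≠ l')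
    (hkl' : k ≠ l') (hkl'' : k' ≠ l') :
    L.Ts l' k' * (L.e k k' * L.e l l') = L.T k l * (L.e k k' * L.e l l') := by
  rw [Ts, two_mul hkl''.symm, mul_assoc, two_st2_mul_caps hkk' hlk hlk' hll' hkl' hkl'',
    ← mul_assoc, two_two (st2_mem_evenPart P_mem_evenPart) hll'.symm hlk'.symm hkl'.symm hkk'.symm,
    mul_assoc, two_st2_mul_caps hkk' hlk hlk' hll' hkl' hkl'', T_eq hlk.symm, ← mul_assoc,
    flip_two_swap hlk.symm, flip_comm hlk.symm]

lemma cups_mul_two_st2 {k' l' : ι} (hkk' : k ≠ k') (hlk : l ≠ k) (hlk' : l ≠ k') (hll' : l ≠ l')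
    (hkl' : k ≠ l') (hkl'' : k' ≠ l') (Z : Mat2 n) :
    L.e0 k k' * L.e0 l l' * L.two l' k' (st2 Z) = L.e0 k k' * L.e0 l l' * L.two l k Z := by
  have hc : L.e0 k k' * L.e0 l l' = L.e0 l l' * L.e0 k k' :=
    two_two Q0_mem_evenPart hlk.symm hlk'.symm hkl' hkl'' _
  have key : (LinearMap.mulLeft K (L.e0 k k' * L.e0 l l')) ∘ₗ L.two l' k' ∘ₗ st2 =
      (LinearMap.mulLeft K (L.e0 k k' * L.e0 l l')) ∘ₗ L.two l k := by
    refine mat2_hom_ext fun i j i' j' => ?_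
    simp only [LinearMap.comp_apply, LinearMap.mulLeft_apply, st2_tens, two_tens]
    calc L.e0 k k' * L.e0 l l' * (L.leg l' (st (E i j)) * L.leg k' (st (E i' j')))
        = L.e0 k k' * (L.e0 l l' * L.leg l' (st (E i j))) * L.leg k' (st (E i' j')) := by
          simp only [mul_assoc]
      _ = L.e0 k k' * L.e0 l l' * (L.leg l (E i j) * L.leg k' (st (E i' j'))) := by
          rw [← e0_mul_leg hll']; simp only [mul_assoc]
      _ = sgn ((par i + par j) * (par j' + par i')) • (L.e0 l l' * (L.e0 k k' *
            L.leg k' (st (E i' j'))) * L.leg l (E i j)) := by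
          rw [st_E, map_smul, mul_smul_comm, L.comm l k' hlk', hc]
          simp only [mul_smul_comm, smul_mul_assoc, mul_assoc]
          rw [smul_comm]
      _ = _ := by
          rw [← e0_mul_leg hkk', add_comm (par j')]
          simp only [mul_assoc]
          rw [L.comm k l hlk.symm, mul_smul_comm, mul_smul_comm, smul_smul,
            mul_comm (par i' + par j'), sgn_mul_self, one_smul, ← mul_assoc, ← hc]
          simp only [mul_assoc]
  exact LinearMap.congr_fun key Z

/-- The unweighted statement comes from sliding along the cups; it extends to the weighted cups
because D ⊗ D commutes with PS. -/
lemma cups_mul_Ts {k' l' : ι} (hkk' : k ≠ k') (hlk : l ≠ k) (hlk' : l ≠ k') (hll' : l ≠ l')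
    (hkl' : k ≠ l') (hkl'' : k' ≠ l') :
    L.e k k' * L.e l l' * L.Ts l' k' = L.e k k' * L.e l l' * L.T k l := by
  have h0 : L.e0 k k' * L.e0 l l' * L.Ts l' k' = L.e0 k k' * L.e0 l l' * L.T k l := by
    rw [Ts, two_mul hkl''.symm, ← mul_assoc, cups_mul_two_st2 hkk' hlk hlk' hll' hkl' hkl'',
      mul_assoc,
      ← two_two (st2_mem_evenPart S_mem_evenPart) hll'.symm hlk'.symm hkl'.symm hkk'.symm,
      ← mul_assoc, cups_mul_two_st2 hkk' hlk hlk' hll' hkl' hkl'', T_eq hlk.symm,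
      flip_two_swap hlk.symm, flip_comm hlk.symm, mul_assoc]
  have hD : L.e k k' * L.e l l' = L.e0 k k' * L.e0 l l' * L.two k l (tens (D n) (D n)) := by
    rw [e_eq hkk', e_eq hll', two_tens, mul_assoc, ← mul_assoc (L.leg k (D n)),
      ← two_leg Q0_mem_evenPart hlk hkl'.symm]
    simp only [mul_assoc]
  rw [hD, mul_assoc _ (L.two k l (tens _ _)), mul_assoc _ (L.two k l (tens _ _)),
    ← two_two Ts_mem_evenPart hkl'.symm hkk'.symm hll'.symm hlk'.symm, T, ← two_mul hlk.symm,
    tens_D_D_mul_PS, two_mul hlk.symm, ← mul_assoc, ← mul_assoc, h0]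

lemma Ts_mul_Rs_Rs_caps {k' l' : ι} (hkk' : k ≠ k') (hlk : l ≠ k) (hlk' : l ≠ k') (hll' : l ≠ l')
    (hkl' : k ≠ l') (hkl'' : k' ≠ l') (hka : k ≠ a) (hla : l ≠ a) (hka' : k' ≠ a) (hla' : l' ≠ a) :
    L.Ts l' k' * (L.Rs l' a * L.Rs k' a) * (L.e k k' * L.e l l') =
      L.Rs l' a * L.Rs k' a * L.Ts l' k' * (L.e k k' * L.e l l') := by
  have hc : L.e k k' * L.e l l' = L.e l l' * L.e k k' := e_comm_e hlk.symm hlk'.symm hkl' hkl''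
  have hR : L.Rs l' a * L.Rs k' a * (L.e k k' * L.e l l') =
      L.Ri l a * L.Ri k a * (L.e k k' * L.e l l') := by
    calc _ = L.Rs l' a * (L.Rs k' a * L.e k k') * L.e l l' := by simp only [mul_assoc]
      _ = L.Rs l' a * L.Ri k a * (L.e k k' * L.e l l') := by
          rw [Rs_mul_e hkk' hka hka']; simp only [mul_assoc]
      _ = L.Rs l' a * (L.Ri k a * L.e l l') * L.e k k' := by
          rw [hc]; simp only [mul_assoc]
      _ = (L.Rs l' a * L.e l l') * L.Ri k a * L.e k k' := by
          rw [two_two Sinv_mem_evenPart hlk.symm hla.symm hkl' hla'.symm]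
          simp only [mul_assoc]
      _ = L.Ri l a * (L.e l l' * L.Ri k a) * L.e k k' := by
          rw [Rs_mul_e hll' hla hla']; simp only [mul_assoc]
      _ = _ := by
          rw [← two_two Sinv_mem_evenPart hlk.symm hla.symm hkl' hla'.symm, hc]
          simp only [mul_assoc]
  have hT := Ts_mul_caps (L := L) hkk' hlk hlk' hll' hkl' hkl''
  set QQ := L.e k k' * L.e l l'
  calc L.Ts l' k' * (L.Rs l' a * L.Rs k' a) * QQ
      = L.Ts l' k' * L.Ri l a * L.Ri k a * QQ := by
        rw [mul_assoc, hR]; simp only [mul_assoc]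
    _ = L.Ri l a * (L.Ts l' k' * L.Ri k a) * QQ := by
        rw [two_two Ts_mem_evenPart hll'.symm hlk'.symm hla' hka']
        simp only [mul_assoc]
    _ = L.Ri l a * L.Ri k a * (L.Ts l' k' * QQ) := by
        rw [two_two Ts_mem_evenPart hkl'.symm hkk'.symm hla' hka']
        simp only [mul_assoc]
    _ = L.T k l * (L.Rs l' a * L.Rs k' a * QQ) := by
        rw [hT, ← mul_assoc, ← T_mul_Ri_Ri hlk.symm hka hla, hR]; simp only [mul_assoc]
    _ = (L.T k l * L.Rs l' a) * L.Rs k' a * QQ := by simp only [mul_assoc]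
    _ = L.Rs l' a * (L.T k l * L.Rs k' a) * QQ := by
        rw [two_two PS_mem_evenPart hkl' hll' hka hla]; simp only [mul_assoc]
    _ = L.Rs l' a * L.Rs k' a * (L.T k l * QQ) := by
        rw [two_two PS_mem_evenPart hkk' hlk' hka hla]; simp only [mul_assoc]
    _ = _ := by rw [← hT]; simp only [mul_assoc]

/-- With both dual legs capped by adjoined V legs, the claim becomes `T_mul_Ri_Ri` for the adjoined
legs. -/
theorem Ts_mul_Rs_Rs (hkl : k ≠ l) (hka : k ≠ a) (hla : l ≠ a) :
    L.Ts k l * (L.Rs k a * L.Rs l a) = L.Rs k a * L.Rs l a * L.Ts k l := by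
  refine cancel_two_caps (L := L) k l ?_ hkl
  simp only [map_mul, ← ext_two_some]
  have h1 : ∀ {x y : ι}, x ≠ y → some (some x) ≠ some (some y) :=
    fun h e => h (Option.some.inj (Option.some.inj e))
  have h2 : ∀ x : ι, none ≠ some (some x) := fun x e => by cases e
  have h3 : ∀ x : ι, some none ≠ some (some x) := fun x e => by cases e
  have h4 : (some none : Option (Option ι)) ≠ none := fun e => by cases e
  -- The caps are nested: the outermost leg `none` is joined to `l`, and `some none` to `k`.
  exact Ts_mul_Rs_Rs_caps (h2 l) h4 (h3 l) (h3 k) (h2 k) (h1 hkl.symm) (h2 a) (h3 a) (h1 hla)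
    (h1 hka)

/-! ### Traces -/

lemma e_leg_e (h : k ≠ l) (X : Mat n) : L.e k l * L.leg k X * L.e k l = trq X • L.e k l := by
  have := congrArg (L.two k l) (Q_mul_tens_mul_Q X)
  rwa [two_mul h, two_mul h, two_tens, map_one, mul_one, map_smul] at this

/-- The component in `m` moves out past the even `e`; the one in `k` is caught between the two
copies of `e` and becomes its weighted supertrace. -/
lemma e_two_e (h : k ≠ l) (hmk : m ≠ k) (hml : m ≠ l) (Z : Mat2 n) :
    L.e k l * L.two m k Z * L.e k l = L.leg m (ptr Z) * L.e k l := by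
  have key : (LinearMap.mulRight K (L.e k l)) ∘ₗ (LinearMap.mulLeft K (L.e k l)) ∘ₗ L.two m k =
      (LinearMap.mulRight K (L.e k l)) ∘ₗ (L.leg m).toLinearMap ∘ₗ ptr := by
    refine mat2_hom_ext_tens fun X Y => ?_
    simp only [LinearMap.comp_apply, LinearMap.mulRight_apply, LinearMap.mulLeft_apply, two_tens,
      ptr_tens, AlgHom.toLinearMap_apply, map_smul]
    rw [← mul_assoc, two_leg Q_mem_evenPart hmk.symm hml.symm, mul_assoc, mul_assoc,
      ← mul_assoc _ _ (L.e k l), e_leg_e h, mul_smul_comm]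
  exact LinearMap.congr_fun key Z

lemma e_sq (h : k ≠ l) : L.e k l * L.e k l = 0 := by
  have := e_leg_e (L := L) h 1
  rwa [map_one, mul_one, trq_one, zero_smul] at this

lemma e_C_e (h : k ≠ l) : L.e k l * L.C k * L.e k l = 0 := by
  rw [C, e_leg_e h, trq_Phi, zero_smul]

lemma e_T_e (h : k ≠ l) (hmk : m ≠ k) (hml : m ≠ l) :
    L.e k l * L.T m k * L.e k l = L.e k l := by
  rw [T, e_two_e h hmk hml, ptr_PS, map_one, one_mul]

/-- Capping `m` with an adjoined leg turns `Ts l m` into a `T` on the V side, where `e_T_e` applies.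
-/
theorem e_Ts_e (h : k ≠ l) (hkm : k ≠ m) (hlm : l ≠ m) :
    L.e k l * L.Ts l m * L.e k l = L.e k l := by
  refine cancel_cap (L := L) m ?_
  simp only [map_mul, ← ext_two_some]
  have ne : ∀ {x y : ι}, x ≠ y → some x ≠ some y := fun h e => h (Option.some.inj e)
  have hn : ∀ x : ι, none ≠ some x := fun x => (Option.some_ne_none x).symm
  have hc : L.ext.e (some k) (some l) * L.ext.e none (some m) =
      L.ext.e none (some m) * L.ext.e (some k) (some l) :=
    e_comm_e (hn k).symm (hn l).symm (ne hkm) (ne hlm)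
  have h1 := Ts_mul_caps (L := L.ext) (hn m) (hn k).symm (ne hkm) (ne h) (hn l) (ne hlm.symm)
  rw [mul_assoc, hc, mul_assoc, h1, ← hc, ← mul_assoc, ← mul_assoc, e_T_e (ne h) (hn k) (hn l)]

/-- `(PS)⁻¹` in the legs `k`, `l`. -/
abbrev Ti (L : LegSystem n ι A) (k l : ι) : A := L.two k l (PSinv n)

lemma T_mul_Ti (h : k ≠ l) : L.T k l * L.Ti k l = 1 := by
  rw [T, Ti, ← two_mul h, PSinv, PS_mul_sub, two_one]

lemma Ti_mul_T (h : k ≠ l) : L.Ti k l * L.T k l = 1 := by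
  rw [T, Ti, ← two_mul h, PSinv, sub_mul_PS, two_one]

lemma Ti_eq : L.Ti k l = L.T k l - xi • 1 := by
  rw [Ti, PSinv, map_sub, map_smul, two_one]

lemma PSinv_mem_evenPart : PSinv n ∈ evenPart n :=
  Submodule.sub_mem _ PS_mem_evenPart (Submodule.smul_mem _ _ one_mem_evenPart)

/-- If a pair `y`, `y'` that is even and disjoint from `m` averages under `e` like a conjugation
that preserves the trace, it does so with coefficients in `m`. -/
lemma e_conj_e {y y' : A} (hmk : m ≠ k) (hml : m ≠ l) {x : ι}
    (hy : ∀ X, y * L.leg m X = L.leg m X * y)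
    (hyy : ∀ X, L.e k l * y * L.leg x X * y' * L.e k l = trq X • L.e k l) (Z : Mat2 n) :
    L.e k l * y * L.two m x Z * y' * L.e k l = L.leg m (ptr Z) * L.e k l := by
  have key : (LinearMap.mulRight K (L.e k l)) ∘ₗ (LinearMap.mulRight K y') ∘ₗ
        (LinearMap.mulLeft K (L.e k l * y)) ∘ₗ L.two m x =
      (LinearMap.mulRight K (L.e k l)) ∘ₗ (L.leg m).toLinearMap ∘ₗ ptr := by
    refine mat2_hom_ext_tens fun X Y => ?_
    simp only [LinearMap.comp_apply, LinearMap.mulRight_apply, LinearMap.mulLeft_apply, two_tens,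
      ptr_tens, AlgHom.toLinearMap_apply, map_smul]
    calc _ = L.e k l * (y * L.leg m X) * L.leg x Y * y' * L.e k l := by simp only [mul_assoc]
      _ = (L.e k l * L.leg m X) * y * L.leg x Y * y' * L.e k l := by
          rw [hy]; simp only [mul_assoc]
      _ = L.leg m X * (L.e k l * y * L.leg x Y * y' * L.e k l) := by
          rw [two_leg Q_mem_evenPart hmk.symm hml.symm]; simp only [mul_assoc]
      _ = _ := by rw [hyy, mul_smul_comm]
  exact LinearMap.congr_fun key Z

/-- Since R is the flip times T, conjugating by R is conjugating by PS and then exchanging the legs.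
This brings `ptr_conj` into play. -/
lemma R_leg_Ri (h : k ≠ a) (X : Mat n) :
    L.R k a * L.leg k X * L.Ri k a = L.two a k (P n * S n * tens X 1 * PSinv n) := by
  have h1 : PSinv n = Sinv n * P n := by
    have : P n * S n * (Sinv n * P n) = 1 := by
      rw [mul_assoc, ← mul_assoc (S n), S_mul_Sinv, one_mul, P_mul_P]
    rw [← mul_one (PSinv n), ← this, ← mul_assoc, PSinv, sub_mul_PS, one_mul]
  have h2 : P n * S n * tens X 1 * PSinv n = P n * (S n * tens X 1 * Sinv n) * P n := by
    rw [h1]; simp only [mul_assoc]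
  rw [h2, two_mul h.symm, two_mul h.symm, flip_two_swap h.symm, mul_assoc _ (L.flip a k),
    flip_mul_flip h.symm, mul_one, two_mul h, two_mul h, two_tens, map_one, mul_one]

/-- The cap turns `Rs l a` into `Ri m a`, and writing `e m l` as the conjugate of `e k l` by a flip
turns that into `Ri k a`. The flip then stands between R and R⁻¹ in the same legs, and by `ptr_conj`
this conjugation is invisible between two copies of `e`. -/
lemma e_mul_R_Rs_mul_cap (hkl : k ≠ l) (hka : k ≠ a) (hla : l ≠ a) (hmk : m ≠ k) (hml : m ≠ l)
    (hma : m ≠ a) :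
    L.e k l * (L.R k a * L.Rs l a) * L.e m l = L.e k l * L.e m l := by
  have hp : L.e m l = L.flip m k * L.e k l * L.flip m k := by
    rw [flip_two_right hmk hml hkl, mul_assoc, flip_mul_flip hmk, mul_one]
  have h1 : L.e k l * L.R k a * L.flip m k * L.Ri k a * L.e k l =
      L.leg m (ptr (P n)) * L.e k l := by
    refine e_conj_e hmk hml (fun X => two_leg S_mem_evenPart hmk.symm hma.symm X) (fun X => ?_) _
    rw [mul_assoc (L.e k l), mul_assoc (L.e k l), R_leg_Ri hka, e_two_e hkl hka.symm hla.symm,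
      ptr_conj, map_smul, map_one, smul_mul_assoc, one_mul]
  calc L.e k l * (L.R k a * L.Rs l a) * L.e m l
      = L.e k l * L.R k a * (L.Rs l a * L.e m l) := by simp only [mul_assoc]
    _ = L.e k l * L.R k a * (L.Ri m a * L.flip m k) * L.e k l * L.flip m k := by
        rw [Rs_mul_e hml hma hla, hp]; simp only [mul_assoc]
    _ = L.e k l * L.R k a * L.flip m k * L.Ri k a * L.e k l * L.flip m k := by
        rw [← flip_two_right hmk hma hka]; simp only [mul_assoc]
    _ = L.e k l * L.flip m k * L.e k l * L.flip m k := by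
        rw [h1, e_two_e hkl hmk hml]
    _ = _ := by rw [hp]; simp only [mul_assoc]

/-- The cup is invariant. -/
theorem e_mul_R_Rs (hkl : k ≠ l) (hka : k ≠ a) (hla : l ≠ a) :
    L.e k l * (L.R k a * L.Rs l a) = L.e k l := by
  refine cancel_cap (L := L) l ?_
  simp only [map_mul, ← ext_two_some]
  have ne : ∀ {x y : ι}, x ≠ y → some x ≠ some y := fun h e => h (Option.some.inj e)
  have hn : ∀ x : ι, none ≠ some x := fun x => (Option.some_ne_none x).symm
  exact e_mul_R_Rs_mul_cap (ne hkl) (ne hka) (ne hla) (hn k) (hn l) (hn a)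

/-- The cap is invariant. -/
theorem R_Rs_mul_e (hkl : k ≠ l) (hka : k ≠ a) (hla : l ≠ a) :
    L.R k a * L.Rs l a * L.e k l = L.e k l := by
  rw [mul_assoc, Rs_mul_e hkl hka hla, ← mul_assoc, R_mul_Ri hka, one_mul]

/-- The same mechanism as for the cup: under the caps `Ts l j` becomes T in legs m, k, a flip
conjugate of `T i k`. So the flip is conjugated by T⁻¹, which the trace does not see by `ptr_conj'`.
The remaining partial trace of `P` is reabsorbed as an `e` in legs i, j. -/
lemma e_Ti_Ts_e_mul_cap {i j : ι} (hik : i ≠ k) (hil : i ≠ l) (hij : i ≠ j) (hkl : k ≠ l)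
    (hkj : k ≠ j) (hlj : l ≠ j) (hmi : m ≠ i) (hmk : m ≠ k) (hml : m ≠ l) (hmj : m ≠ j) :
    L.e k l * (L.Ti i k * L.Ts l j) * L.e k l * L.e m j = L.e i j * L.e k l * L.e m j := by
  have hc : L.e k l * L.e m j = L.e m j * L.e k l := e_comm_e hmk.symm hml.symm hkj hlj
  have hc' : L.e i j * L.e k l = L.e k l * L.e i j := e_comm_e hik hkj.symm hil hlj.symm
  have hp : L.e i j = L.flip m i * L.e m j * L.flip m i := by
    rw [flip_two hmi hmj hij, mul_assoc, flip_mul_flip hmi, mul_one]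
  have hT : L.T m k = L.flip m i * L.T i k * L.flip m i := by
    rw [flip_two_right hmi hmk hik, mul_assoc, flip_mul_flip hmi, mul_one]
  have hpe : L.flip m i * L.e k l = L.e k l * L.flip m i :=
    two_two P_mem_evenPart hmk hik hml hil _
  have h1 : L.e k l * L.Ti i k * L.flip m i * L.T i k * L.e k l =
      L.leg m (ptr (P n)) * L.e k l := by
    refine e_conj_e hmk hml (fun X => two_leg PSinv_mem_evenPart hmi.symm hmk.symm X)
      (fun X => ?_) _
    have : L.Ti i k * L.leg i X * L.T i k = L.two i k (PSinv n * tens X 1 * (P n * S n)) := by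
      rw [two_mul hik, two_mul hik, two_tens, map_one, mul_one]
    rw [mul_assoc (L.e k l), mul_assoc (L.e k l), this, e_two_e hkl hik hil,
      ptr_conj', map_smul, map_one, smul_mul_assoc, one_mul]
  calc L.e k l * (L.Ti i k * L.Ts l j) * L.e k l * L.e m j
      = L.e k l * L.Ti i k * (L.Ts l j * (L.e m j * L.e k l)) := by
        rw [← hc]; simp only [mul_assoc]
    _ = L.e k l * L.Ti i k * L.flip m i * L.T i k * (L.flip m i * L.e k l) * L.e m j := by
        rw [Ts_mul_caps hmj hmk.symm hkj hkl hml hlj.symm, hT, ← hc]; simp only [mul_assoc]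
    _ = L.leg m (ptr (P n)) * L.e k l * L.flip m i * L.e m j := by
        rw [hpe, ← h1]; simp only [mul_assoc]
    _ = L.e k l * (L.leg m (ptr (P n)) * L.flip m i) * L.e m j := by
        rw [← two_leg Q_mem_evenPart hmk.symm hml.symm]; simp only [mul_assoc]
    _ = L.e k l * L.flip m i * (L.leg i (ptr (P n)) * L.e m j) := by
        rw [← flip_leg' hmi]; simp only [mul_assoc]
    _ = L.e k l * (L.flip m i * L.e m j * L.flip m i) * L.e m j := by
        rw [← e_two_e hmj hmi.symm hij, flip_comm hmi]; simp only [mul_assoc]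
    _ = _ := by rw [← hp, hc']

theorem e_Ti_Ts_e {i j : ι} (hik : i ≠ k) (hil : i ≠ l) (hij : i ≠ j) (hkl : k ≠ l)
    (hkj : k ≠ j) (hlj : l ≠ j) :
    L.e k l * (L.Ti i k * L.Ts l j) * L.e k l = L.e i j * L.e k l := by
  refine cancel_cap (L := L) j ?_
  simp only [map_mul, ← ext_two_some]
  have ne : ∀ {x y : ι}, x ≠ y → some x ≠ some y := fun h e => h (Option.some.inj e)
  have hn : ∀ x : ι, none ≠ some x := fun x => (Option.some_ne_none x).symm
  exact e_Ti_Ts_e_mul_cap (ne hik) (ne hil) (ne hij) (ne hkl) (ne hkj) (ne hlj) (hn i) (hn k)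
    (hn l) (hn j)

/-- Both sides equal `e i j * e k l`: by `e_Ti_Ts_e` this product appears on either side, and next
to nested caps or cups `Ts l j` acts as `T i k`, which cancels the remaining `Ti i k`. -/
theorem e_long {i j : ι} (hik : i ≠ k) (hil : i ≠ l) (hij : i ≠ j) (hkl : k ≠ l)
    (hkj : k ≠ j) (hlj : l ≠ j) :
    L.e k l * L.Ti i k * L.Ts l j * L.e k l * L.Ts l j * L.Ti i k =
      L.Ti i k * L.Ts l j * L.e k l * L.Ts l j * L.Ti i k * L.e k l := by
  have hc : L.Ts l j * L.Ti i k = L.Ti i k * L.Ts l j :=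
    two_two Ts_mem_evenPart hil.symm hij.symm hkl.symm hkj.symm _
  have hF := e_Ti_Ts_e (L := L) hik hil hij hkl hkj hlj
  have h1 : L.Ts l j * (L.e i j * L.e k l) = L.T i k * (L.e i j * L.e k l) :=
    Ts_mul_caps hij hik.symm hkj hkl hil hlj.symm
  have h2 : L.e i j * L.e k l * L.Ts l j = L.e i j * L.e k l * L.T i k :=
    cups_mul_Ts hij hik.symm hkj hkl hil hlj.symm
  calc _ = L.e k l * (L.Ti i k * L.Ts l j) * L.e k l * L.Ts l j * L.Ti i k := by
        simp only [mul_assoc]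
    _ = L.e i j * L.e k l := by rw [hF, h2, mul_assoc, T_mul_Ti hik, mul_one]
    _ = L.Ti i k * (L.Ts l j * (L.e k l * (L.Ti i k * L.Ts l j) * L.e k l)) := by
        rw [hF, h1, ← mul_assoc, Ti_mul_T hik, one_mul]
    _ = L.Ti i k * (L.Ts l j * (L.e k l * (L.Ts l j * L.Ti i k) * L.e k l)) := by rw [hc]
    _ = _ := by simp only [mul_assoc]

lemma C_sq : L.C k * L.C k = -1 := by
  rw [C, ← map_mul, Phi_sq, map_neg, map_one]

lemma Cs_sq : L.Cs k * L.Cs k = 1 := by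
  have : st (Phi n) * st (Phi n) = 1 := by
    rw [st_Phi, Finset.sum_mul]
    conv_rhs => rw [one_eq_sum_E]
    refine Finset.sum_congr rfl fun i _ => ?_
    rw [Finset.mul_sum, Finset.sum_eq_single (-i)]
    · rw [E_mul_E_same, idx_neg_neg]
    · intro j _ hj
      rw [E_mul_E_ne _ _ _ _ hj.symm]
    · simp
  rw [Cs, ← map_mul, this, map_one]

/-- Homogeneous elements in different legs supercommute. -/
lemma leg_comm (h : k ≠ l) {p p' : ZMod 2} {X Y : Mat n} (hX : X ∈ matPart n p)
    (hY : Y ∈ matPart n p') :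
    L.leg k X * L.leg l Y = sgn (p * p') • (L.leg l Y * L.leg k X) := by
  have h1 : ∀ i j, L.leg k (E i j) * L.leg l Y =
      sgn ((par i + par j) * p') • (L.leg l Y * L.leg k (E i j)) := by
    intro i j
    rw [mat_eq_sum Y]
    simp only [map_sum, map_smul, Finset.sum_mul, Finset.mul_sum, Finset.smul_sum]
    refine Finset.sum_congr rfl fun c _ => Finset.sum_congr rfl fun d _ => ?_
    rw [smul_mul_assoc, mul_smul_comm, L.comm k l h, smul_comm]
    by_cases hp : par c + par d = p'
    · rw [hp]
    · rw [hY c d hp, zero_smul, smul_zero, smul_zero]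
  rw [mat_eq_sum X]
  simp only [map_sum, map_smul, Finset.sum_mul, Finset.mul_sum, Finset.smul_sum]
  refine Finset.sum_congr rfl fun c _ => Finset.sum_congr rfl fun d _ => ?_
  rw [smul_mul_assoc, mul_smul_comm, h1, smul_comm]
  by_cases hp : par c + par d = p
  · rw [hp]
  · rw [hX c d hp, zero_smul, smul_zero, smul_zero]

lemma st_mem {p : ZMod 2} {X : Mat n} (hX : X ∈ matPart n p) : st X ∈ matPart n p := by
  intro i j h
  change sgn _ * X j i = 0
  rw [hX j i (by rwa [add_comm]), mul_zero]

end LegSystem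

/-! ### The legs of the mixed tensor space -/

section Mixed
variable {r s : ℕ}

lemma site_apply (k : Fin (r + s)) (X : Mat n) (w : Fin (r + s) → Idx n) :
    site k X (mBasis n r s w) =
      ∑ a : Idx n, (sgn ((par a + par (w k)) * ∑ l ∈ Finset.Iio k, par (w l)) * X a (w k)) •
        mBasis n r s (Function.update w k a) :=
  (mBasis n r s).constr_basis K _ w

lemma site_E_apply (k : Fin (r + s)) (a b : Idx n) (w : Fin (r + s) → Idx n) :
    site k (E a b) (mBasis n r s w) =
      if b = w k then sgn ((par a + par b) * ∑ l ∈ Finset.Iio k, par (w l)) •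
        mBasis n r s (Function.update w k a) else 0 := by
  rw [site_apply, Finset.sum_eq_single a]
  · rw [E_apply]
    split_ifs with h1 h2 h3
    · rw [mul_one, h2]
    · exact absurd h1.2 h2
    · exact absurd ⟨rfl, h3⟩ h1
    · simp
  · intro c _ hc
    rw [E_apply, if_neg (by simp [hc.symm]), mul_zero, zero_smul]
  · simp

lemma site_one (k : Fin (r + s)) : site k (1 : Mat n) = 1 := by
  refine (mBasis n r s).ext fun w => ?_
  rw [site_apply, Finset.sum_eq_single (w k)]
  · simp [CharTwo.add_self_eq_zero, sgn_zero]
  · intro a _ ha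
    rw [Matrix.one_apply_ne ha, mul_zero, zero_smul]
  · simp

/-- Changing a letter affects the sign rule only at sites further to the right; this asymmetry is
the source of the supercommutation of different sites. -/
lemma sum_Iio_update (k l : Fin (r + s)) (w : Fin (r + s) → Idx n) (a : Idx n) :
    ∑ x ∈ Finset.Iio l, par (Function.update w k a x) =
      ∑ x ∈ Finset.Iio l, par (w x) + if k < l then par a + par (w k) else 0 := by
  have h : ∀ x, par (Function.update w k a x) =
      par (w x) + if x = k then par a + par (w k) else 0 := by
    intro x
    rcases eq_or_ne x k with rfl | hx
    · rw [Function.update_self, if_pos rfl]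
      generalize par a = a, par (w x) = b
      revert a b; decide
    · rw [Function.update_of_ne hx, if_neg hx, add_zero]
  simp only [h, Finset.sum_add_distrib, Finset.sum_ite_eq', Finset.mem_Iio]

lemma site_mul (k : Fin (r + s)) (X Y : Mat n) :
    (site k (X * Y) : Module.End K (Mixed n r s)) = site k X * site k Y := by
  have : (LinearMap.mul K (Mat n)).compr₂ (site (r := r) (s := s) k) =
      (LinearMap.mul K (Module.End K (Mixed n r s))).compl₁₂ (site k) (site k) := by
    refine mat_hom_ext fun a b => mat_hom_ext fun c d => (mBasis n r s).ext fun w => ?_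
    simp only [LinearMap.compr₂_apply, LinearMap.mul_apply', LinearMap.compl₁₂_apply,
      Module.End.mul_apply]
    rw [E_mul_E, site_E_apply k c d]
    by_cases hd : d = w k
    · rw [if_pos hd, map_smul, site_E_apply, Function.update_self]
      by_cases hb : b = c
      · rw [if_pos hb, if_pos hb, site_E_apply, if_pos hd, sum_Iio_update, if_neg (lt_irrefl k),
          add_zero, Function.update_idem, smul_smul, ← sgn_add, hb]
        congr 2
        generalize (∑ l ∈ Finset.Iio k, par (w l)) = x, par a = a, par c = c, par d = d
        revert x a c d; decide
      · rw [if_neg hb, if_neg hb]; simp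
    · rw [if_neg hd, map_zero]
      split_ifs
      · rw [site_E_apply, if_neg hd]
      · simp
  exact LinearMap.congr_fun₂ this X Y

/-- The parity operator of the mixed tensor space. -/
def mixedJ (n r s : ℕ) : Module.End K (Mixed n r s) :=
  (mBasis n r s).constr K fun w => sgn (∑ k, par (w k)) • mBasis n r s w

lemma mixedJ_apply (w : Fin (r + s) → Idx n) :
    mixedJ n r s (mBasis n r s w) = sgn (∑ k, par (w k)) • mBasis n r s w :=
  (mBasis n r s).constr_basis K _ w

lemma sum_par_update (k : Fin (r + s)) (w : Fin (r + s) → Idx n) (a : Idx n) :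
    ∑ x, par (Function.update w k a x) = ∑ x, par (w x) + (par a + par (w k)) := by
  have h : ∀ x, par (Function.update w k a x) =
      par (w x) + if x = k then par a + par (w k) else 0 := by
    intro x
    rcases eq_or_ne x k with rfl | hx
    · rw [Function.update_self, if_pos rfl]
      generalize par a = a, par (w x) = b
      revert a b; decide
    · rw [Function.update_of_ne hx, if_neg hx, add_zero]
  simp only [h, Finset.sum_add_distrib, Finset.sum_ite_eq', Finset.mem_univ, if_true]

lemma site_comm_of_lt {k l : Fin (r + s)} (h : k < l) (a b c d : Idx n) :
    (site k (E a b) * site l (E c d) : Module.End K (Mixed n r s)) =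
      sgn ((par a + par b) * (par c + par d)) • (site l (E c d) * site k (E a b)) := by
  refine (mBasis n r s).ext fun w => ?_
  simp only [Module.End.mul_apply, LinearMap.smul_apply]
  rw [site_E_apply l, site_E_apply k]
  by_cases hd : d = w l
  · by_cases hb : b = w k
    · rw [if_pos hd, if_pos hb, map_smul, map_smul, site_E_apply, site_E_apply,
        Function.update_of_ne h.ne, Function.update_of_ne h.ne', if_pos hd, if_pos hb,
        sum_Iio_update, sum_Iio_update, if_neg h.asymm, if_pos h, ← hb, smul_smul, smul_smul,
        smul_smul, ← sgn_add, ← sgn_add, ← sgn_add, Function.update_comm h.ne]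
      congr 2
      generalize (∑ x ∈ Finset.Iio k, par (w x)) = x, (∑ x ∈ Finset.Iio l, par (w x)) = y,
        par a = a, par b = b, par c = c, par d = d
      revert x y a b c d; decide
    · rw [if_pos hd, if_neg hb, map_smul, site_E_apply, Function.update_of_ne h.ne, if_neg hb]
      simp
  · rw [if_neg hd]
    split_ifs with hb
    · rw [map_smul, site_E_apply, Function.update_of_ne h.ne', if_neg hd]
      simp
    · simp

/-- The operators in the factors of the mixed tensor space. -/
def mixed (n r s : ℕ) : LegSystem n (Fin (r + s)) (Module.End K (Mixed n r s)) where
  leg k := AlgHom.ofLinearMap (site k) (site_one k) (site_mul k)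
  J := mixedJ n r s
  J_sq := by
    refine (mBasis n r s).ext fun w => ?_
    rw [Module.End.mul_apply, mixedJ_apply, map_smul, mixedJ_apply, smul_smul, sgn_mul_self,
      one_smul, Module.End.one_apply]
  J_leg k a b := by
    refine (mBasis n r s).ext fun w => ?_
    change mixedJ n r s (site k (E a b) _) = sgn (par a + par b) • site k (E a b) (mixedJ n r s _)
    rw [site_E_apply, mixedJ_apply, map_smul, site_E_apply]
    split_ifs with h
    · rw [map_smul, mixedJ_apply, sum_par_update, ← h, smul_smul, smul_smul, smul_smul, ← sgn_add,
        ← sgn_add, ← sgn_add]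
      congr 2
      ring
    · simp
  comm k l h a b c d := by
    change site k (E a b) * site l (E c d) = _ • (site l (E c d) * site k (E a b))
    rcases lt_or_gt_of_ne h with h | h
    · exact site_comm_of_lt h a b c d
    · rw [site_comm_of_lt h c d a b, smul_smul, mul_comm (par c + par d), sgn_mul_self, one_smul]

lemma mixed_leg (k : Fin (r + s)) (X : Mat n) : (mixed n r s).leg k X = site k X := rfl

lemma mixed_two (k l : Fin (r + s)) (Z : Mat2 n) : (mixed n r s).two k l Z = site2 k l Z := by
  have : (mixed n r s).two k l = site2 k l := mat2_hom_ext_tens fun X Y => rfl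
  rw [this]

/-- The homogeneous parts are the eigenspaces of the parity operator, so the parity of an operator
can be read off from how it commutes with `mixedJ`. -/
lemma mem_mixedPart_iff (p : ZMod 2) (x : Mixed n r s) :
    x ∈ mixedPart n r s p ↔ mixedJ n r s x = sgn p • x := by
  constructor
  · intro h
    induction h using Submodule.span_induction with
    | zero => simp
    | add x y _ _ hx hy => rw [map_add, hx, hy, smul_add]
    | smul c x _ hx => rw [map_smul, hx, smul_comm]
    | mem x hx =>
      obtain ⟨w, rfl, rfl⟩ := hx
      exact mixedJ_apply w
  · intro h
    rw [← (mBasis n r s).sum_repr x]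
    refine Submodule.sum_mem _ fun w _ => ?_
    by_cases hw : ∑ k, par (w k) = p
    · exact Submodule.smul_mem _ _ (Submodule.subset_span ⟨w, hw, rfl⟩)
    · have h1 : (mBasis n r s).repr (mixedJ n r s x) w =
          sgn (∑ k, par (w k)) * (mBasis n r s).repr x w := by
        have : ((mBasis n r s).coord w) ∘ₗ mixedJ n r s =
            sgn (∑ k, par (w k)) • (mBasis n r s).coord w := by
          refine (mBasis n r s).ext fun w' => ?_
          rw [LinearMap.comp_apply, mixedJ_apply, map_smul, LinearMap.smul_apply,
            Module.Basis.coord_apply, Module.Basis.repr_self]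
          rcases eq_or_ne w' w with rfl | hne
          · rfl
          · rw [Finsupp.single_eq_of_ne hne.symm, smul_zero, smul_zero]
        exact LinearMap.congr_fun this x
      rw [h, map_smul, Finsupp.smul_apply, smul_eq_mul] at h1
      have h2 : sgn p ≠ sgn (∑ k, par (w k)) := by
        intro e
        have : ∀ a b : ZMod 2, sgn a = sgn b → a = b := by
          intro a b hab
          rcases zmod_two_cases a with rfl | rfl <;> rcases zmod_two_cases b with rfl | rfl <;>
            first
            | rfl
            | (rw [sgn_zero, sgn_one] at hab
               exfalso
               norm_num [eq_neg_iff_add_eq_zero, neg_eq_iff_add_eq_zero] at hab)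
        exact hw (this _ _ e).symm
      have h3 : (mBasis n r s).repr x w = 0 := by
        by_contra h0
        exact h2 (mul_right_cancel₀ h0 h1)
      rw [h3, zero_smul]
      exact Submodule.zero_mem _

lemma mem_endPart {p : ZMod 2} {f : Module.End K (Mixed n r s)}
    (h : mixedJ n r s * f = sgn p • (f * mixedJ n r s)) : f ∈ endPart n r s p := by
  intro p' x hx
  rw [mem_mixedPart_iff] at hx ⊢
  have := LinearMap.congr_fun h x
  rw [Module.End.mul_apply, LinearMap.smul_apply, Module.End.mul_apply, hx, map_smul, smul_smul,
    ← sgn_add] at this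
  exact this

/-! ### Cap and cup -/

/-- This identifies the intrinsic map, inserted without signs, with the matrix `Q` acting by the
sign rule in the two factors at the wall. -/
lemma mid_cap_cup (hr : 0 < r) (hs : 0 < s) :
    mid hr hs (cap n ∘ₗ cup n) = (mixed n r s).e ⟨r - 1, by omega⟩ ⟨r, by omega⟩ := by
  have hlt : (⟨r - 1, by omega⟩ : Fin (r + s)) < ⟨r, by omega⟩ := by
    rw [Fin.lt_def]; dsimp only; omega
  -- The two sites are adjacent, so their sign rules differ by the letter at the first one only; for
  -- an even element the contributions of all earlier letters cancel.
  have hI : ∀ w : Fin (r + s) → Idx n, ∑ l ∈ Finset.Iio (⟨r, by omega⟩ : Fin (r + s)), par (w l) =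
      par (w ⟨r - 1, by omega⟩) +
        ∑ l ∈ Finset.Iio (⟨r - 1, by omega⟩ : Fin (r + s)), par (w l) := by
    intro w
    rw [← Finset.sum_insert (f := fun l => par (w l)) (Finset.notMem_Iio_self)]
    congr 1
    ext x
    simp only [Finset.mem_Iio, Finset.mem_insert, Fin.lt_def, Fin.ext_iff]
    omega
  refine (mBasis n r s).ext fun w => ?_
  have hl : mid hr hs (cap n ∘ₗ cup n) (mBasis n r s w) = _ := (mBasis n r s).constr_basis K _ w
  rw [hl]
  clear hl
  have hI := hI w
  generalize (⟨r - 1, by omega⟩ : Fin (r + s)) = k at *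
  generalize (⟨r, by omega⟩ : Fin (r + s)) = k' at *
  have h1 : cup n (vBasis n (w k) ⊗ₜ[K] wBasis n (w k')) =
      if w k = w k' then sgn (par (w k)) * q ^ (2 * (w k).1 * eps (w k) - (2 * n + 1)) else 0 := by
    rw [← Module.Basis.tensorProduct_apply]
    exact ((vBasis n).tensorProduct (wBasis n)).constr_basis K _ (w k, w k')
  have h2 : ((vBasis n).tensorProduct (wBasis n)).constr K
      (fun ab => mBasis n r s (Function.update (Function.update w k ab.1) k' ab.2))
        (cap n 1) = ∑ i, mBasis n r s (Function.update (Function.update w k i) k' i) := by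
    rw [cap, LinearMap.toSpanSingleton_apply, one_smul, map_sum]
    refine Finset.sum_congr rfl fun i _ => ?_
    rw [← Module.Basis.tensorProduct_apply]
    exact ((vBasis n).tensorProduct (wBasis n)).constr_basis K _ (i, i)
  rw [LinearMap.comp_apply, h1, ← mul_one (ite _ _ _), ← smul_eq_mul, map_smul, map_smul, h2]
  simp only [LegSystem.e, Q, map_sum, map_smul, LegSystem.two_tens, mixed_leg, LinearMap.sum_apply,
    LinearMap.smul_apply, Module.End.mul_apply]
  rw [Finset.smul_sum]
  refine Finset.sum_congr rfl fun i _ => ?_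
  rw [Finset.sum_eq_single (w k')]
  · rw [site_E_apply k', if_pos rfl, map_smul, site_E_apply, Function.update_of_ne hlt.ne,
      sum_Iio_update, if_neg hlt.asymm, add_zero]
    split_ifs with h3 h4 h5
    · rw [hI, h3, smul_smul, smul_smul, Function.update_comm hlt.ne, cw]
      congr 1
      generalize q ^ (2 * (w k').1 * eps (w k') - (2 * n + 1)) = c
      have h5 : sgn (par (w k')) = sgn (par i * par (w k')) *
          sgn ((par i + par (w k')) * (par (w k') + ∑ l ∈ Finset.Iio k, par (w l))) *
          sgn ((par i + par (w k')) * ∑ l ∈ Finset.Iio k, par (w l)) := by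
        rw [← sgn_add, ← sgn_add]
        congr 1
        generalize (∑ l ∈ Finset.Iio k, par (w l)) = x, par i = a, par (w k') = b
        revert x a b; decide
      rw [h5]
      ring
    · exact absurd h3.symm h4
    · exact absurd h5.symm h3
    · simp
  · intro j _ hj
    rw [site_E_apply, if_neg hj, map_zero, smul_zero]
  · simp

end Mixed

lemma Q_eq_smul : Q n = q ^ (-(2 * (n : ℤ) + 1)) • ∑ i : Idx n, ∑ j : Idx n,
    (sgn (par i * par j) * q ^ (2 * j.1 * eps j)) • tens (E i j) (E i j) := by
  rw [Q]
  simp only [Finset.smul_sum, smul_smul]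
  refine Finset.sum_congr rfl fun i _ => Finset.sum_congr rfl fun j _ => ?_
  rw [cw, sub_eq_add_neg, zpow_add₀ q_ne_zero]
  congr 1
  ring

/-! ### Iterated coproducts -/

section
variable {A B : Type} [Ring A] [Algebra K A] [Ring B] [Algebra K B]

lemma map_coprod (f : A →ₐ[K] B) (M : List (Idx n → Idx n → A)) (i j : Idx n) :
    f (coprod M i j) = coprod (M.map fun N i j => f (N i j)) i j := by
  induction M generalizing i with
  | nil => simp only [coprod, List.map_nil]; split_ifs <;> simp
  | cons N M ih => simp only [coprod, List.map_cons, map_sum, map_smul, map_mul, ih]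

lemma coprod_of_lt (M : List (Idx n → Idx n → A)) (hM : ∀ N ∈ M, ∀ i j : Idx n, j < i → N i j = 0)
    {i j : Idx n} (h : j < i) : coprod M i j = 0 := by
  induction M generalizing i with
  | nil => simp [coprod, h.ne']
  | cons N M ih =>
    rw [coprod]
    refine Finset.sum_eq_zero fun k _ => ?_
    rcases lt_or_ge k i with hk | hk
    · rw [hM N (by simp) i k hk, zero_mul, smul_zero]
    · rw [ih (fun N hN => hM N (by simp [hN])) (h.trans_le hk), mul_zero, smul_zero]

/-- For triangular matrices the only path from i to i is the constant one, so diagonal generators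
act as pure tensor products. -/
lemma coprod_diag (M : List (Idx n → Idx n → A))
    (hM : ∀ N ∈ M, ∀ i j : Idx n, j < i → N i j = 0) (i : Idx n) :
    coprod M i i = (M.map fun N => N i i).prod := by
  induction M with
  | nil => simp [coprod]
  | cons N M ih =>
    have hM' : ∀ N ∈ M, ∀ i j : Idx n, j < i → N i j = 0 := fun N hN => hM N (by simp [hN])
    rw [coprod, List.map_cons, List.prod_cons, ← ih hM', Finset.sum_eq_single i]
    · rw [CharTwo.add_self_eq_zero, zero_mul, sgn_zero, one_smul]
    · intro k _ hk
      rcases lt_or_gt_of_ne hk with hk | hk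
      · rw [hM N (by simp) i k hk, zero_mul, smul_zero]
      · rw [coprod_of_lt M hM' hk, mul_zero, smul_zero]
    · simp

end

lemma entry_mem {Z : Mat2 n} (hZ : Z ∈ evenPart n) (i j : Idx n) :
    entry i j Z ∈ matPart n (par i + par j) := by
  induction hZ using Submodule.span_induction with
  | zero => simp
  | add x y _ _ hx hy => rw [map_add]; exact add_mem hx hy
  | smul c x _ hx => rw [map_smul]; exact Submodule.smul_mem _ _ hx
  | mem x hx =>
    obtain ⟨a, b, c, d, h, rfl⟩ := hx
    rw [entry_tens_E]
    split_ifs with h'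
    · obtain ⟨rfl, rfl⟩ := h'
      rw [← h]
      exact E_mem a b
    · exact zero_mem _

/-! ### Transfer matrices and the relations of their entries -/

namespace LegSystem
variable {ι A : Type} [Ring A] [Algebra K A] {L : LegSystem n ι A} {k l m a b : ι}

lemma Jp_leg_of_mem (k : ι) (p : ZMod 2) {p' : ZMod 2} {X : Mat n} (hX : X ∈ matPart n p') :
    L.Jp p * L.leg k X = sgn (p * p') • (L.leg k X * L.Jp p) := by
  rw [mat_eq_sum X]
  simp only [map_sum, map_smul, Finset.sum_mul, Finset.mul_sum, Finset.smul_sum]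
  refine Finset.sum_congr rfl fun c _ => Finset.sum_congr rfl fun d _ => ?_
  rw [smul_mul_assoc, mul_smul_comm, Jp_leg, smul_comm]
  by_cases hp : par c + par d = p'
  · rw [hp]
  · rw [hX c d hp, zero_smul, smul_zero, smul_zero]

/-- The coproduct of the matrices `Z k`, in the legs `k` of a list. -/
def cop (L : LegSystem n ι A) (Z : ι → Mat2 n) (ks : List ι) (i j : Idx n) : A :=
  coprod (ks.map fun k i j => L.leg k (entry i j (Z k))) i j

lemma cop_nil (Z : ι → Mat2 n) (i j : Idx n) : L.cop Z [] i j = if i = j then 1 else 0 := rfl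

lemma cop_cons (Z : ι → Mat2 n) (k : ι) (ks : List ι) (i j : Idx n) :
    L.cop Z (k :: ks) i j = ∑ x : Idx n, sgn ((par i + par x) * (par x + par j)) •
      (L.leg k (entry i x (Z k)) * L.cop Z ks x j) := rfl

lemma Jp_mul_cop {Z : ι → Mat2 n} (hZ : ∀ k, Z k ∈ evenPart n) (ks : List ι) (p : ZMod 2)
    (i j : Idx n) :
    L.Jp p * L.cop Z ks i j = sgn (p * (par i + par j)) • (L.cop Z ks i j * L.Jp p) := by
  induction ks generalizing i with
  | nil =>
    rw [cop_nil]
    split_ifs with h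
    · subst h; simp [CharTwo.add_self_eq_zero, sgn_zero]
    · simp
  | cons k ks ih =>
    rw [cop_cons, Finset.mul_sum, Finset.sum_mul, Finset.smul_sum]
    refine Finset.sum_congr rfl fun x _ => ?_
    rw [mul_smul_comm, ← mul_assoc, Jp_leg_of_mem k p (entry_mem (hZ k) i x), smul_mul_assoc,
      mul_assoc, ih, mul_smul_comm, smul_smul, smul_smul, smul_mul_assoc, smul_smul, mul_assoc,
      ← sgn_add, ← sgn_add, ← sgn_add]
    clear ih
    rw [mul_assoc (L.leg k _)]
    congr 2
    generalize par i = i, par j = j, par x = x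
    revert p i j x; decide

/-- The product of the `Z k` in the legs `k` of a list and `a`. -/
def prodTwo (L : LegSystem n ι A) (Z : ι → Mat2 n) (a : ι) (ks : List ι) : A :=
  (ks.map fun k => L.two k a (Z k)).prod

/-- In the product of matrices over `A`, moving the power of `J` of one factor past the entries of
the next yields the sign (−1)^{(|i|+|x|)(|x|+|j|)} of the coproduct. Thus signed coproducts become
ordinary matrix products. -/
lemma prodTwo_ext {Z : Option ι → Mat2 n} (hZ : ∀ k, Z k ∈ evenPart n) (ks : List ι)
    (i j : Idx n) :
    L.ext.prodTwo Z none (ks.map some) i j =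
      L.cop (fun k => Z (some k)) ks i j * L.Jp (par i + par j) := by
  induction ks generalizing i with
  | nil =>
    change (1 : Matrix (Idx n) (Idx n) A) i j = _
    rw [cop_nil, Matrix.one_apply]
    split_ifs with h
    · subst h; simp [CharTwo.add_self_eq_zero]
    · simp
  | cons k ks ih =>
    change (L.ext.two (some k) none (Z (some k)) * L.ext.prodTwo Z none (ks.map some)) i j = _
    rw [Matrix.mul_apply, cop_cons, Finset.sum_mul]
    refine Finset.sum_congr rfl fun x _ => ?_
    rw [ih, ext_two_none, mul_assoc, ← mul_assoc (L.Jp _), Jp_mul_cop (fun k => hZ (some k)),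
      smul_mul_assoc, mul_smul_comm, smul_mul_assoc, mul_assoc (L.cop _ ks x j), Jp_mul, mul_assoc]
    congr 4
    generalize par i = i, par j = j, par x = x
    revert i j x; decide

/-- Elements commuting with the transfer matrix supercommute with its entries. -/
lemma mul_cop_of_comm {Z : Option ι → Mat2 n} (hZ : ∀ k, Z k ∈ evenPart n) (ks : List ι) {y : A}
    {p : ZMod 2} (hy : ∀ p', L.Jp p' * y = sgn (p' * p) • (y * L.Jp p'))
    (h : incl n A y * L.ext.prodTwo Z none (ks.map some) =
      L.ext.prodTwo Z none (ks.map some) * incl n A y) (i j : Idx n) :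
    y * L.cop (fun k => Z (some k)) ks i j =
      sgn ((par i + par j) * p) • (L.cop (fun k => Z (some k)) ks i j * y) := by
  have h1 := congrFun (congrFun h i) j
  rw [incl_mul_apply, mul_incl_apply, prodTwo_ext hZ, mul_assoc, hy] at h1
  have h2 := congrArg (· * L.Jp (par i + par j)) h1
  simpa only [mul_assoc, Jp_mul_self, mul_one, mul_smul_comm, smul_mul_assoc] using h2

/-- The usual train argument: factors in different legs `k` and different auxiliary legs commute, so
the product can be sorted site by site and R moved through one site at a time. -/
lemma rtt_prod {Z : ι → Mat2 n} (hZ : ∀ k, Z k ∈ evenPart n) {ks : List ι} (hks : ks.Nodup)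
    (ha : a ∉ ks) (hb : b ∉ ks) (hab : a ≠ b)
    (h : ∀ k ∈ ks, L.two k a (Z k) * L.two k b (Z k) * L.R a b =
      L.R a b * L.two k b (Z k) * L.two k a (Z k)) :
    L.prodTwo Z a ks * L.prodTwo Z b ks * L.R a b =
      L.R a b * L.prodTwo Z b ks * L.prodTwo Z a ks := by
  induction ks with
  | nil => simp [prodTwo]
  | cons k ks ih =>
    rw [List.nodup_cons] at hks
    simp only [List.mem_cons, not_or] at ha hb
    have ih := ih hks.2 ha.2 hb.2 (fun k hk => h k (by simp [hk]))
    have hk := h k (by simp)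
    have hc : ∀ (x y : ι), x ≠ y → k ≠ x → x ∉ ks → y ∉ ks → k ≠ y →
        L.prodTwo Z x ks * L.two k y (Z k) = L.two k y (Z k) * L.prodTwo Z x ks := by
      intro x y hxy hkx hx hy hky
      refine (Commute.list_prod_left _ _ fun z hz => ?_).eq
      obtain ⟨m, hm, rfl⟩ := List.mem_map.1 hz
      have hmk : m ≠ k := fun e => hks.1 (e ▸ hm)
      have hmy : m ≠ y := fun e => hy (e ▸ hm)
      exact two_two (hZ m) hmk hkx.symm hmy hxy _
    have e1 : ∀ x, L.prodTwo Z x (k :: ks) = L.two k x (Z k) * L.prodTwo Z x ks := fun x => rfl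
    rw [e1, e1]
    calc L.two k a (Z k) * L.prodTwo Z a ks * (L.two k b (Z k) * L.prodTwo Z b ks) * L.R a b
        = L.two k a (Z k) * (L.prodTwo Z a ks * L.two k b (Z k)) * L.prodTwo Z b ks * L.R a b := by
          simp only [mul_assoc]
      _ = L.two k a (Z k) * L.two k b (Z k) * (L.prodTwo Z a ks * L.prodTwo Z b ks * L.R a b) := by
          rw [hc a b hab (Ne.symm ha.1) ha.2 hb.2 (Ne.symm hb.1)]
          simp only [mul_assoc]
      _ = L.two k a (Z k) * L.two k b (Z k) * L.R a b * L.prodTwo Z b ks * L.prodTwo Z a ks := by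
          rw [ih]; simp only [mul_assoc]
      _ = L.R a b * L.two k b (Z k) * (L.two k a (Z k) * L.prodTwo Z b ks) * L.prodTwo Z a ks := by
          rw [hk]; simp only [mul_assoc]
      _ = _ := by
          rw [← hc b a hab.symm (Ne.symm hb.1) hb.2 ha.2 (Ne.symm ha.1)]
          simp only [mul_assoc]

lemma ext_Jp (p : ZMod 2) :
    L.ext.Jp p = Matrix.diagonal fun i => sgn (p * par i) • L.Jp p := by
  rcases zmod_two_cases p with rfl | rfl
  · simp [sgn_zero]
  · simp only [Jp_one, one_mul]
    rfl

lemma ext_cop_map_some (Z : Option ι → Mat2 n) (ks : List ι) (i j : Idx n) :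
    L.ext.cop Z (ks.map some) i j = incl n A (L.cop (fun k => Z (some k)) ks i j) := by
  rw [cop, cop, map_coprod, List.map_map, List.map_map]
  rfl

lemma ext_prodTwo_some (Z : Option ι → Mat2 n) (a : ι) (ks : List ι) :
    L.ext.prodTwo Z (some a) (ks.map some) = incl n A (L.prodTwo (fun k => Z (some k)) a ks) := by
  rw [prodTwo, prodTwo, map_list_prod, List.map_map, List.map_map]
  congr 2
  funext k
  exact ext_two_some ..

/-- The term splits into the coefficient in the defining relation, a sign and a power of `J`. The
last two depend on neither j nor l and are shared with `rtt_entry_right`, so they cancel in the end.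
-/
lemma rtt_entry_left {u : Matrix (Idx n) (Idx n) A} {f : Idx n → Idx n → A}
    (hu : ∀ i j, u i j = f i j * L.Jp (par i + par j))
    (hf : ∀ p i j, L.Jp p * f i j = sgn (p * (par i + par j)) • (f i j * L.Jp p))
    (X : Mat n) (a b c d l : Idx n) :
    (u * (incl n A (f c l) *
        Matrix.diagonal fun i => sgn ((par c + par l) * par i) • L.Jp (par c + par l)) *
      (L.newLeg X * Matrix.diagonal fun i => sgn ((par l + par d) * par i) • L.Jp (par l + par d)) :
        Matrix (Idx n) (Idx n) A) a b =
      ∑ j, sgn ((par c + par d) * par b) •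
        ((sgn ((par a + par j) * (par c + par l) + (par c + par l) * (par j + par b)) * X j b) •
          (f a j * f c l)) * L.Jp (par a + par b + (par c + par d)) := by
  rw [Matrix.mul_apply]
  refine Finset.sum_congr rfl fun j _ => ?_
  rw [← mul_assoc u, Matrix.mul_diagonal, mul_incl_apply, hu, Matrix.mul_diagonal, newLeg_apply,
    mul_assoc (f a j), hf]
  simp only [smul_mul_assoc, mul_smul_comm, smul_smul, mul_assoc, Jp_mul]
  have h1 : par a + par j + (par c + par l) + (par j + par b + (par l + par d)) =
      par a + par b + (par c + par d) := by
    generalize par a = a, par b = b, par c = c, par d = d, par j = j, par l = l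
    revert a b c d j l; decide
  have h2 : sgn ((par l + par d) * par b) *
      (sgn ((par c + par l) * par j) * sgn ((par a + par j) * (par c + par l))) =
      sgn ((par c + par d) * par b) *
      sgn ((par a + par j) * (par c + par l) + (par c + par l) * (par j + par b)) := by
    simp only [← sgn_add]
    congr 1
    generalize par a = a, par b = b, par c = c, par d = d, par j = j, par l = l
    revert a b c d j l; decide
  rw [h1]
  congr 1
  linear_combination X j b * h2

lemma rtt_entry_right {u : Matrix (Idx n) (Idx n) A} {f : Idx n → Idx n → A}
    (hu : ∀ i j, u i j = f i j * L.Jp (par i + par j))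
    (hf : ∀ p i j, L.Jp p * f i j = sgn (p * (par i + par j)) • (f i j * L.Jp p))
    {c l : Idx n} {X : Mat n} (hX : X ∈ matPart n (par c + par l)) (a b d : Idx n) :
    (L.newLeg X * (Matrix.diagonal fun i => sgn ((par c + par l) * par i) • L.Jp (par c + par l)) *
      (incl n A (f l d) *
        Matrix.diagonal fun i => sgn ((par l + par d) * par i) • L.Jp (par l + par d)) * u :
        Matrix (Idx n) (Idx n) A) a b =
      ∑ j, sgn ((par c + par d) * par b) •
        ((sgn ((par c + par l) * (par j + par b)) * X a j) • (f l d * f j b)) *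
          L.Jp (par a + par b + (par c + par d)) := by
  rw [Matrix.mul_apply]
  refine Finset.sum_congr rfl fun j _ => ?_
  rw [← mul_assoc _ (incl n A _), Matrix.mul_diagonal, mul_incl_apply, hu, Matrix.mul_diagonal,
    newLeg_apply]
  by_cases hp : par a + par j = par c + par l
  · rw [hp]
    simp only [smul_mul_assoc, mul_smul_comm, smul_smul, Jp_mul_self, one_mul]
    rw [mul_assoc (f l d), ← mul_assoc (L.Jp _), hf]
    simp only [smul_mul_assoc, mul_smul_comm, smul_smul, mul_assoc, Jp_mul]
    have h1 : par l + par d + (par j + par b) = par a + par b + (par c + par d) := by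
      revert hp
      generalize par a = a, par b = b, par c = c, par d = d, par j = j, par l = l
      revert a b c d j l; decide
    have h2 : sgn ((par l + par d) * par j) *
        (sgn ((par c + par l) * par j) * sgn ((par l + par d) * (par j + par b))) =
        sgn ((par c + par d) * par b) * sgn ((par c + par l) * (par j + par b)) := by
      simp only [← sgn_add]
      congr 1
      generalize par b = b, par c = c, par d = d, par j = j, par l = l
      revert b c d j l; decide
    rw [h1]
    congr 1
    linear_combination X a j * h2
  · rw [hX a j hp]
    simp

lemma rtt_matrix {Z : Option ι → Mat2 n} (hZ : ∀ k, Z k ∈ evenPart n) {ks : List ι}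
    (hks : ks.Nodup)
    (h : ∀ k ∈ ks, L.ext.ext.two (some (some k)) (some none) (Z (some k)) *
        L.ext.ext.two (some (some k)) none (Z (some k)) * L.ext.ext.R (some none) none =
      L.ext.ext.R (some none) none * L.ext.ext.two (some (some k)) none (Z (some k)) *
        L.ext.ext.two (some (some k)) (some none) (Z (some k))) (c d : Idx n) :
    ∑ l, L.ext.prodTwo Z none (ks.map some) *
        (incl n A (L.cop (fun k => Z (some k)) ks c l) * L.ext.Jp (par c + par l)) *
        (L.newLeg (entry l d (S n)) * L.ext.Jp (par l + par d)) =
      ∑ l, L.newLeg (entry c l (S n)) * L.ext.Jp (par c + par l) *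
        (incl n A (L.cop (fun k => Z (some k)) ks l d) * L.ext.Jp (par l + par d)) *
        L.ext.prodTwo Z none (ks.map some) := by
  let Z2 : Option (Option ι) → Mat2 n := fun o => o.elim 0 Z
  have hZ2 : ∀ k, Z2 k ∈ evenPart n := by
    rintro (_ | k)
    · exact zero_mem _
    · exact hZ k
  have hrtt := rtt_prod (L := L.ext.ext) hZ2 (ks := (ks.map some).map some) (a := some none)
    (b := none) ((hks.map (Option.some_injective _)).map (Option.some_injective _)) (by simp)
    (by simp) (by simp) (by
      intro k hk
      simp only [List.mem_map, exists_exists_and_eq_and] at hk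
      obtain ⟨k, hk, rfl⟩ := hk
      exact h k hk)
  have hUa : L.ext.ext.prodTwo Z2 (some none) ((ks.map some).map some) =
      incl n _ (L.ext.prodTwo Z none (ks.map some)) := ext_prodTwo_some ..
  have hUb : ∀ i j, L.ext.ext.prodTwo Z2 none ((ks.map some).map some) i j =
      incl n _ (L.cop (fun k => Z (some k)) ks i j) * L.ext.Jp (par i + par j) := by
    intro i j
    rw [prodTwo_ext hZ2]
    congr 1
    exact ext_cop_map_some ..
  have hR : ∀ i j, L.ext.ext.R (some none) none i j =
      L.newLeg (entry i j (S n)) * L.ext.Jp (par i + par j) := fun i j => ext_two_none ..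
  rw [hUa] at hrtt
  -- The position (c, d) in the outer auxiliary leg is fixed here; the inner leg stays a matrix,
  -- whose entry (a, b) is taken in `rtt_cop`.
  have h0 := congrFun (congrFun hrtt c) d
  rw [mul_incl_apply, Matrix.mul_apply, Matrix.mul_apply, Finset.sum_mul] at h0
  simpa only [incl_mul_apply, hUb, hR] using h0

/-- The defining relations of `U_q(q(n))` for the entries of the transfer matrix. -/
theorem rtt_cop {Z : Option ι → Mat2 n} (hZ : ∀ k, Z k ∈ evenPart n) {ks : List ι}
    (hks : ks.Nodup)
    (h : ∀ k ∈ ks, L.ext.ext.two (some (some k)) (some none) (Z (some k)) *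
        L.ext.ext.two (some (some k)) none (Z (some k)) * L.ext.ext.R (some none) none =
      L.ext.ext.R (some none) none * L.ext.ext.two (some (some k)) none (Z (some k)) *
        L.ext.ext.two (some (some k)) (some none) (Z (some k)))
    {f : Idx n → Idx n → A} (hf : f = L.cop (fun k => Z (some k)) ks) (a b c d : Idx n) :
    ∑ j : Idx n, ∑ l : Idx n,
        (sgn ((par a + par j) * (par c + par l) + (par c + par l) * (par j + par b)) *
          entry l d (S n) j b) • (f a j * f c l) =
      ∑ j : Idx n, ∑ l : Idx n,
        (sgn ((par c + par l) * (par j + par b)) *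
          entry c l (S n) a j) • (f l d * f j b) := by
  have h0 := rtt_matrix hZ hks h c d
  have hu := prodTwo_ext (L := L) hZ ks
  have hJ := Jp_mul_cop (L := L) (fun k => hZ (some k)) ks
  rw [← hf] at h0 hu hJ
  simp only [ext_Jp] at h0
  have h1 := congrFun (congrFun h0 a) b
  rw [Matrix.sum_apply, Matrix.sum_apply] at h1
  rw [Finset.sum_congr rfl fun l _ => rtt_entry_left hu hJ (entry l d (S n)) a b c d l,
    Finset.sum_congr rfl fun l _ => rtt_entry_right hu hJ (entry_mem S_mem_evenPart c l) a b d] at h1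
  rw [Finset.sum_comm] at h1
  rw [Finset.sum_comm (s := Finset.univ) (t := Finset.univ)
      (f := fun l j => sgn ((par c + par d) * par b) •
        ((sgn ((par c + par l) * (par j + par b)) * entry c l (S n) a j) • (f l d * f j b)) *
          L.Jp (par a + par b + (par c + par d)))] at h1
  simp only [← Finset.sum_mul, ← Finset.smul_sum] at h1
  have h2 := congrArg (· * L.Jp (par a + par b + (par c + par d))) h1
  simp only [mul_assoc, Jp_mul_self, mul_one] at h2
  exact smul_right_injective A (sgn_ne_zero _) h2

end LegSystem

/-! ### Triangularity -/

lemma entry_S_of_lt {i j : Idx n} (h : j < i) : entry i j (S n) = 0 := by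
  rw [S, map_add, map_smul, map_sum, map_sum]
  simp only [map_sum]
  rw [Finset.sum_eq_zero, Finset.sum_eq_zero, smul_zero, add_zero]
  · intro a _
    refine Finset.sum_eq_zero fun b _ => ?_
    split_ifs with hab
    · rw [map_smul, entry_tens, E_apply, if_neg, zero_smul, smul_zero]
      rintro ⟨rfl, rfl⟩
      exact h.asymm hab
    · exact map_zero _
  · intro a _
    refine Finset.sum_eq_zero fun b _ => ?_
    rw [map_smul, entry_tens_E, if_neg, smul_zero]
    rintro ⟨rfl, rfl⟩
    exact lt_irrefl _ h

lemma entry_S_diag (i : Idx n) : entry i i (S n) = ∑ a, q ^ expo a i • E a a := by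
  rw [S, map_add, map_smul, map_sum, map_sum]
  simp only [map_sum]
  rw [Finset.sum_eq_zero (f := fun a => ∑ b, entry i i (if a < b then _ else 0)), smul_zero,
    add_zero]
  · refine Finset.sum_congr rfl fun a _ => ?_
    rw [Finset.sum_eq_single i]
    · rw [map_smul, entry_tens_E, if_pos ⟨rfl, rfl⟩]
    · intro b _ hb
      rw [map_smul, entry_tens_E, if_neg (by simp [hb]), smul_zero]
    · simp
  · intro a _
    refine Finset.sum_eq_zero fun b _ => ?_
    split_ifs with hab
    · rw [map_smul, entry_tens, E_apply, if_neg, zero_smul, smul_zero]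
      rintro ⟨rfl, rfl⟩
      exact lt_irrefl _ hab
    · exact map_zero _

lemma tens_mul_P (a b c d : Idx n) : tens (E a b) (E c d) * P n =
    sgn (par d + (par c + par d) * (par b + par d)) • tens (E a d) (E c b) := by
  unfold P
  rw [Finset.mul_sum, Finset.sum_eq_single b]
  · rw [Finset.mul_sum, Finset.sum_eq_single d]
    · rw [mul_smul_comm, tens_E_mul, if_pos ⟨rfl, rfl⟩, smul_smul, ← sgn_add]
    · intro x _ hx
      rw [mul_smul_comm, tens_E_mul, if_neg (by simp [hx.symm]), smul_zero]
    · simp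
  · intro x _ hx
    rw [Finset.mul_sum]
    refine Finset.sum_eq_zero fun y _ => ?_
    rw [mul_smul_comm, tens_E_mul, if_neg (by simp [hx.symm]), smul_zero]
  · simp

lemma Sinv_eq : Sinv n = (∑ i : Idx n, ∑ j : Idx n, q ^ expo i j • tens (E j j) (E i i)) +
    xi • (∑ i : Idx n, ∑ j : Idx n, (if i < j then
      sgn (par j) • tens (E i j) (E j i) + sgn (par j) • tens (E i j) (E (-j) (-i)) else 0) -
      P n) := by
  have h1 : ∀ i j : Idx n, ((sgn (par i) * q ^ expo i j) • tens (E j i) (E i j)) * P n =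
      q ^ expo i j • tens (E j j) (E i i) := by
    intro i j
    rw [smul_mul_assoc, tens_mul_P, smul_smul]
    congr 1
    rw [mul_right_comm, ← sgn_add, show par i + (par j + (par i + par j) * (par i + par j)) = 0 by
      generalize par i = i, par j = j
      revert i j; decide, sgn_zero, one_mul]
  have h2 : ∀ i j : Idx n, (if i < j then
        tens (E i i) (E j j) - sgn (par i + par j) • tens (E i (-i)) (E (-j) j) else 0) * P n =
      if i < j then
        sgn (par j) • tens (E i j) (E j i) + sgn (par j) • tens (E i j) (E (-j) (-i)) else 0 := by
    intro i j
    split_ifs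
    · rw [sub_mul, smul_mul_assoc, tens_mul_P, tens_mul_P, smul_smul, ← sgn_add,
        CharTwo.add_self_eq_zero, zero_mul, add_zero, sub_eq_add_neg, ← neg_smul, neg_sgn]
      congr 3
      rw [par_neg, par_neg]
      generalize par i = i, par j = j
      revert i j; decide
    · rw [zero_mul]
  rw [Sinv, sub_mul, P_mul_S, add_mul, smul_mul_assoc, smul_mul_assoc, one_mul, smul_sub,
    ← add_sub_assoc]
  simp only [Finset.sum_mul, h1, h2]

lemma entry_P (i j : Idx n) : entry i j (P n) = sgn (par i) • E j i := by
  unfold P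
  simp only [map_sum, map_smul, entry_tens_E]
  rw [Finset.sum_eq_single j, Finset.sum_eq_single i]
  · simp
  · intro b _ hb; simp [hb]
  · simp
  · intro b _ hb; simp [hb]
  · simp

/-- Below the diagonal, the term E_{ij} ⊗ E_{ji} of the ξ-sum in `Sinv_eq` is cancelled exactly by
the subtracted ξP, and no other term contributes. -/
lemma entry_Sinv_of_lt {i j : Idx n} (h : j < i) : entry i j (Sinv n) = 0 := by
  rw [Sinv_eq, map_add, map_smul, map_sub, entry_P]
  simp only [map_sum]
  rw [Finset.sum_eq_zero, zero_add, Finset.sum_eq_single j, Finset.sum_eq_single i, if_pos h,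
    map_add, map_smul, map_smul, entry_tens_E, if_pos ⟨rfl, rfl⟩, entry_tens_E, if_neg,
    smul_zero, add_zero, sub_self, smul_zero]
  · rintro ⟨h1, h2⟩
    have h1 := congrArg Subtype.val h1
    have h2 := congrArg Subtype.val h2
    rw [idx_lt_iff] at h
    rw [idx_val_neg] at h1 h2
    omega
  · intro b _ hb
    split_ifs with hab
    · rw [map_add, map_smul, map_smul, entry_tens_E, if_neg (by simp [hb]), entry_tens_E, if_neg]
      · simp
      · rintro ⟨h1, h2⟩
        have h1 := congrArg Subtype.val h1
        have h2 := congrArg Subtype.val h2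
        rw [idx_lt_iff] at h hab
        rw [idx_val_neg] at h1 h2
        omega
    · exact map_zero _
  · simp
  · intro a _ ha
    refine Finset.sum_eq_zero fun b _ => ?_
    split_ifs with hab
    · rw [map_add, map_smul, map_smul, entry_tens_E, if_neg (by simp [ha]), entry_tens_E, if_neg]
      · simp
      · rintro ⟨h1, h2⟩
        have h1 := congrArg Subtype.val h1
        have h2 := congrArg Subtype.val h2
        rw [idx_lt_iff] at h hab
        rw [idx_val_neg] at h1 h2
        omega
    · exact map_zero _
  · simp
  · intro a _
    refine Finset.sum_eq_zero fun b _ => ?_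
    rw [map_smul, entry_tens_E, if_neg, smul_zero]
    rintro ⟨rfl, rfl⟩
    exact lt_irrefl _ h

/-- The subtracted ξP turns the coefficient at a = i into its inverse, as q − ξ = q⁻¹ and q⁻¹ + ξ =
q. At a = −i, exchanging the arguments of `expo` reverses its sign. -/
lemma entry_Sinv_diag (i : Idx n) : entry i i (Sinv n) = ∑ a, q ^ (-expo a i) • E a a := by
  have h1 : entry i i (Sinv n) = ∑ a, q ^ expo i a • E a a - xi • sgn (par i) • E i i := by
    rw [Sinv_eq, map_add, map_smul, map_sub, entry_P]
    simp only [map_sum]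
    rw [Finset.sum_eq_zero (f := fun a => ∑ b, entry i i (if a < b then (_ : Mat2 n) else 0)),
      zero_sub, smul_neg, ← sub_eq_add_neg]
    · congr 1
      rw [Finset.sum_eq_single i]
      · refine Finset.sum_congr rfl fun a _ => ?_
        rw [map_smul, entry_tens_E, if_pos ⟨rfl, rfl⟩]
      · intro b _ hb
        refine Finset.sum_eq_zero fun a _ => ?_
        rw [map_smul, entry_tens_E, if_neg (by simp [hb]), smul_zero]
      · simp
    · intro a _
      refine Finset.sum_eq_zero fun b _ => ?_
      split_ifs with hab
      · rw [map_add, map_smul, map_smul, entry_tens_E, if_neg, entry_tens_E, if_neg]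
        · simp
        · rintro ⟨h1, h2⟩
          have h1 := congrArg Subtype.val h1
          have h2 := congrArg Subtype.val h2
          rw [idx_lt_iff] at hab
          rw [idx_val_neg] at h1 h2
          omega
        · rintro ⟨rfl, rfl⟩
          exact lt_irrefl _ hab
      · exact map_zero _
  have h2 : xi • sgn (par i) • E i i = ∑ a, (if a = i then xi * sgn (par i) else 0) • E a a := by
    rw [Finset.sum_eq_single i]
    · rw [if_pos rfl, smul_smul]
    · intro b _ hb; rw [if_neg hb, zero_smul]
    · simp
  rw [h1, h2, ← Finset.sum_sub_distrib]
  refine Finset.sum_congr rfl fun a _ => ?_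
  rw [← sub_smul]
  congr 1
  rcases eq_or_ne a i with rfl | hai
  · rw [if_pos rfl, expo, if_pos rfl, if_neg (idx_ne_neg a)]
    unfold par eps xi
    split_ifs
    · rw [sgn_one]; simp
    · rw [sgn_zero]; simp
  · rw [if_neg hai, sub_zero]
    congr 1
    rcases eq_or_ne a (-i) with rfl | hai'
    · rw [expo, expo, idx_neg_neg, if_neg (idx_ne_neg i), if_neg hai, if_pos rfl, if_pos rfl]
      have := idx_ne_zero i
      unfold eps
      rw [idx_val_neg]
      split_ifs <;> omega
    · rw [expo, expo, if_neg hai.symm, if_neg hai, if_neg hai', if_neg]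
      · simp
      · rintro rfl; exact hai' (idx_neg_neg a).symm

lemma expo_neg (a i : Idx n) : expo a (-i) = -expo a i := by
  have := idx_ne_zero i
  unfold expo
  rw [idx_neg_neg, add_comm, show eps (-i) = -eps i by
    unfold eps
    rw [idx_val_neg]
    split_ifs <;> omega]
  ring

lemma diag_mul_diag (c d : Idx n → K) :
    (∑ a, c a • E a a) * (∑ a, d a • E a a) = ∑ a, (c a * d a) • E a a := by
  rw [Finset.sum_mul]
  refine Finset.sum_congr rfl fun a _ => ?_
  rw [Finset.mul_sum, Finset.sum_eq_single a]
  · rw [smul_mul_smul_comm, E_mul_E_same]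
  · intro b _ hb
    rw [smul_mul_smul_comm, E_mul_E_ne _ _ _ _ hb.symm, smul_zero]
  · simp

/-- The matrix by which `U` acts on `V` (`S`) or on its dual. -/
def actMat (n : ℕ) (dual : Bool) : Mat2 n := if dual then st1 (Sinv n) else S n

lemma actMat_mem_evenPart (x : Bool) : actMat n x ∈ evenPart n := by
  cases x
  · exact S_mem_evenPart
  · exact LegSystem.Rs_mem_evenPart

lemma entry_actMat_of_lt (x : Bool) {i j : Idx n} (h : j < i) : entry i j (actMat n x) = 0 := by
  cases x
  · exact entry_S_of_lt h
  · change entry i j (st1 (Sinv n)) = 0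
    rw [entry_st1, entry_Sinv_of_lt h, map_zero]

lemma entry_actMat_diag (x : Bool) (i : Idx n) :
    entry i i (actMat n x) = ∑ a, q ^ (if x then -expo a i else expo a i) • E a a := by
  cases x
  · exact entry_S_diag i
  · change entry i i (st1 (Sinv n)) = _
    rw [entry_st1, entry_Sinv_diag, map_sum]
    refine Finset.sum_congr rfl fun a _ => ?_
    rw [map_smul, st_E, CharTwo.add_self_eq_zero, zero_mul, sgn_zero, one_smul, if_pos rfl]

lemma entry_actMat_diag_mul (x : Bool) (i : Idx n) :
    entry i i (actMat n x) * entry (-i) (-i) (actMat n x) = 1 := by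
  rw [entry_actMat_diag, entry_actMat_diag, diag_mul_diag, one_eq_sum_E]
  refine Finset.sum_congr rfl fun a _ => ?_
  rw [expo_neg, ← zpow_add₀ q_ne_zero]
  cases x <;> simp

/-! ### Products over lists -/

section Lists
variable {M : Type} [Monoid M]

lemma prod_mul_prod_eq_one {ι : Type} {f g : ι → M} {ks : List ι} (hks : ks.Nodup)
    (h1 : ∀ k, f k * g k = 1) (h2 : ∀ k l, k ≠ l → Commute (f k) (g l)) :
    (ks.map f).prod * (ks.map g).prod = 1 := by
  induction ks with
  | nil => simp
  | cons k ks ih =>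
    rw [List.nodup_cons] at hks
    have hc : Commute ((ks.map f).prod) (g k) := Commute.list_prod_left _ _ fun z hz => by
      obtain ⟨m, hm, rfl⟩ := List.mem_map.1 hz
      exact h2 m k fun e => hks.1 (e ▸ hm)
    rw [List.map_cons, List.map_cons, List.prod_cons, List.prod_cons, mul_assoc,
      ← mul_assoc _ (g k), hc.eq, mul_assoc (g k), ih hks.2, mul_one, h1]

/-- The element commutes with the product of two adjacent factors, without having to commute with
either of them. -/
lemma commute_prod_ofFn {N : ℕ} (k : ℕ) (hk : k + 1 < N) (f : Fin N → M) {y : M}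
    (h1 : ∀ m : Fin N, m.1 ≠ k → m.1 ≠ k + 1 → Commute y (f m))
    (h2 : Commute y (f ⟨k, by omega⟩ * f ⟨k + 1, hk⟩)) : Commute y (List.ofFn f).prod := by
  induction k generalizing N with
  | zero =>
    obtain ⟨N, rfl⟩ : ∃ N', N = N' + 2 := ⟨N - 2, by omega⟩
    rw [List.ofFn_succ, List.ofFn_succ, List.prod_cons, List.prod_cons, ← mul_assoc]
    refine Commute.mul_right h2 (Commute.list_prod_right _ _ fun z hz => ?_)
    obtain ⟨m, rfl⟩ := (List.mem_ofFn' _ _).1 hz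
    exact h1 _ (by simp) (by simp)
  | succ k ih =>
    obtain ⟨N, rfl⟩ : ∃ N', N = N' + 1 := ⟨N - 1, by omega⟩
    rw [List.ofFn_succ, List.prod_cons]
    refine Commute.mul_right (h1 _ (by simp) (by simp)) (ih (by omega) _ (fun m hm hm' => ?_) h2)
    exact h1 _ (by simpa using hm) (by simpa using hm')

end Lists

/-! ### The action of `U_q(q(n))` -/

/-- A relation with the generators extends to all homogeneous elements. -/
lemma superPart_comm {X A B : Type} [Ring A] [Algebra K A] [Ring B] [Algebra K B] {g : X → A}
    {π : X → ZMod 2} (f : A →ₐ[K] B) {y : B} {p' : ZMod 2}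
    (h : ∀ x, y * f (g x) = sgn (π x * p') • (f (g x) * y)) {p : ZMod 2} {a : A}
    (ha : a ∈ superPart g π p) : y * f a = sgn (p * p') • (f a * y) := by
  induction ha using Submodule.span_induction with
  | zero => simp
  | add a b _ _ ha hb => rw [map_add, mul_add, add_mul, smul_add, ha, hb]
  | smul c a _ ha => rw [map_smul, mul_smul_comm, smul_mul_assoc, smul_comm, ha]
  | mem a ha =>
    obtain ⟨l, rfl, rfl⟩ := ha
    induction l with
    | nil => simp [sgn_zero]
    | cons x l ih =>
      rw [List.map_cons, List.prod_cons, List.map_cons, List.sum_cons, map_mul, ← mul_assoc, h,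
        smul_mul_assoc, mul_assoc, ih, mul_smul_comm, smul_smul, ← sgn_add, add_mul, mul_assoc]

section
variable {r s : ℕ}

/-- The matrices acting in the factors of the mixed tensor space. -/
def mixedMat (n r s : ℕ) (o : Option (Fin (r + s))) : Mat2 n :=
  o.elim 0 fun k => actMat n (decide (r ≤ k.1))

lemma mixedMat_mem_evenPart (o : Option (Fin (r + s))) : mixedMat n r s o ∈ evenPart n := by
  cases o
  · exact zero_mem _
  · exact actMat_mem_evenPart _

lemma mixedMat_of_lt {k : Fin (r + s)} (h : k.1 < r) : mixedMat n r s (some k) = S n := by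
  change actMat n (decide (r ≤ k.1)) = _
  rw [decide_eq_false (by omega)]
  rfl

lemma mixedMat_of_le {k : Fin (r + s)} (h : r ≤ k.1) :
    mixedMat n r s (some k) = st1 (Sinv n) := by
  change actMat n (decide (r ≤ k.1)) = _
  rw [decide_eq_true h]
  rfl

lemma leg_eq (k : Fin (r + s)) (i j : Idx n) :
    leg k i j = (mixed n r s).leg k (entry i j (mixedMat n r s (some k))) := by
  rw [leg, mixed_leg]
  split_ifs with h
  · rw [mixedMat_of_lt h]
  · rw [mixedMat_of_le (not_lt.1 h), entry_st1, inverse_S]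

lemma uAct_eq : uAct n r s =
    (mixed n r s).cop (fun k => mixedMat n r s (some k)) (List.finRange (r + s)) := by
  funext i j
  rw [uAct, LegSystem.cop, List.ofFn_eq_map]
  congr 2
  funext k i j
  exact leg_eq k i j

lemma uAct_of_lt {i j : Idx n} (h : j < i) : uAct n r s i j = 0 := by
  rw [uAct_eq]
  refine coprod_of_lt _ (fun N hN i j hij => ?_) h
  obtain ⟨k, _, rfl⟩ := List.mem_map.1 hN
  change (mixed n r s).leg k (entry i j (actMat n _)) = 0
  rw [entry_actMat_of_lt _ hij, map_zero]

lemma uAct_diag (i : Idx n) : uAct n r s i i =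
    ((List.finRange (r + s)).map fun k =>
      (mixed n r s).leg k (entry i i (mixedMat n r s (some k)))).prod := by
  rw [uAct_eq, LegSystem.cop, coprod_diag, List.map_map]
  · rfl
  · intro N hN i j hij
    obtain ⟨k, _, rfl⟩ := List.mem_map.1 hN
    change (mixed n r s).leg k (entry i j (actMat n _)) = 0
    rw [entry_actMat_of_lt _ hij, map_zero]

lemma uAct_diag_mul (i : Idx n) : uAct n r s i i * uAct n r s (-i) (-i) = 1 := by
  rw [uAct_diag, uAct_diag]
  refine prod_mul_prod_eq_one (List.nodup_finRange _) (fun k => ?_) fun k l hkl => ?_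
  · rw [← map_mul]
    change (mixed n r s).leg k (entry i i (actMat n _) * entry (-i) (-i) (actMat n _)) = 1
    rw [entry_actMat_diag_mul, map_one]
  · have := LegSystem.leg_comm (L := mixed n r s) hkl
      (entry_mem (mixedMat_mem_evenPart (n := n) (some k)) i i)
      (entry_mem (mixedMat_mem_evenPart (n := n) (some l)) (-i) (-i))
    rwa [CharTwo.add_self_eq_zero, zero_mul, sgn_zero, one_smul] at this

/-- The relation is checked in each factor: it is the Yang-Baxter equation on V and its transposed
form `Rs_Rs_R` on V*. -/
lemma uAct_rtt (a b c d : Idx n) :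
    ∑ j : Idx n, ∑ l : Idx n,
        (sgn ((par a + par j) * (par c + par l) + (par c + par l) * (par j + par b)) *
          entry l d (S n) j b) • (uAct n r s a j * uAct n r s c l) =
      ∑ j : Idx n, ∑ l : Idx n,
        (sgn ((par c + par l) * (par j + par b)) *
          entry c l (S n) a j) • (uAct n r s l d * uAct n r s j b) := by
  refine LegSystem.rtt_cop (L := mixed n r s) mixedMat_mem_evenPart (List.nodup_finRange (r + s))
    (fun k _ => ?_) uAct_eq a b c d
  rcases lt_or_ge k.1 r with h | h
  · rw [mixedMat_of_lt h]
    exact LegSystem.yang_baxter (by simp) (by simp) (by simp)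
  · rw [mixedMat_of_le h]
    exact LegSystem.Rs_Rs_R (by simp) (by simp) (by simp)

/-- For i > j the convention that the free generator is zero agrees with the coproduct formula
because S and S⁻¹ are triangular. -/
lemma lift_uFree (i j : Idx n) :
    FreeAlgebra.lift K (fun x : UGen n => uAct n r s x.1.1 x.1.2) (uFree i j) =
      uAct n r s i j := by
  rw [uFree]
  split_ifs with h
  · rw [FreeAlgebra.lift_ι_apply]
  · rw [map_zero, uAct_of_lt (not_le.1 h)]

/-- The action of `U_q(q(n))` on the mixed tensor space. -/
def uqAction (n r s : ℕ) : Uq n →ₐ[K] Module.End K (Mixed n r s) :=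
  RingQuot.liftAlgHom K ⟨FreeAlgebra.lift K (fun x : UGen n => uAct n r s x.1.1 x.1.2), by
    intro x y h
    cases h with
    | diag i => rw [map_mul, lift_uFree, lift_uFree, uAct_diag_mul, map_one]
    | diag' i =>
      rw [map_mul, lift_uFree, lift_uFree, map_one]
      simpa only [idx_neg_neg] using uAct_diag_mul (n := n) (r := r) (s := s) (-i)
    | rtt a b c d =>
      simp only [map_sum, map_smul, map_mul, lift_uFree]
      exact uAct_rtt a b c d⟩

lemma uqAction_u (i j : Idx n) : uqAction n r s (u i j) = uAct n r s i j := by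
  rw [uqAction, u, RingQuot.liftAlgHom_mkAlgHom_apply, lift_uFree]

lemma Jp_mul_uAct (p : ZMod 2) (i j : Idx n) :
    (mixed n r s).Jp p * uAct n r s i j =
      sgn (p * (par i + par j)) • (uAct n r s i j * (mixed n r s).Jp p) := by
  rw [uAct_eq]
  exact LegSystem.Jp_mul_cop (fun k => mixedMat_mem_evenPart (some k)) _ p i j

/-! ### The action of `BC_{r,s}(q)` -/

lemma lt_of_lt_left {i : ℕ} (h : i < r) : i < r + s := by omega

lemma lt_of_succ_lt_left {i : ℕ} (h : i + 1 < r) : i < r + s := by omega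

lemma add_lt_of_lt_right {i : ℕ} (h : i < s) : r + i < r + s := by omega

lemma add_lt_of_succ_lt_right {i : ℕ} (h : i + 1 < s) : r + i < r + s := by omega

lemma add_succ_lt_of_lt_right {i : ℕ} (h : i + 1 < s) : r + i + 1 < r + s := by omega

lemma succ_lt_of_lt_left {i : ℕ} (h : i + 1 < r) : i + 1 < r + s := by omega

/-- The operator by which a generator acts. -/
def bcGenAct (n : ℕ) {r s : ℕ} : BCGen r s → Module.End K (Mixed n r s)
  | .t _ h => (mixed n r s).T ⟨_, lt_of_succ_lt_left h⟩ ⟨_, succ_lt_of_lt_left h⟩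
  | .ts _ h => (mixed n r s).Ts ⟨_, add_lt_of_succ_lt_right h⟩ ⟨_, add_succ_lt_of_lt_right h⟩
  | .e hr hs => (mixed n r s).e ⟨r - 1, by omega⟩ ⟨r, by omega⟩
  | .c _ h => (mixed n r s).C ⟨_, lt_of_lt_left h⟩
  | .cs _ h => (mixed n r s).Cs ⟨_, add_lt_of_lt_right h⟩

lemma Jp_mul_two {L : LegSystem n (Fin (r + s)) (Module.End K (Mixed n r s))} {Z : Mat2 n}
    (hZ : Z ∈ evenPart n) (p : ZMod 2) (k l : Fin (r + s)) :
    L.Jp p * L.two k l Z = L.two k l Z * L.Jp p := by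
  rcases zmod_two_cases p with rfl | rfl
  · simp
  · rw [LegSystem.Jp_one, LegSystem.J_two hZ]

lemma Jp_mul_bcGenAct (p : ZMod 2) (x : BCGen r s) :
    (mixed n r s).Jp p * bcGenAct n x =
      sgn (p * x.parity) • (bcGenAct n x * (mixed n r s).Jp p) := by
  cases x with
  | t i h => rw [BCGen.parity, mul_zero, sgn_zero, one_smul]; exact Jp_mul_two PS_mem_evenPart ..
  | ts i h =>
    rw [BCGen.parity, mul_zero, sgn_zero, one_smul]
    exact Jp_mul_two LegSystem.Ts_mem_evenPart ..
  | e hr hs => rw [BCGen.parity, mul_zero, sgn_zero, one_smul]; exact Jp_mul_two Q_mem_evenPart ..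
  | c i h => exact LegSystem.Jp_leg_of_mem _ p Phi_mem
  | cs i h => exact LegSystem.Jp_leg_of_mem _ p (LegSystem.st_mem Phi_mem)

lemma transfer_eq : (mixed n r s).ext.prodTwo (mixedMat n r s) none
      ((List.finRange (r + s)).map some) =
    (List.ofFn fun k : Fin (r + s) =>
      (mixed n r s).ext.two (some k) none (mixedMat n r s (some k))).prod := by
  rw [LegSystem.prodTwo, List.map_map, List.ofFn_eq_map]
  rfl

/-- Even operators in adjacent factors that commute with the coproduct of these factors commute
with the transfer matrix. -/
lemma commute_transfer {Z : Mat2 n} (hZ : Z ∈ evenPart n) (k : ℕ) (hk : k + 1 < r + s)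
    (h : Commute ((mixed n r s).ext.two (some ⟨k, by omega⟩) (some ⟨k + 1, hk⟩) Z)
      ((mixed n r s).ext.two (some ⟨k, by omega⟩) none (mixedMat n r s (some ⟨k, by omega⟩)) *
        (mixed n r s).ext.two (some ⟨k + 1, hk⟩) none (mixedMat n r s (some ⟨k + 1, hk⟩)))) :
    Commute (LegSystem.incl n _ ((mixed n r s).two ⟨k, by omega⟩ ⟨k + 1, hk⟩ Z))
      ((mixed n r s).ext.prodTwo (mixedMat n r s) none ((List.finRange (r + s)).map some)) := by
  rw [transfer_eq, ← LegSystem.ext_two_some]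
  refine commute_prod_ofFn k hk _ (fun m hm hm' => ?_) h
  refine LegSystem.two_two hZ ?_ ?_ (by simp) (by simp) _
  · intro e; exact hm (congrArg Fin.val (Option.some.inj e)).symm
  · intro e; exact hm' (congrArg Fin.val (Option.some.inj e)).symm

lemma commute_transfer_leg {X : Mat n} (k : Fin (r + s))
    (h : Commute ((mixed n r s).ext.leg (some k) X)
      ((mixed n r s).ext.two (some k) none (mixedMat n r s (some k)))) :
    Commute (LegSystem.incl n _ ((mixed n r s).leg k X))
      ((mixed n r s).ext.prodTwo (mixedMat n r s) none ((List.finRange (r + s)).map some)) := by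
  rw [transfer_eq, ← LegSystem.ext_leg_some]
  refine Commute.list_prod_right _ _ fun z hz => ?_
  obtain ⟨m, rfl⟩ := (List.mem_ofFn' _ _).1 hz
  rcases eq_or_ne m k with rfl | hm
  · exact h
  · refine (LegSystem.two_leg (mixedMat_mem_evenPart _) ?_ (by simp) _).symm
    intro e; exact hm (Option.some.inj e)

/-- Each generator is an intertwiner for the one or two factors it touches. For `e` both products
with the transfer factors collapse to `e` itself, by the invariance of the cup and of the cap. -/
lemma bcGenAct_commute (x : BCGen r s) : Commute (LegSystem.incl n _ (bcGenAct n x))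
    ((mixed n r s).ext.prodTwo (mixedMat n r s) none ((List.finRange (r + s)).map some)) := by
  cases x with
  | t i h =>
    refine commute_transfer PS_mem_evenPart i (by omega) ?_
    rw [mixedMat_of_lt (by dsimp only; omega), mixedMat_of_lt (by dsimp only; omega)]
    exact LegSystem.T_mul_R_R (by simp) (by simp) (by simp)
  | ts i h =>
    refine commute_transfer LegSystem.Ts_mem_evenPart (r + i) (by omega) ?_
    rw [mixedMat_of_le (by dsimp only; omega), mixedMat_of_le (by dsimp only; omega)]
    exact LegSystem.Ts_mul_Rs_Rs (by simp) (by simp) (by simp)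
  | e hr hs =>
    -- The site of the first dual factor is written as the successor of r − 1 to fit the form of
    -- adjacent sites.
    have hr1 : (⟨r, by omega⟩ : Fin (r + s)) = ⟨r - 1 + 1, by omega⟩ :=
      Fin.ext (Nat.succ_pred_eq_of_pos hr).symm
    rw [bcGenAct, hr1]
    refine commute_transfer Q_mem_evenPart (r - 1) (by omega) ?_
    rw [mixedMat_of_lt (by dsimp only; omega), mixedMat_of_le (by dsimp only; omega)]
    change _ * _ = _ * _
    rw [LegSystem.e_mul_R_Rs (by simp) (by simp) (by simp),
      LegSystem.R_Rs_mul_e (by simp) (by simp) (by simp)]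
  | c i h =>
    refine commute_transfer_leg _ ?_
    rw [mixedMat_of_lt (by dsimp only; omega)]
    exact (LegSystem.R_mul_C (by simp)).symm
  | cs i h =>
    refine commute_transfer_leg _ ?_
    rw [mixedMat_of_le (by dsimp only; omega)]
    exact (LegSystem.Rs_mul_Cs (by simp)).symm

lemma bcGenAct_mul_uAct (x : BCGen r s) (i j : Idx n) :
    bcGenAct n x * uAct n r s i j =
      sgn ((par i + par j) * x.parity) • (uAct n r s i j * bcGenAct n x) := by
  rw [uAct_eq]
  exact LegSystem.mul_cop_of_comm mixedMat_mem_evenPart _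
    (fun p' => Jp_mul_bcGenAct p' x) (bcGenAct_commute x).eq i j

end

/-! ### The relations of the walled Brauer-Clifford superalgebra and its action -/

section
variable {r s : ℕ}

lemma fin_ne {N a b : ℕ} (ha : a < N) (hb : b < N) (h : a ≠ b) : (⟨a, ha⟩ : Fin N) ≠ ⟨b, hb⟩ :=
  fun e => h (congrArg Fin.val e)

open LegSystem in
lemma bcGenAct_rel {x y : FreeAlgebra K (BCGen r s)} (h : BCRel r s x y) :
    FreeAlgebra.lift K (bcGenAct n) x = FreeAlgebra.lift K (bcGenAct n) y := by
  have odd : sgn (1 * 1) = -1 := by rw [one_mul, sgn_one]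
  cases h <;>
    simp only [ft, fts, fe, fc, fcs, ftInv, map_mul, map_sub, map_smul, map_one, map_zero,
      map_neg, AlgHom.commutes, FreeAlgebra.lift_ι_apply, bcGenAct, pow_two]
  case t_quad i h =>
    rw [T_sq (fin_ne _ _ (by omega)), add_sub_cancel_left, sub_self]
  case t_braid i h =>
    exact braid (fin_ne _ _ (by omega)) (fin_ne _ _ (by omega)) (fin_ne _ _ (by omega))
  case ts_quad i h =>
    rw [Ts_sq (fin_ne _ _ (by omega)), add_sub_cancel_left, sub_self]
  case ts_braid i h =>
    exact Ts_braid (fin_ne _ _ (by omega)) (fin_ne _ _ (by omega)) (fin_ne _ _ (by omega))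
  case t_comm i j hi hj h =>
    exact two_two PS_mem_evenPart (fin_ne _ _ (by omega)) (fin_ne _ _ (by omega))
      (fin_ne _ _ (by omega)) (fin_ne _ _ (by omega)) _
  case t_ts i j hi hj =>
    exact two_two PS_mem_evenPart (fin_ne _ _ (by omega)) (fin_ne _ _ (by omega))
      (fin_ne _ _ (by omega)) (fin_ne _ _ (by omega)) _
  case ts_comm i j hi hj h =>
    exact two_two Ts_mem_evenPart (fin_ne _ _ (by omega)) (fin_ne _ _ (by omega))
      (fin_ne _ _ (by omega)) (fin_ne _ _ (by omega)) _
  case e_sq hr hs => exact LegSystem.e_sq (fin_ne _ _ (by omega))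
  case e_t_e hr hs =>
    simp only [show r - 2 + 1 = r - 1 by omega]
    exact e_T_e (fin_ne _ _ (by omega)) (fin_ne _ _ (by omega)) (fin_ne _ _ (by omega))
  case e_t hr hs j hj h =>
    exact two_two Q_mem_evenPart (fin_ne _ _ (by omega)) (fin_ne _ _ (by omega))
      (fin_ne _ _ (by omega)) (fin_ne _ _ (by omega)) _
  case e_ts_e hr hs =>
    exact e_Ts_e (fin_ne _ _ (by omega)) (fin_ne _ _ (by omega)) (fin_ne _ _ (by omega))
  case e_ts hr hs j hj h =>
    exact two_two Q_mem_evenPart (fin_ne _ _ (by omega)) (fin_ne _ _ (by omega))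
      (fin_ne _ _ (by omega)) (fin_ne _ _ (by omega)) _
  case e_long hr hs =>
    -- The element t − ξ standing for the inverse generator is recognised as (PS)⁻¹ in the legs, so
    -- that the long relation takes the form of `e_long`.
    simp only [show r - 2 + 1 = r - 1 by omega, Algebra.algebraMap_eq_smul_one, ← Ti_eq]
    exact LegSystem.e_long (fin_ne _ _ (by omega)) (fin_ne _ _ (by omega)) (fin_ne _ _ (by omega))
      (fin_ne _ _ (by omega)) (fin_ne _ _ (by omega)) (fin_ne _ _ (by omega))
  case c_sq i h => exact C_sq
  case c_c i j hi hj h =>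
    rw [leg_comm (fin_ne _ _ h) Phi_mem Phi_mem, odd, neg_one_smul]
  case c_cs i j hi hj =>
    rw [leg_comm (fin_ne _ _ (by omega)) Phi_mem (st_mem Phi_mem), odd, neg_one_smul]
  case cs_sq i h => exact Cs_sq
  case cs_cs i j hi hj h =>
    rw [leg_comm (fin_ne _ _ (by omega)) (st_mem Phi_mem) (st_mem Phi_mem), odd, neg_one_smul]
  case t_c i h => exact T_mul_C (fin_ne _ _ (by omega))
  case t_c_comm i j hi hj h h' =>
    exact two_leg PS_mem_evenPart (fin_ne _ _ (by omega)) (fin_ne _ _ (by omega)) _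
  case ts_cs i h => exact Ts_mul_Cs (fin_ne _ _ (by omega))
  case ts_cs_comm i j hi hj h h' =>
    exact two_leg Ts_mem_evenPart (fin_ne _ _ (by omega)) (fin_ne _ _ (by omega)) _
  case t_cs i j hi hj =>
    exact two_leg PS_mem_evenPart (fin_ne _ _ (by omega)) (fin_ne _ _ (by omega)) _
  case ts_c i j hi hj =>
    exact two_leg Ts_mem_evenPart (fin_ne _ _ (by omega)) (fin_ne _ _ (by omega)) _
  case c_e hr hs => exact C_mul_e (fin_ne _ _ (by omega))
  case e_c hr hs => exact e_mul_C (fin_ne _ _ (by omega))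
  case c_e_comm hr hs j hj h =>
    exact (two_leg Q_mem_evenPart (fin_ne _ _ (by omega)) (fin_ne _ _ (by omega)) _).symm
  case cs_e_comm hr hs j hj h =>
    exact (two_leg Q_mem_evenPart (fin_ne _ _ (by omega)) (fin_ne _ _ (by omega)) _).symm
  case e_c_e hr hs => exact e_C_e (fin_ne _ _ (by omega))

/-- The action of `BC_{r,s}(q)` on the mixed tensor space. -/
def bcAction (n r s : ℕ) : BC r s →ₐ[K] Module.End K (Mixed n r s) :=
  RingQuot.liftAlgHom K ⟨FreeAlgebra.lift K (bcGenAct n), fun _ _ => bcGenAct_rel⟩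

lemma bcAction_bc (x : BCGen r s) : bcAction n r s (bc x) = bcGenAct n x := by
  rw [bcAction, bc, RingQuot.liftAlgHom_mkAlgHom_apply, FreeAlgebra.lift_ι_apply]

lemma uqAction_mem_endPart {p : ZMod 2} {x : Uq n} (hx : x ∈ uqPart n p) :
    uqAction n r s x ∈ endPart n r s p := by
  refine mem_endPart ?_
  have := superPart_comm (uqAction n r s) (y := mixedJ n r s) (p' := 1) (fun x => ?_) hx
  · rwa [mul_one] at this
  · rw [uqAction_u, mul_one]
    have := Jp_mul_uAct (n := n) (r := r) (s := s) 1 x.1.1 x.1.2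
    rwa [one_mul, LegSystem.Jp_one] at this

lemma bcAction_mem_endPart {p : ZMod 2} {y : BC r s} (hy : y ∈ bcPart r s p) :
    bcAction n r s y ∈ endPart n r s p := by
  refine mem_endPart ?_
  have := superPart_comm (bcAction n r s) (y := mixedJ n r s) (p' := 1) (fun x => ?_) hy
  · rwa [mul_one] at this
  · rw [bcAction_bc, mul_one]
    have := Jp_mul_bcGenAct (n := n) 1 x
    rwa [one_mul, LegSystem.Jp_one] at this

lemma bcAction_mul_uqAction {p p' : ZMod 2} {x : Uq n} (hx : x ∈ uqPart n p) {y : BC r s}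
    (hy : y ∈ bcPart r s p') :
    bcAction n r s y * uqAction n r s x =
      sgn (p * p') • (uqAction n r s x * bcAction n r s y) := by
  -- Supercommutation is extended in two stages: to all homogeneous x for a fixed generator of BC,
  -- then with x fixed to all homogeneous y.
  have h1 : ∀ z : BCGen r s, uqAction n r s x * bcAction n r s (bc z) =
      sgn (z.parity * p) • (bcAction n r s (bc z) * uqAction n r s x) := by
    intro z
    have h := superPart_comm (uqAction n r s) (y := bcAction n r s (bc z)) (p' := z.parity)
      (fun x => by rw [uqAction_u, bcAction_bc, bcGenAct_mul_uAct]) hx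
    rw [h, smul_smul, mul_comm p, sgn_mul_self, one_smul]
  rw [superPart_comm (bcAction n r s) h1 hy, smul_smul, mul_comm p, sgn_mul_self, one_smul]

end

end QueerBC

end

open QueerBC

theorem mainTheorem2 (n r s : ℕ) :
    -- `S` is invertible, so that the action on the dual is meaningful
    IsUnit (S n) ∧
    ∃ σ : Uq n →ₐ[K] Module.End K (Mixed n r s),
    ∃ ρ : BC r s →ₐ[K] Module.End K (Mixed n r s),
      -- `σ` is the action of `U_q(q(n))` given by the coproduct and the antipode
      (∀ i j : Idx n, σ (u i j) = uAct n r s i j) ∧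
      (∀ p : ZMod 2, ∀ x ∈ uqPart n p, σ x ∈ endPart n r s p) ∧
      -- `ρ` is an action of the superalgebra `BC_{r,s}(q)`, with the stated action of generators
      (∀ p : ZMod 2, ∀ y ∈ bcPart r s p, ρ y ∈ endPart n r s p) ∧
      (∀ (i : ℕ) (h : i + 1 < r),
        ρ (bc (.t i h)) = site2 ⟨i, by omega⟩ ⟨i + 1, by omega⟩ (P n * S n)) ∧
      (∀ (i : ℕ) (h : i < r),
        ρ (bc (.c i h)) = site ⟨i, by omega⟩ (Phi n)) ∧
      (∀ (i : ℕ) (h : i + 1 < s),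
        ρ (bc (.ts i h)) =
          site2 ⟨r + i, by omega⟩ ⟨r + i + 1, by omega⟩ (st2 (P n) * st2 (S n))) ∧
      (∀ (i : ℕ) (h : i < s),
        ρ (bc (.cs i h)) = site ⟨r + i, by omega⟩ (st (Phi n))) ∧
      (∀ (hr : 0 < r) (hs : 0 < s),
        ρ (bc (.e hr hs)) = mid hr hs (cap n ∘ₗ cup n)) ∧
      -- the two actions supercommute
      (∀ p p' : ZMod 2, ∀ x ∈ uqPart n p, ∀ y ∈ bcPart r s p',
        ρ y * σ x = sgn (p * p') • (σ x * ρ y)) ∧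
      -- the explicit formulas
      P n * S n =
        (∑ i : Idx n, ∑ j : Idx n, (sgn (par i) * q ^ expo i j) • tens (E j i) (E i j)) +
        xi • ∑ i : Idx n, ∑ j : Idx n,
          (if i < j then
            tens (E i i) (E j j) - sgn (par i + par j) • tens (E i (-i)) (E (-j) j)
          else 0) ∧
      st2 (P n) * st2 (S n) =
        (∑ i : Idx n, ∑ j : Idx n, (sgn (par i) * q ^ expo i j) • tens (E j i) (E i j)) +
        xi • ∑ i : Idx n, ∑ j : Idx n,
          (if j < i then tens (E i i) (E j j) - tens (E i (-i)) (E (-j) j) else 0) ∧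
      st (Phi n) = ∑ i : Idx n, E i (-i) ∧
      (∀ (hr : 0 < r) (hs : 0 < s),
        mid hr hs (cap n ∘ₗ cup n) =
          site2 ⟨r - 1, by omega⟩ ⟨r, by omega⟩
            (q ^ (-(2 * (n : ℤ) + 1)) • ∑ i : Idx n, ∑ j : Idx n,
              (sgn (par i * par j) * q ^ (2 * j.1 * eps j)) • tens (E i j) (E i j))) := by
  refine ⟨isUnit_S, uqAction n r s, bcAction n r s, uqAction_u, fun p x => uqAction_mem_endPart,
    fun p y => bcAction_mem_endPart, fun i h => ?_, fun i h => ?_, fun i h => ?_, fun i h => ?_,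
    fun hr hs => ?_, fun p p' x hx y hy => bcAction_mul_uqAction hx hy, P_mul_S, st2_P_mul_st2_S,
    st_Phi, fun hr hs => ?_⟩
  · rw [bcAction_bc]
    exact mixed_two _ _ _
  · rw [bcAction_bc]
    rfl
  · rw [bcAction_bc]
    exact mixed_two _ _ _
  · rw [bcAction_bc]
    rfl
  · rw [bcAction_bc, mid_cap_cup]
    rfl
  · rw [mid_cap_cup, ← Q_eq_smul]
    exact mixed_two _ _ _
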